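/- Let $n\ge 2$ be an integer and let $\rho:[0,\infty)\to[0,\infty)$ be \emph{suitable}: $\rho$ is smooth on $[0,\infty)$, positive on $(0,\infty)$, $\rho(0)=0$, $\rho'(0)>0$, $\rho'>0$ and $(\rho'/\rho)'<0$ on $(0,\infty)$, and $\int_0^\infty e^{ty}\rho(y)\,dy=+\infty$ for all $t>0$. Let $\alpha\ge 0$ be real. Let $\mathbb{H}^n=\{(x,y)\in\mathbb{R}^{n-1}\times\mathbb{R}: y>0\}$, and let $R_\alpha:\mathbb{H}^n\times\mathbb{H}^n\to\mathbb{R}$ be the harmonic Bergman kernel for the weight $\rho(y)^\alpha$, i.e. the reproducing kernel of the space of harmonic functions $f$ on $\mathbb{H}^n$ with $\int_{\mathbb{H}^n}|f(x,y)|^2\rho(y)^\alpha\,dx\,dy<\infty$: for each $(a,b)\in\mathbb{H}^n$ the function $R_\alpha(a,b;\cdot,\cdot)$ lies in this space, and $f(a,b)=\int_{\mathbb{H}^n} f(x,y)\,R_\alpha(a,b;x,y)\,\rho(y)^\alpha\,dx\,dy$ for every $f$ in it. Let $\mathcal{S}^{n-1}=\{(z,x+iy)\in\mathbb{C}^{n-2}\times\mathbb{C}: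 y>|z|^2\}$ be the Siegel domain, let $K_\alpha$ be the holomorphic Bergman kernel of $\mathcal{S}^{n-1}$ for the weight $\rho(y-|z|^2)^\alpha$, i.e. the reproducing kernel of the space of holomorphic functions $f$ on $\mathcal{S}^{n-1}$ with $\int_{\mathcal{S}^{n-1}}|f|^2\rho(y-|z|^2)^\alpha<\infty$ (Lebesgue measure), and put $K^0_\alpha(w;W)=K_\alpha(0,w;0,W)$ for $w,W\in\mathbb{C}$ with $\operatorname{Im}w,\operatorname{Im}W>0$. Let $\omega_{m}=2\pi^{m/2}/\Gamma(m/2)$ be the area of the unit sphere in $\mathbb{R}^m$. Then both kernels exist, and for all $a\in\mathbb{R}^{n-1}$, $b>0$ and $s\in\mathbb{R}$, $$R_\alpha(a,b;a,b)=2^{4-2n}\,\omega_{n-1}\,K^0_\alpha(s+ib;s+ib)=2^{4-2n}\,\omega_{n-1}\,K^0_\alpha(ib;ib).$$ -/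

import Mathlib

open MeasureTheory Set
open scoped ContDiff ComplexConjugate

noncomputable section

/-- The measure `wt(x)^α dx` on `Ω`, where `dx` is the Lebesgue measure. -/
def weightedMeasure {E : Type*} [MeasureSpace E] (Ω : Set E) (wt : E → ℝ) (α : ℝ) : Measure E :=
  (volume.restrict Ω).withDensity (fun x => ENNReal.ofReal (wt x ^ α))

/-- The weighted harmonic Bergman space: the complex-valued functions that are harmonic on `Ω` and
square integrable on `Ω` with respect to `wt^α dx`. Values outside `Ω` play no role. -/
def harmonicBergmanSpace {E : Type*} [NormedAddCommGroup E] [InnerProductSpace ℝ E]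
    [FiniteDimensional ℝ E] [MeasureSpace E] (Ω : Set E) (wt : E → ℝ) (α : ℝ) : Set (E → ℂ) :=
  {f | InnerProductSpace.HarmonicOnNhd f Ω ∧ MemLp f 2 (weightedMeasure Ω wt α)}

/-- The weighted holomorphic Bergman space: the functions that are holomorphic on `Ω` and
square integrable on `Ω` with respect to `wt^α dx`. Values outside `Ω` play no role. -/
def holomorphicBergmanSpace {E : Type*} [NormedAddCommGroup E] [NormedSpace ℂ E]
    [MeasureSpace E] (Ω : Set E) (wt : E → ℝ) (α : ℝ) : Set (E → ℂ) :=
  {f | DifferentiableOn ℂ f Ω ∧ MemLp f 2 (weightedMeasure Ω wt α)}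

/-- `R` is the (real-valued) reproducing kernel of the weighted harmonic Bergman space on `Ω`. -/
def IsHarmonicBergmanKernel {E : Type*} [NormedAddCommGroup E] [InnerProductSpace ℝ E]
    [FiniteDimensional ℝ E] [MeasureSpace E] (Ω : Set E) (wt : E → ℝ) (α : ℝ)
    (R : E → E → ℝ) : Prop :=
  ∀ p ∈ Ω, (fun q => (R p q : ℂ)) ∈ harmonicBergmanSpace Ω wt α ∧
    ∀ f ∈ harmonicBergmanSpace Ω wt α, f p = ∫ q, f q * (R p q : ℂ) ∂(weightedMeasure Ω wt α)

/-- `K` is the reproducing kernel of the weighted holomorphic Bergman space on `Ω`; it is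
holomorphic in its first and antiholomorphic in its second argument. -/
def IsHolomorphicBergmanKernel {E : Type*} [NormedAddCommGroup E] [NormedSpace ℂ E]
    [MeasureSpace E] (Ω : Set E) (wt : E → ℝ) (α : ℝ) (K : E → E → ℂ) : Prop :=
  ∀ p ∈ Ω, (fun q => K q p) ∈ holomorphicBergmanSpace Ω wt α ∧
    ∀ f ∈ holomorphicBergmanSpace Ω wt α,
      f p = ∫ q, f q * conj (K q p) ∂(weightedMeasure Ω wt α)

/-- Suitable functions on `[0, ∞)`; values at negative arguments play no role. -/
structure Suitable (ρ : ℝ → ℝ) : Prop where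
  pos : ∀ y, 0 < y → 0 < ρ y
  smooth : ContDiffOn ℝ ∞ ρ (Ici 0)
  zero : ρ 0 = 0
  deriv_zero_pos : 0 < derivWithin ρ (Ici 0) 0
  lintegral_eq_top : ∀ t : ℝ, 0 < t →
    ∫⁻ y in Ioi (0 : ℝ), ENNReal.ofReal (Real.exp (t * y) * ρ y) = ⊤
  deriv_pos : ∀ y, 0 < y → 0 < deriv ρ y
  deriv_logDeriv_neg : ∀ y, 0 < y → deriv (fun s => deriv ρ s / ρ s) y < 0

/-- The Euclidean space `ℝ^{n-1} × ℝ`. -/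
abbrev HalfSpaceAmbient (n : ℕ) : Type := WithLp 2 (EuclideanSpace ℝ (Fin (n - 1)) × ℝ)

/-- The half-space `{(x, y) ∈ ℝ^{n-1} × ℝ : y > 0}`. -/
def halfSpace (n : ℕ) : Set (HalfSpaceAmbient n) := {p | 0 < p.snd}

/-- The weight `ω(x, y) = ρ(y)` on the half-space. -/
def halfSpaceWeight (n : ℕ) (ρ : ℝ → ℝ) (p : HalfSpaceAmbient n) : ℝ := ρ p.snd

/-- The space `ℂ^{n-2} × ℂ`, with the product topology and the product Lebesgue measure. -/
abbrev SiegelAmbient (n : ℕ) : Type := (Fin (n - 2) → ℂ) × ℂ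

/-- The function `(z, x + iy) ↦ y - |z|²`, with the Euclidean norm of `z`. -/
def siegelHeight (n : ℕ) (p : SiegelAmbient n) : ℝ := p.2.im - ∑ j, ‖p.1 j‖ ^ 2

/-- The Siegel domain `{(z, x + iy) ∈ ℂ^{n-2} × ℂ : y > |z|²}`. -/
def siegelDomain (n : ℕ) : Set (SiegelAmbient n) := {p | 0 < siegelHeight n p}

/-- The weight `ω(z, x + iy) = ρ(y - |z|²)` on the Siegel domain. -/
def siegelWeight (n : ℕ) (ρ : ℝ → ℝ) (p : SiegelAmbient n) : ℝ := ρ (siegelHeight n p)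

/-- The restriction `K⁰(w; W) = K(0, w; 0, W)` of a kernel on `ℂ^{n-2} × ℂ`. -/
def kernelZero {n : ℕ} (K : SiegelAmbient n → SiegelAmbient n → ℂ) (w W : ℂ) : ℂ :=
  K (0, w) (0, W)

/-- The area `2 π^{m/2} / Γ(m/2)` of the unit sphere in `ℝ^m`. -/
def sphereArea (m : ℕ) : ℝ := 2 * Real.pi ^ ((m : ℝ) / 2) / Real.Gamma ((m : ℝ) / 2)

end

/-!
The two kernels are computed by Fourier analysis in the horizontal variable and their diagonals are
compared.

*Harmonic functions on `V × (0, ∞)`.* Let `ν` be a measure in the height `y` that dominates a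
multiple of the Lebesgue measure away from `y = 0`; the weight `ρ(y)^α dy` is of this kind because
`ρ` is increasing. A harmonic function `f` with `∫∫ |f|² dx dν(y) < ∞` has the form
`f(x, y) = ∫ exp (2πi ⟪ξ, x⟫ - 2π y ‖ξ‖) A(ξ) dξ` (`exists_eq_harmonicExt`). The reason is that the
energy `y ↦ ∫ |f(x, y)|² dx` of the slices lies below its chords (`sliceEnergy_le_chord`, since
`|f|²` is subharmonic), so that it decreases as soon as it does not tend to infinity. Hence the
difference of `f` and the harmonic extension of one of its slices has energy tending to `0` at the
boundary and vanishes (`eq_zero_of_sliceEnergy_tendsto_zero`). By Plancherel the norm of `f` is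
`∫ |A(ξ)|² L(ξ) dξ`, where `L(ξ) = ∫ exp (-4π y ‖ξ‖) dν(y)` is the Laplace transform of `ν`
(`poissonLaplace`). Therefore the reproducing kernel at `(a, b)` is the harmonic function with
symbol `exp (-2πi ⟪ξ, a⟫ - 2π b ‖ξ‖) / L(ξ)` (`eq_integral_mul_conj_harmonicKernel`), and its
diagonal value is `∫ exp (-4π b ‖ξ‖) / L(ξ) dξ`. Values `L(ξ) = ∞` are allowed: there `A` vanishes
almost everywhere and `1 / L(ξ) = 0`. In polar coordinates of `ℝ^{n-1}` the diagonal is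
`ω_{n-1} ∫₀^∞ t^{n-2} exp (-4π b t) / L(t) dt` (`harmonicKernel_univ_self`).

*Holomorphic functions on the Siegel domain.* On the upper half-plane, a holomorphic function is a
harmonic function with spectrum in `(0, ∞)`, by the Cauchy-Riemann equation
(`ae_eq_zero_of_differentiableOn`), so the holomorphic kernel is the part of the harmonic kernel
with positive frequencies (`planeKernel`). For a function on the Siegel domain, averaging over the
rotations `z ↦ exp (iθ) z` replaces `f(z, w)` by `f(0, w)`. This reduces the kernel at `(0, w₀)` to
the kernel of the upper half-plane for the distribution `ν'` of `h + |z|²` under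
`dz ρ(h)^α dh` (`eq_integral_mul_conj_siegel`); the other points are reached by the Heisenberg
translations. A Gaussian integral gives `L'(t) = (4t)^{-(n-2)} L(t)` for the Laplace transform of
`ν'` (`poissonLaplace_siegelHeightMeasure`), so the diagonal at `(0, s + ib)` is
`4^{n-2} ∫₀^∞ t^{n-2} exp (-4π b t) / L(t) dt` (`kernelZero_siegelKernel_self`), which differs from
the diagonal of the half-space by the factor `2^{4-2n} ω_{n-1}`. Finally, the value of a reproducing
kernel on the diagonal is unique.
-/

open Filter Topology WithLp
open scoped FourierTransform RealInnerProductSpace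

/-! ### The Fourier transform of integrable square integrable functions -/

section Plancherel

variable {V : Type*} [NormedAddCommGroup V] [InnerProductSpace ℝ V] [FiniteDimensional ℝ V]
  [MeasurableSpace V] [BorelSpace V]

theorem continuous_fourierInv_of_integrable {h : V → ℂ} (h1 : Integrable h) :
    Continuous (𝓕⁻ h) := by
  have : 𝓕⁻ h = fun x => 𝓕 h (-x) := by
    ext x
    rw [Real.fourierInv_eq_fourier_neg]
  rw [this]
  exact (VectorFourier.fourierIntegral_continuous Real.continuous_fourierChar
    continuous_inner h1).comp continuous_neg

/-- For `h ∈ L¹ ∩ L²` the inverse Fourier integral represents the inverse Fourier transform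
of `h` as an element of `L²`: both define the same tempered distribution. -/
theorem fourierInv_ae_eq_lp {h : V → ℂ} (h1 : Integrable h) (h2 : MemLp h 2) :
    𝓕⁻ h =ᵐ[volume] ((𝓕⁻ (h2.toLp h) : Lp ℂ 2 (volume : Measure V)) : V → ℂ) := by
  have hc : Continuous (𝓕⁻ h) := continuous_fourierInv_of_integrable h1
  refine ae_eq_of_integral_contDiff_smul_eq hc.locallyIntegrable
    ((Lp.memLp _).locallyIntegrable (by norm_num)) ?_
  intro g g_smooth g_cpt
  have hg₁ : HasCompactSupport (Complex.ofRealCLM ∘ g) := g_cpt.comp_left rfl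
  have hg₂ : ContDiff ℝ ∞ (Complex.ofRealCLM ∘ g) := by fun_prop
  set φ := hg₁.toSchwartzMap hg₂ with hφ
  have e1 : ∀ x, φ x = (g x : ℂ) := fun x => rfl
  have h3 := congrArg (fun T => T φ) (Lp.fourierInv_toTemperedDistribution_eq (h2.toLp h))
  simp only [TemperedDistribution.fourierInv_apply, Lp.toTemperedDistribution_apply] at h3
  have h4 : ∫ x, φ x • 𝓕⁻ h x = ∫ x, (𝓕⁻ φ) x • h x := by
    have := VectorFourier.integral_fourierIntegral_smul_eq_flip (L := -innerₗ V) (μ := volume)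
      (ν := volume) Real.continuous_fourierChar (by
        simp only [LinearMap.neg_apply, innerₗ_apply_apply]; fun_prop)
        (f := φ) (g := h) φ.integrable h1
    have hf : (-innerₗ V).flip = -innerₗ V := by
      ext x y
      simp [real_inner_comm]
    rw [hf] at this
    have e : ∀ k : V → ℂ, VectorFourier.fourierIntegral 𝐞 volume (-innerₗ V) k = 𝓕⁻ k := by
      intro k
      ext x
      rw [Real.fourierInv_eq, VectorFourier.fourierIntegral]
      simp
    rw [e, e] at this
    rw [← SchwartzMap.fourierInv_coe] at this
    exact this.symm
  calc ∫ x, g x • 𝓕⁻ h x = ∫ x, φ x • 𝓕⁻ h x := by simp [e1]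
    _ = ∫ x, (𝓕⁻ φ) x • h x := h4
    _ = ∫ x, (𝓕⁻ φ) x • h2.toLp h x := by
      refine integral_congr_ae ?_
      filter_upwards [h2.coeFn_toLp] with x hx
      rw [hx]
    _ = _ := by rw [h3]; simp [e1]

theorem memLp_fourierInv {h : V → ℂ} (h1 : Integrable h) (h2 : MemLp h 2) :
    MemLp (𝓕⁻ h) 2 :=
  (memLp_congr_ae (fourierInv_ae_eq_lp h1 h2)).2 (Lp.memLp _)

theorem toLp_fourierInv {h : V → ℂ} (h1 : Integrable h) (h2 : MemLp h 2) :
    (memLp_fourierInv h1 h2).toLp (𝓕⁻ h) = 𝓕⁻ (h2.toLp h) := by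
  refine Lp.ext ?_
  exact (MemLp.coeFn_toLp _).trans (fourierInv_ae_eq_lp h1 h2)

theorem Lp.norm_fourierInv_eq (f : Lp ℂ 2 (volume : Measure V)) : ‖𝓕⁻ f‖ = ‖f‖ := by
  rw [← Lp.norm_fourier_eq (𝓕⁻ f), FourierTransform.fourier_fourierInv_eq]

theorem eLpNorm_fourierInv {h : V → ℂ} (h1 : Integrable h) (h2 : MemLp h 2) :
    eLpNorm (𝓕⁻ h) 2 = eLpNorm h 2 := by
  have e1 := Lp.norm_fourierInv_eq (h2.toLp h)
  rw [← toLp_fourierInv h1 h2, Lp.norm_toLp, Lp.norm_toLp] at e1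
  exact (ENNReal.toReal_eq_toReal_iff' (memLp_fourierInv h1 h2).2.ne h2.2.ne).1 e1

theorem eLpNorm_two_sq {X : Type*} [MeasurableSpace X] (μ : Measure X) (f : X → ℂ) :
    eLpNorm f 2 μ ^ 2 = ∫⁻ x, ‖f x‖ₑ ^ 2 ∂μ := by
  have := eLpNorm_nnreal_pow_eq_lintegral (f := f) (μ := μ) (p := 2) (by norm_num)
  simpa using this

theorem memLp_two_iff {X : Type*} [MeasurableSpace X] {μ : Measure X} {f : X → ℂ}
    (hf : AEStronglyMeasurable f μ) : MemLp f 2 μ ↔ ∫⁻ x, ‖f x‖ₑ ^ 2 ∂μ < ⊤ := by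
  rw [← eLpNorm_two_sq, MemLp]
  simp [hf]

/-- **Plancherel's theorem** for integrable square integrable functions. -/
theorem lintegral_fourierInv_sq {h : V → ℂ} (h1 : Integrable h) (h2 : MemLp h 2) :
    ∫⁻ x, ‖𝓕⁻ h x‖ₑ ^ 2 = ∫⁻ x, ‖h x‖ₑ ^ 2 := by
  rw [← eLpNorm_two_sq, ← eLpNorm_two_sq, eLpNorm_fourierInv h1 h2]

/-- **Parseval's identity** for integrable square integrable functions. -/
theorem integral_fourierInv_mul_conj {h k : V → ℂ} (h1 : Integrable h) (h2 : MemLp h 2)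
    (k1 : Integrable k) (k2 : MemLp k 2) :
    ∫ x, 𝓕⁻ h x * conj (𝓕⁻ k x) = ∫ x, h x * conj (k x) := by
  have e1 := Lp.inner_fourier_eq (𝓕⁻ (k2.toLp k)) (𝓕⁻ (h2.toLp h))
  rw [FourierTransform.fourier_fourierInv_eq, FourierTransform.fourier_fourierInv_eq,
    L2.inner_def, L2.inner_def] at e1
  have e2 : ∫ x, h x * conj (k x) = ∫ x, inner ℂ (k2.toLp k x) (h2.toLp h x) := by
    refine integral_congr_ae ?_
    filter_upwards [h2.coeFn_toLp, k2.coeFn_toLp] with x hx hx'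
    rw [hx, hx', RCLike.inner_apply]
  rw [e2, e1]
  refine integral_congr_ae ?_
  filter_upwards [fourierInv_ae_eq_lp h1 h2, fourierInv_ae_eq_lp k1 k2] with x hx hx'
  rw [RCLike.inner_apply, hx, hx']

end Plancherel

/-! ### Harmonic extension of Fourier integrals to the half-space -/

section HarmonicExtension

variable {V : Type*} [NormedAddCommGroup V]

/-- The multiplier `exp (-2π y ‖ξ‖)` of the Poisson semigroup. -/
noncomputable def poissonMul (y : ℝ) (ξ : V) : ℝ := Real.exp (-(2 * Real.pi * y * ‖ξ‖))

theorem poissonMul_pos (y : ℝ) (ξ : V) : 0 < poissonMul y ξ := Real.exp_pos _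

@[fun_prop]
theorem continuous_poissonMul (y : ℝ) : Continuous (poissonMul y : V → ℝ) := by
  unfold poissonMul; fun_prop

theorem poissonMul_add (y z : ℝ) (ξ : V) :
    poissonMul (y + z) ξ = poissonMul y ξ * poissonMul z ξ := by
  rw [poissonMul, poissonMul, poissonMul, ← Real.exp_add]; ring_nf

theorem poissonMul_anti (ξ : V) : Antitone (fun y => poissonMul y ξ) := by
  intro y z h
  have := mul_le_mul_of_nonneg_right h (by positivity : 0 ≤ 2 * Real.pi * ‖ξ‖)
  exact Real.exp_le_exp.2 (by linarith)

theorem poissonMul_le_one {y : ℝ} (hy : 0 ≤ y) (ξ : V) : poissonMul y ξ ≤ 1 := by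
  have := poissonMul_anti ξ hy
  simpa [poissonMul] using this

theorem norm_mul_poissonMul_le {y : ℝ} (hy : 0 < y) (ξ : V) :
    ‖ξ‖ * poissonMul y ξ ≤ 1 / (2 * Real.pi * y) := by
  have h1 := Real.add_one_le_exp (2 * Real.pi * y * ‖ξ‖)
  have h2 : 0 < 2 * Real.pi * y := by positivity
  rw [poissonMul, Real.exp_neg, le_div_iff₀ h2, mul_assoc, ← div_eq_inv_mul, mul_div_assoc',
    div_le_one (Real.exp_pos _)]
  linarith

variable [InnerProductSpace ℝ V] {E : Type*} [NormedAddCommGroup E] [NormedSpace ℝ E]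

/-- The real linear form `2πi ⟪ξ, a⟫ - 2π ‖ξ‖ b` in two linear coordinates `a` and `b`. For the
coordinates `(x, y)` of `V × ℝ`, its exponential is the elementary harmonic function of
frequency `ξ`. -/
noncomputable def phaseCLM (a : E →L[ℝ] V) (b : E →L[ℝ] ℝ) (ξ : V) : E →L[ℝ] ℂ :=
  (2 * Real.pi * Complex.I : ℂ) • (Complex.ofRealCLM ∘L (innerSL ℝ ξ) ∘L a) -
    (2 * Real.pi * ‖ξ‖ : ℂ) • (Complex.ofRealCLM ∘L b)

theorem phaseCLM_apply (a : E →L[ℝ] V) (b : E →L[ℝ] ℝ) (ξ : V) (p : E) :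
    phaseCLM a b ξ p = 2 * Real.pi * Complex.I * (⟪ξ, a p⟫ : ℝ) - 2 * Real.pi * ‖ξ‖ * b p := by
  simp [phaseCLM]

theorem norm_cexp_phaseCLM (a : E →L[ℝ] V) (b : E →L[ℝ] ℝ) (ξ : V) (p : E) :
    ‖Complex.exp (phaseCLM a b ξ p)‖ = poissonMul (b p) ξ := by
  rw [Complex.norm_exp, phaseCLM_apply, poissonMul]
  congr 1
  simp
  ring

theorem norm_phaseCLM_le (a : E →L[ℝ] V) (b : E →L[ℝ] ℝ) (ξ : V) :
    ‖phaseCLM a b ξ‖ ≤ 2 * Real.pi * (‖a‖ + ‖b‖) * ‖ξ‖ := by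
  refine ContinuousLinearMap.opNorm_le_bound _ (by positivity) fun p => ?_
  rw [phaseCLM_apply]
  refine (norm_sub_le _ _).trans ?_
  simp only [norm_mul, Complex.norm_real, Complex.norm_I, Complex.norm_ofNat, Real.norm_eq_abs,
    abs_of_pos Real.pi_pos, abs_norm, mul_one]
  have h4 : |⟪ξ, a p⟫| ≤ ‖ξ‖ * (‖a‖ * ‖p‖) :=
    (abs_real_inner_le_norm ξ (a p)).trans (by gcongr; exact a.le_opNorm p)
  have h5 : |b p| ≤ ‖b‖ * ‖p‖ := b.le_opNorm p
  calc _ ≤ 2 * Real.pi * (‖ξ‖ * (‖a‖ * ‖p‖)) + 2 * Real.pi * ‖ξ‖ * (‖b‖ * ‖p‖) := by gcongr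
    _ = _ := by ring

theorem continuous_phaseCLM (a : E →L[ℝ] V) (b : E →L[ℝ] ℝ) : Continuous (phaseCLM a b) := by
  have h1 : Continuous fun ξ : V => Complex.ofRealCLM ∘L (innerSL ℝ ξ) ∘L a :=
    continuous_const.clm_comp ((innerSL ℝ).continuous.clm_comp continuous_const)
  have h2 : Continuous fun ξ : V => (2 * Real.pi * ‖ξ‖ : ℂ) := by fun_prop
  exact (h1.const_smul (2 * Real.pi * Complex.I : ℂ)).sub (h2.smul continuous_const)

theorem continuous_cexp_phaseCLM (a : E →L[ℝ] V) (b : E →L[ℝ] ℝ) (p : E) :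
    Continuous fun ξ : V => Complex.exp (phaseCLM a b ξ p) := by
  have := (continuous_phaseCLM a b).clm_apply (continuous_const (y := p))
  fun_prop

theorem norm_complex_smulRight_le {F : Type*} [NormedAddCommGroup F] [NormedSpace ℂ F]
    (c : E →L[ℝ] ℂ) (v : F) : ‖c.smulRight v‖ ≤ ‖c‖ * ‖v‖ := by
  refine ContinuousLinearMap.opNorm_le_bound _ (by positivity) fun p => ?_
  rw [ContinuousLinearMap.smulRight_apply, norm_smul]
  nlinarith [c.le_opNorm p, norm_nonneg v]

theorem continuous_complex_smulRight {F : Type*} [NormedAddCommGroup F] [NormedSpace ℂ F] :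
    Continuous fun q : (E →L[ℝ] ℂ) × F => q.1.smulRight q.2 := by
  have : IsBoundedBilinearMap ℝ fun q : (E →L[ℝ] ℂ) × F => q.1.smulRight q.2 :=
    { add_left := fun x y z => by ext; simp [add_smul]
      smul_left := fun c x y => by ext p; simp [mul_smul]
      add_right := fun x y z => by ext; simp
      smul_right := fun c x y => by ext p; simp [smul_comm c (x p) y]
      bound := ⟨1, one_pos, fun x y => by simpa using norm_complex_smulRight_le x y⟩ }
  exact this.continuous

variable [FiniteDimensional ℝ V] [MeasurableSpace V] [BorelSpace V]

/-- Integrability against all the multipliers `exp (-2π y ‖ξ‖)`, `y > 0`. -/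
structure PoissonIntegrable {F : Type*} [NormedAddCommGroup F] (G : V → F) : Prop where
  aestronglyMeasurable : AEStronglyMeasurable G
  integrable : ∀ y : ℝ, 0 < y → Integrable fun ξ => poissonMul y ξ * ‖G ξ‖

variable {F : Type*} [NormedAddCommGroup F] [NormedSpace ℂ F]

/-- Differentiating an exponential multiplies the symbol by a linear factor in `ξ`, which the
multipliers absorb: this allows repeated differentiation under the integral sign. -/
theorem PoissonIntegrable.phaseCLM_smulRight {G : V → F} (hG : PoissonIntegrable G)
    (a : E →L[ℝ] V) (b : E →L[ℝ] ℝ) :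
    PoissonIntegrable fun ξ => (phaseCLM a b ξ).smulRight (G ξ) where
  aestronglyMeasurable := continuous_complex_smulRight.comp_aestronglyMeasurable
    ((continuous_phaseCLM a b).aestronglyMeasurable.prodMk hG.aestronglyMeasurable)
  integrable y hy := by
    set C := 2 * Real.pi * (‖a‖ + ‖b‖) with hC
    have hC0 : 0 ≤ C := by positivity
    refine ((hG.integrable (y / 2) (half_pos hy)).const_mul
      (C * (1 / (2 * Real.pi * (y / 2))))).mono' ?_ (Eventually.of_forall fun ξ => ?_)
    · exact (continuous_poissonMul y).aestronglyMeasurable.mul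
        (continuous_complex_smulRight.comp_aestronglyMeasurable
        ((continuous_phaseCLM a b).aestronglyMeasurable.prodMk hG.aestronglyMeasurable)).norm
    · have h1 := norm_mul_poissonMul_le (half_pos hy) ξ
      have h3 := poissonMul_pos (y / 2) ξ
      have h2 : ‖(phaseCLM a b ξ).smulRight (G ξ)‖ ≤ C * ‖ξ‖ * ‖G ξ‖ :=
        (norm_complex_smulRight_le _ _).trans (by gcongr; exact norm_phaseCLM_le a b ξ)
      have e : poissonMul y ξ = poissonMul (y / 2) ξ * poissonMul (y / 2) ξ := by
        rw [← poissonMul_add]; ring_nf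
      rw [Real.norm_of_nonneg (by have := poissonMul_pos y ξ; positivity), e]
      calc _ ≤ poissonMul (y / 2) ξ * poissonMul (y / 2) ξ * (C * ‖ξ‖ * ‖G ξ‖) := by gcongr
        _ = C * (‖ξ‖ * poissonMul (y / 2) ξ) * (poissonMul (y / 2) ξ * ‖G ξ‖) := by ring
        _ ≤ _ := by gcongr

theorem PoissonIntegrable.integrable_cexp {G : V → F} (hG : PoissonIntegrable G)
    (a : E →L[ℝ] V) (b : E →L[ℝ] ℝ) {p : E} (hp : 0 < b p) :
    Integrable fun ξ => Complex.exp (phaseCLM a b ξ p) • G ξ := by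
  refine (hG.integrable (b p) hp).mono' ?_ (Eventually.of_forall fun ξ => ?_)
  · exact (continuous_cexp_phaseCLM a b p).aestronglyMeasurable.smul hG.aestronglyMeasurable
  · rw [norm_smul, norm_cexp_phaseCLM]

theorem PoissonIntegrable.hasFDerivAt {G : V → F} (hG : PoissonIntegrable G)
    (a : E →L[ℝ] V) (b : E →L[ℝ] ℝ) {p : E} (hp : 0 < b p) :
    HasFDerivAt (fun q => ∫ ξ, Complex.exp (phaseCLM a b ξ q) • G ξ)
      (∫ ξ, Complex.exp (phaseCLM a b ξ p) • (phaseCLM a b ξ).smulRight (G ξ)) p := by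
  have hU : {q : E | b p / 2 < b q} ∈ 𝓝 p :=
    (isOpen_lt continuous_const b.continuous).mem_nhds (by simpa using half_lt_self hp)
  refine hasFDerivAt_integral_of_dominated_of_fderiv_le (𝕜 := ℝ)
    (F' := fun q ξ => Complex.exp (phaseCLM a b ξ q) • (phaseCLM a b ξ).smulRight (G ξ)) hU
    (Eventually.of_forall fun q => ?_) (hG.integrable_cexp a b hp)
    ((hG.phaseCLM_smulRight a b).integrable_cexp a b hp).aestronglyMeasurable
    (Eventually.of_forall fun ξ q hq => ?_)
    ((hG.phaseCLM_smulRight a b).integrable (b p / 2) (half_pos hp))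
    (Eventually.of_forall fun ξ q _ => ?_)
  · exact (continuous_cexp_phaseCLM a b q).aestronglyMeasurable.smul hG.aestronglyMeasurable
  · rw [norm_smul, norm_cexp_phaseCLM]
    exact mul_le_mul_of_nonneg_right (poissonMul_anti ξ (le_of_lt hq)) (norm_nonneg _)
  · have h := ((phaseCLM a b ξ).hasFDerivAt (x := q)).cexp.smul_const (G ξ)
    convert h using 1
    ext v
    simp [smul_smul]

/-- A superposition of the exponentials of the forms `phaseCLM a b ξ` is twice continuously
differentiable, and its second derivatives may be computed under the integral sign. -/
theorem PoissonIntegrable.contDiffAt_and_fderiv_fderiv {g : V → ℂ} (hg : PoissonIntegrable g)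
    (a : E →L[ℝ] V) (b : E →L[ℝ] ℝ) {p : E} (hp : 0 < b p) :
    ContDiffAt ℝ 2 (fun q => ∫ ξ, Complex.exp (phaseCLM a b ξ q) * g ξ) p ∧
    ∀ v, Integrable (fun ξ => Complex.exp (phaseCLM a b ξ p) * (phaseCLM a b ξ v ^ 2 * g ξ)) ∧
      fderiv ℝ (fderiv ℝ fun q => ∫ ξ, Complex.exp (phaseCLM a b ξ q) * g ξ) p v v =
      ∫ ξ, Complex.exp (phaseCLM a b ξ p) * (phaseCLM a b ξ v ^ 2 * g ξ) := by
  set f := fun q => ∫ ξ, Complex.exp (phaseCLM a b ξ q) * g ξ with hf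
  set G1 := fun ξ => (phaseCLM a b ξ).smulRight (g ξ) with hG1
  set G2 := fun ξ => (phaseCLM a b ξ).smulRight (G1 ξ) with hG2
  have hg1 : PoissonIntegrable G1 := hg.phaseCLM_smulRight a b
  have hg2 : PoissonIntegrable G2 := hg1.phaseCLM_smulRight a b
  have hU : {q : E | 0 < b q} ∈ 𝓝 p := (isOpen_lt continuous_const b.continuous).mem_nhds hp
  set f1 := fun q => ∫ ξ, Complex.exp (phaseCLM a b ξ q) • G1 ξ
  set f2 := fun q => ∫ ξ, Complex.exp (phaseCLM a b ξ q) • G2 ξ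
  have d1 : ∀ q ∈ {q : E | 0 < b q}, HasFDerivAt f (f1 q) q := fun q hq => hg.hasFDerivAt a b hq
  have d2 : ∀ q ∈ {q : E | 0 < b q}, HasFDerivAt f1 (f2 q) q := fun q hq => hg1.hasFDerivAt a b hq
  have c2 : ∀ q ∈ {q : E | 0 < b q}, ContinuousAt f2 q :=
    fun q hq => (hg2.hasFDerivAt a b hq).continuousAt
  constructor
  · have h1 : ContDiffAt ℝ (1 : ℕ) f1 p := by
      refine (contDiffAt_succ_iff_hasFDerivAt (n := 0)).2 ⟨f2, ⟨_, hU, d2⟩, ?_⟩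
      exact contDiffAt_zero.2 ⟨_, hU, fun q hq => (c2 q hq).continuousWithinAt⟩
    exact (contDiffAt_succ_iff_hasFDerivAt (n := 1)).2 ⟨f1, ⟨_, hU, d1⟩, h1⟩
  · intro v
    have hI := (hg2.integrable_cexp a b hp)
    have hIv := hI.apply_continuousLinearMap v
    have hIvv := hIv.apply_continuousLinearMap v
    refine ⟨by simpa [hG2, hG1, pow_two, mul_assoc] using hIvv, ?_⟩
    have e1 : fderiv ℝ f =ᶠ[𝓝 p] f1 := by
      filter_upwards [hU] with r hr using (d1 r hr).fderiv
    rw [e1.fderiv_eq, (d2 p hp).fderiv, ContinuousLinearMap.integral_apply hI,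
      ContinuousLinearMap.integral_apply hIv]
    simp [hG2, hG1, pow_two, mul_assoc]

/-- The function on the half-space `{y > 0}` whose slice at height `y` has the Fourier transform
`exp (-2π y ‖ξ‖) g ξ`. -/
noncomputable def harmonicExt (g : V → ℂ) (p : WithLp 2 (V × ℝ)) : ℂ :=
  ∫ ξ, Complex.exp (phaseCLM (fstL 2 ℝ V ℝ) (sndL 2 ℝ V ℝ) ξ p) * g ξ

theorem harmonicExt_eq_fourierInv (g : V → ℂ) (x : V) (y : ℝ) :
    harmonicExt g (toLp 2 (x, y)) = 𝓕⁻ (fun ξ => (poissonMul y ξ : ℂ) * g ξ) x := by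
  rw [harmonicExt, Real.fourierInv_eq']
  refine integral_congr_ae (Eventually.of_forall fun ξ => ?_)
  simp only [phaseCLM_apply, poissonMul, smul_eq_mul, ← mul_assoc, Complex.ofReal_exp,
    ← Complex.exp_add, fstL_apply, sndL_apply, toLp_fst, toLp_snd]
  congr 2
  push_cast
  ring

/-- The sum of the squares of the phase along an orthonormal basis vanishes: the exponential of
the phase is harmonic. -/
theorem sum_phaseCLM_sq {V ι : Type*} [NormedAddCommGroup V] [InnerProductSpace ℝ V]
     [Fintype ι] (e : OrthonormalBasis ι ℝ V) (ξ : V) :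
    ∑ i, phaseCLM (fstL 2 ℝ V ℝ) (sndL 2 ℝ V ℝ) ξ (toLp 2 (e i, (0 : ℝ))) ^ 2 +
      phaseCLM (fstL 2 ℝ V ℝ) (sndL 2 ℝ V ℝ) ξ (toLp 2 ((0 : V), (1 : ℝ))) ^ 2 = 0 := by
  have h : ∑ i, ⟪ξ, e i⟫ ^ 2 = ‖ξ‖ ^ 2 := e.sum_sq_inner_left ξ
  simp only [phaseCLM_apply, fstL_apply, sndL_apply, toLp_fst, toLp_snd]
  simp only [Complex.ofReal_zero, mul_zero, sub_zero, inner_zero_right, mul_pow, Complex.I_sq,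
    Complex.ofReal_one, zero_sub, mul_one]
  rw [← Finset.mul_sum]
  simp_rw [← Complex.ofReal_pow]
  rw [← Complex.ofReal_sum, h]
  push_cast
  ring

/-- The upper half-space `{(x, y) : y > 0}` over `V`. -/
def upperHalf (V : Type*) : Set (WithLp 2 (V × ℝ)) := {p | 0 < p.snd}

theorem isOpen_upperHalf {V : Type*} [NormedAddCommGroup V] : IsOpen (upperHalf V) :=
  isOpen_lt continuous_const (by fun_prop)

theorem iteratedFDeriv_two_diag {E F : Type*} [NormedAddCommGroup E] [NormedSpace ℝ E]
    [NormedAddCommGroup F] [NormedSpace ℝ F] (f : E → F) (p v : E) :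
    iteratedFDeriv ℝ 2 f p ![v, v] = fderiv ℝ (fderiv ℝ f) p v v := by
  rw [iteratedFDeriv_two_apply]
  simp

/-- The Laplacian on `V × ℝ`, split into the directions of `V` and the vertical direction. -/
theorem laplacian_eq_sum_add {V F : Type*} [NormedAddCommGroup V] [InnerProductSpace ℝ V]
    [FiniteDimensional ℝ V] [NormedAddCommGroup F] [NormedSpace ℝ F]
    {ι : Type*} [Fintype ι] (e : OrthonormalBasis ι ℝ V) (f : WithLp 2 (V × ℝ) → F)
    (p : WithLp 2 (V × ℝ)) :
    Laplacian.laplacian f p =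
      ∑ i, iteratedFDeriv ℝ 2 f p ![toLp 2 (e i, (0 : ℝ)), toLp 2 (e i, (0 : ℝ))]
      + iteratedFDeriv ℝ 2 f p ![toLp 2 ((0 : V), (1 : ℝ)), toLp 2 ((0 : V), (1 : ℝ))] := by
  have h := congrFun (InnerProductSpace.laplacian_eq_iteratedFDeriv_orthonormalBasis f
    (e.prod (OrthonormalBasis.singleton Unit ℝ))) p
  rw [h, Fintype.sum_sum_type]
  simp [OrthonormalBasis.prod_apply]

/-- The second derivatives of the exponentials cancel under the integral sign. -/
theorem PoissonIntegrable.harmonicOnNhd {g : V → ℂ} (hg : PoissonIntegrable g) :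
    InnerProductSpace.HarmonicOnNhd (harmonicExt g) (upperHalf V) := by
  have key := fun (q : WithLp 2 (V × ℝ)) (hq : q ∈ upperHalf V) =>
    hg.contDiffAt_and_fderiv_fderiv (fstL 2 ℝ V ℝ) (sndL 2 ℝ V ℝ) (p := q) hq
  intro p hp
  refine ⟨(key p hp).1, ?_⟩
  filter_upwards [isOpen_upperHalf.mem_nhds hp] with q hq
  rw [laplacian_eq_sum_add (stdOrthonormalBasis ℝ V)]
  simp only [iteratedFDeriv_two_diag]
  have e2 := fun v => ((key q hq).2 v).2
  have hI := fun v => ((key q hq).2 v).1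
  change ∑ i, fderiv ℝ (fderiv ℝ fun q =>
      ∫ ξ, Complex.exp (phaseCLM (fstL 2 ℝ V ℝ) (sndL 2 ℝ V ℝ) ξ q) * g ξ) q _ _ +
    fderiv ℝ (fderiv ℝ fun q =>
      ∫ ξ, Complex.exp (phaseCLM (fstL 2 ℝ V ℝ) (sndL 2 ℝ V ℝ) ξ q) * g ξ) q _ _ = 0
  simp only [e2]
  rw [← integral_finsetSum _ fun i _ => hI _,
    ← integral_add (integrable_finsetSum _ fun i _ => hI _) (hI _)]
  refine integral_eq_zero_of_ae (Eventually.of_forall fun ξ => ?_)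
  have := sum_phaseCLM_sq (stdOrthonormalBasis ℝ V) ξ
  simp only [Pi.zero_apply]
  rw [← Finset.mul_sum, ← Finset.sum_mul, ← mul_add, ← add_mul, this]
  simp

/-- Harmonicity is invariant under translations. -/
theorem harmonicAt_comp_add_right {E F : Type*} [NormedAddCommGroup E] [InnerProductSpace ℝ E]
    [FiniteDimensional ℝ E] [NormedAddCommGroup F] [NormedSpace ℝ F] {f : E → F} {p : E} (a : E)
    (h : InnerProductSpace.HarmonicAt f (p + a)) :
    InnerProductSpace.HarmonicAt (fun q => f (q + a)) p := by
  refine ⟨h.1.comp p (by fun_prop), ?_⟩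
  have ht : Tendsto (fun q => q + a) (𝓝 p) (𝓝 (p + a)) := by
    exact (continuous_add_const a).tendsto p
  filter_upwards [ht.eventually h.2] with q hq
  rw [InnerProductSpace.laplacian_eq_iteratedFDeriv_stdOrthonormalBasis] at hq ⊢
  simpa [iteratedFDeriv_comp_add_right] using hq

end HarmonicExtension

/-! ### Convexity of the energy of the slices of a harmonic function -/

section Convexity

/-- Differentiation of slice integrals against a compactly supported cutoff. -/
theorem hasDerivAt_integral_mul_of_hasCompactSupport {X : Type*} [TopologicalSpace X]
    [T2Space X] [MeasurableSpace X] [OpensMeasurableSpace X]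
    [SecondCountableTopology X] {μ : Measure X} [IsFiniteMeasureOnCompacts μ]
    {G G' : X → ℝ → ℝ} {χ : X → ℝ} (hχ : Continuous χ) (hc : HasCompactSupport χ)
    (hG : ContinuousOn (Function.uncurry G) (univ ×ˢ Ioi 0))
    (hG' : ContinuousOn (Function.uncurry G') (univ ×ˢ Ioi 0))
    (hd : ∀ x, ∀ y, 0 < y → HasDerivAt (G x) (G' x y) y) {y : ℝ} (hy : 0 < y) :
    HasDerivAt (fun y => ∫ x, G x y * χ x ∂μ) (∫ x, G' x y * χ x ∂μ) y := by
  have slice : ∀ {H : X → ℝ → ℝ}, ContinuousOn (Function.uncurry H) (univ ×ˢ Ioi 0) →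
      ∀ {z : ℝ}, 0 < z → Continuous fun x => H x z * χ x := by
    intro H hH z hz
    refine Continuous.mul ?_ hχ
    exact hH.comp_continuous (f := fun x => (x, z)) (by fun_prop) fun x => ⟨mem_univ _, hz⟩
  have hK : IsCompact (tsupport χ ×ˢ Icc (y / 2) (2 * y)) := hc.isCompact.prod isCompact_Icc
  obtain ⟨C, hC⟩ := hK.exists_bound_of_continuousOn
    (hG'.mono (prod_mono (subset_univ _) fun z hz => lt_of_lt_of_le (half_pos hy) hz.1))
  have hs : Ioo (y / 2) (2 * y) ∈ 𝓝 y := Ioo_mem_nhds (by linarith) (by linarith)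
  refine (hasDerivAt_integral_of_dominated_loc_of_deriv_le (𝕜 := ℝ) (F := fun y x => G x y * χ x)
    (F' := fun y x => G' x y * χ x) (bound := fun x => C * ‖χ x‖) hs ?_ ?_ ?_ ?_ ?_ ?_).2
  · filter_upwards [lt_mem_nhds hy] with z hz
    exact (slice hG hz).aestronglyMeasurable
  · exact (slice hG hy).integrable_of_hasCompactSupport hc.mul_left
  · exact (slice hG' hy).aestronglyMeasurable
  · refine Eventually.of_forall fun x z hz => ?_
    rw [norm_mul]
    by_cases hx : x ∈ tsupport χ
    · exact mul_le_mul_of_nonneg_right (hC (x, z) ⟨hx, hz.1.le, hz.2.le⟩) (norm_nonneg _)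
    · simp [image_eq_zero_of_notMem_tsupport hx]
  · exact (hχ.norm.integrable_of_hasCompactSupport hc.norm).const_mul C
  · refine Eventually.of_forall fun x z hz => ?_
    exact (hd x z (lt_trans (half_pos hy) hz.1)).mul_const _

theorem continuousOn_integral_mul_of_hasCompactSupport {X : Type*} [TopologicalSpace X]
    [T2Space X] [MeasurableSpace X] [OpensMeasurableSpace X]
    [SecondCountableTopology X] {μ : Measure X} [IsFiniteMeasureOnCompacts μ]
    {G : X → ℝ → ℝ} {χ : X → ℝ} (hχ : Continuous χ) (hc : HasCompactSupport χ)
    (hG : ContinuousOn (Function.uncurry G) (univ ×ˢ Ioi 0)) :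
    ContinuousOn (fun y => ∫ x, G x y * χ x ∂μ) (Ioi 0) := by
  intro y hy
  have hK : IsCompact (tsupport χ ×ˢ Icc (y / 2) (2 * y)) := hc.isCompact.prod isCompact_Icc
  have hy : 0 < y := hy
  obtain ⟨C, hC⟩ := hK.exists_bound_of_continuousOn
    (hG.mono (prod_mono (subset_univ _) fun z hz => lt_of_lt_of_le (half_pos hy) hz.1))
  have hs : Ioo (y / 2) (2 * y) ∈ 𝓝 y := Ioo_mem_nhds (by linarith) (by linarith)
  refine ContinuousAt.continuousWithinAt ?_
  refine continuousAt_of_dominated (bound := fun x => C * ‖χ x‖) ?_ ?_ ?_ ?_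
  · filter_upwards [lt_mem_nhds hy] with z hz
    refine Continuous.aestronglyMeasurable (Continuous.mul ?_ hχ)
    exact hG.comp_continuous (f := fun x => (x, z)) (by fun_prop) fun x => ⟨mem_univ _, hz⟩
  · filter_upwards [hs] with z hz
    refine Eventually.of_forall fun x => ?_
    rw [norm_mul]
    by_cases hx : x ∈ tsupport χ
    · exact mul_le_mul_of_nonneg_right (hC (x, z) ⟨hx, hz.1.le, hz.2.le⟩) (norm_nonneg _)
    · simp [image_eq_zero_of_notMem_tsupport hx]
  · exact (hχ.norm.integrable_of_hasCompactSupport hc.norm).const_mul C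
  · refine Eventually.of_forall fun x => ContinuousAt.mul ?_ continuousAt_const
    exact (hG.continuousAt ((isOpen_univ.prod isOpen_Ioi).mem_nhds
      (show ((x, y) : X × ℝ) ∈ univ ×ˢ Ioi 0 from ⟨mem_univ x, hy⟩))).comp
      (f := fun y => (x, y)) (by fun_prop)

variable {V : Type*} [NormedAddCommGroup V] [InnerProductSpace ℝ V] [FiniteDimensional ℝ V]
  [MeasurableSpace V] [BorelSpace V]

/-- Integration by parts, twice, against a compactly supported function. -/
theorem integral_fderiv_fderiv_mul {U χ : V → ℝ} (hU : ContDiff ℝ 2 U) (hχ : ContDiff ℝ 2 χ)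
    (hc : HasCompactSupport χ) (e : V) :
    ∫ x, fderiv ℝ (fun z => fderiv ℝ U z e) x e * χ x =
      ∫ x, U x * fderiv ℝ (fun z => fderiv ℝ χ z e) x e := by
  have hU1 : ContDiff ℝ 1 fun z => fderiv ℝ U z e :=
    (hU.fderiv_right (m := 1) (by norm_num)).clm_apply contDiff_const
  have hχ1 : ContDiff ℝ 1 fun z => fderiv ℝ χ z e :=
    (hχ.fderiv_right (m := 1) (by norm_num)).clm_apply contDiff_const
  have hU2 : Continuous fun z => fderiv ℝ (fun z => fderiv ℝ U z e) z e :=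
    (hU1.continuous_fderiv (by norm_num)).clm_apply continuous_const
  have hχ2 : Continuous fun z => fderiv ℝ (fun z => fderiv ℝ χ z e) z e :=
    (hχ1.continuous_fderiv (by norm_num)).clm_apply continuous_const
  have c1 : HasCompactSupport fun z => fderiv ℝ χ z e := hc.fderiv_apply (𝕜 := ℝ) e
  have c2 : HasCompactSupport fun z => fderiv ℝ (fun z => fderiv ℝ χ z e) z e :=
    c1.fderiv_apply (𝕜 := ℝ) e
  have I0 := integral_mul_fderiv_eq_neg_fderiv_mul_of_integrable (μ := (volume : Measure V))
    (f := fun z => fderiv ℝ U z e) (g := χ) (v := e)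
    ((hU2.mul hχ.continuous).integrable_of_hasCompactSupport hc.mul_left)
    ((hU1.continuous.mul hχ1.continuous).integrable_of_hasCompactSupport c1.mul_left)
    ((hU1.continuous.mul hχ.continuous).integrable_of_hasCompactSupport hc.mul_left)
    (fun x _ => (hU1.differentiable one_ne_zero) x) (fun x _ => (hχ.differentiable two_ne_zero) x)
  have I1 := integral_mul_fderiv_eq_neg_fderiv_mul_of_integrable (μ := (volume : Measure V))
    (f := U) (g := fun z => fderiv ℝ χ z e) (v := e)
    ((hU1.continuous.mul hχ1.continuous).integrable_of_hasCompactSupport c1.mul_left)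
    ((hU.continuous.mul hχ2).integrable_of_hasCompactSupport c2.mul_left)
    ((hU.continuous.mul hχ1.continuous).integrable_of_hasCompactSupport c1.mul_left)
    (fun x _ => (hU.differentiable two_ne_zero) x) (fun x _ => (hχ1.differentiable one_ne_zero) x)
  linarith

/-- A function with second derivative at least `-B` lies below its chords up to an error
controlled by `∫ B`. -/
theorem le_chord_add_of_deriv2_ge {φ φ' φ'' B : ℝ → ℝ} (h1 : ∀ y, 0 < y → HasDerivAt φ (φ' y) y)
    (h2 : ∀ y, 0 < y → HasDerivAt φ' (φ'' y) y) (hB : ContinuousOn B (Ioi 0))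
    (hB0 : ∀ y, 0 < y → 0 ≤ B y) (h3 : ∀ y, 0 < y → -B y ≤ φ'' y) {y0 y1 : ℝ} (h0 : 0 < y0)
    (h01 : y0 ≤ y1) {t : ℝ} (ht0 : 0 ≤ t) (ht1 : t ≤ 1) :
    φ ((1 - t) * y0 + t * y1) ≤ (1 - t) * φ y0 + t * φ y1 + (y1 - y0) * ∫ s in y0..y1, B s := by
  have hBI : ∀ a b, 0 < a → 0 < b → IntervalIntegrable B volume a b := fun a b ha hb =>
    (hB.mono fun z hz => lt_of_lt_of_le (lt_min ha hb) hz.1).intervalIntegrable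
  -- adding a second primitive `g` of `B` makes `φ` convex
  set b1 : ℝ → ℝ := fun s => ∫ r in y0..s, B r with hb1
  have db1 : ∀ s, 0 < s → HasDerivAt b1 (B s) s := by
    intro s hs
    refine intervalIntegral.integral_hasDerivAt_right (hBI _ _ h0 hs) ?_
      (hB.continuousAt (Ioi_mem_nhds hs))
    exact hB.stronglyMeasurableAtFilter isOpen_Ioi s hs
  have cb1 : ContinuousOn b1 (Ioi 0) := fun s hs => (db1 s hs).continuousAt.continuousWithinAt
  have hbI : ∀ a b, 0 < a → 0 < b → IntervalIntegrable b1 volume a b := fun a b ha hb =>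
    (cb1.mono fun z hz => lt_of_lt_of_le (lt_min ha hb) hz.1).intervalIntegrable
  set g : ℝ → ℝ := fun s => ∫ r in y0..s, b1 r with hg
  have dg : ∀ s, 0 < s → HasDerivAt g (b1 s) s := by
    intro s hs
    refine intervalIntegral.integral_hasDerivAt_right (hbI _ _ h0 hs) ?_
      (cb1.continuousAt (Ioi_mem_nhds hs))
    exact cb1.stronglyMeasurableAtFilter isOpen_Ioi s hs
  have hconv : ConvexOn ℝ (Ioi 0) fun s => φ s + g s := by
    refine convexOn_of_hasDerivWithinAt2_nonneg (convex_Ioi 0) (f' := fun s => φ' s + b1 s)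
      (f'' := fun s => φ'' s + B s) ?_ ?_ ?_ ?_
    · exact fun s hs => ((h1 s hs).add (dg s hs)).continuousAt.continuousWithinAt
    · rw [interior_Ioi]
      exact fun s hs => ((h1 s hs).add (dg s hs)).hasDerivWithinAt
    · rw [interior_Ioi]
      exact fun s hs => ((h2 s hs).add (db1 s hs)).hasDerivWithinAt
    · rw [interior_Ioi]
      intro s hs
      linarith [h3 s hs]
  have b1nn : ∀ s, y0 ≤ s → 0 ≤ b1 s := fun s hs =>
    intervalIntegral.integral_nonneg hs fun r hr => hB0 r (lt_of_lt_of_le h0 hr.1)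
  have gnn : ∀ s, y0 ≤ s → 0 ≤ g s := fun s hs =>
    intervalIntegral.integral_nonneg hs fun r hr => b1nn r hr.1
  have g0 : g y0 = 0 := by simp [hg]
  have g1 : g y1 ≤ (y1 - y0) * b1 y1 := by
    have : g y1 ≤ ∫ r in y0..y1, b1 y1 := by
      refine intervalIntegral.integral_mono_on h01 (hbI _ _ h0 (h0.trans_le h01)) (by simp)
        fun r hr => ?_
      have := intervalIntegral.integral_add_adjacent_intervals
        (hBI y0 r h0 (h0.trans_le hr.1)) (hBI r y1 (h0.trans_le hr.1) (h0.trans_le h01))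
      have h' : 0 ≤ ∫ s in r..y1, B s :=
        intervalIntegral.integral_nonneg hr.2 fun q hq => hB0 q (h0.trans_le (hr.1.trans hq.1))
      simp only [hb1]
      linarith
    simpa using this
  have key := hconv.2 (show y0 ∈ Ioi 0 from h0) (show y1 ∈ Ioi 0 from h0.trans_le h01)
    (sub_nonneg.2 ht1) ht0 (by ring)
  simp only [smul_eq_mul, g0, add_zero] at key
  have hy : y0 ≤ (1 - t) * y0 + t * y1 := by nlinarith
  have := gnn _ hy
  have h5 : t * g y1 ≤ g y1 := by nlinarith [gnn y1 h01]
  have e : b1 y1 = ∫ s in y0..y1, B s := rfl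
  rw [← e]
  linarith

/-- The sum of the second derivatives of `χ` along an orthonormal basis. -/
noncomputable def trace2 {ι : Type*} [Fintype ι] (e : OrthonormalBasis ι ℝ V) (χ : V → ℝ)
    (x : V) : ℝ := ∑ i, fderiv ℝ (fun z => fderiv ℝ χ z (e i)) x (e i)

/-- The derivative of `2 ⟪f, f' v⟫` along a map `c`, when `f` and `f'` are differentiable with
derivatives `A` and `B`; for `A = f'` this is a second derivative of `|f|²`. -/
theorem hasFDerivAt_two_mul_inner {X E : Type*} [NormedAddCommGroup X] [NormedSpace ℝ X]
    [NormedAddCommGroup E] [NormedSpace ℝ E] {f : E → ℂ} {f' : E → E →L[ℝ] ℂ} {c : X → E}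
    {L : X →L[ℝ] E} {A : E →L[ℝ] ℂ} {B : E →L[ℝ] E →L[ℝ] ℂ} {z : X} (hc : HasFDerivAt c L z)
    (h1 : HasFDerivAt f A (c z)) (h2 : HasFDerivAt f' B (c z)) (v : E) :
    ∃ D : X →L[ℝ] ℝ, HasFDerivAt (fun z => 2 * ⟪f (c z), f' (c z) v⟫) D z ∧
      ∀ w, D w = 2 * (⟪f (c z), B (L w) v⟫ + ⟪A (L w), f' (c z) v⟫) := by
  have k1 : HasFDerivAt (fun z => f (c z)) (A ∘L L) z := h1.comp z hc
  have k2 : HasFDerivAt (fun z => f' (c z)) (B ∘L L) z := h2.comp z hc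
  have k3 : HasFDerivAt (fun z => f' (c z) v) ((ContinuousLinearMap.apply ℝ ℂ v) ∘L (B ∘L L)) z :=
    (ContinuousLinearMap.apply ℝ ℂ v).hasFDerivAt.comp z k2
  refine ⟨_, (k1.inner ℝ k3).const_mul 2, fun w => ?_⟩
  simp

/-- The chord inequality for the energy of the slices, localized by a cutoff `χ`. The space is
presented as `j x + y • t` with a linear map `j` and a vertical vector `t`, and harmonicity by
second derivatives. As `|f|²` is subharmonic, the second derivative of the localized energy is at
least `-∫ |f|² |Δχ|`. -/
theorem slice_energy_le_chord {E ι : Type*} [NormedAddCommGroup E] [NormedSpace ℝ E] [Fintype ι]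
    (e : OrthonormalBasis ι ℝ V) {f : E → ℂ} (j : V →L[ℝ] E) (t : E)
    (hf : ∀ (x : V) (y : ℝ), 0 < y → ContDiffAt ℝ 2 f (j x + y • t))
    (hΔ : ∀ (x : V) (y : ℝ), 0 < y → ∑ i, fderiv ℝ (fderiv ℝ f) (j x + y • t) (j (e i)) (j (e i)) +
      fderiv ℝ (fderiv ℝ f) (j x + y • t) t t = 0)
    {χ : V → ℝ} (hχ : ContDiff ℝ 2 χ) (hc : HasCompactSupport χ) (hχ0 : ∀ x, 0 ≤ χ x)
    {y0 y1 : ℝ} (h0 : 0 < y0) (h01 : y0 ≤ y1) {s : ℝ} (hs0 : 0 ≤ s) (hs1 : s ≤ 1) :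
    ∫ x, ‖f (j x + ((1 - s) * y0 + s * y1) • t)‖ ^ 2 * χ x ≤
      (1 - s) * (∫ x, ‖f (j x + y0 • t)‖ ^ 2 * χ x) + s * (∫ x, ‖f (j x + y1 • t)‖ ^ 2 * χ x) +
      (y1 - y0) * ∫ y in y0..y1, ∫ x, ‖f (j x + y • t)‖ ^ 2 * |trace2 e χ x| := by
  have d1 : ∀ (x : V) (y : ℝ), 0 < y → HasFDerivAt f (fderiv ℝ f (j x + y • t)) (j x + y • t) :=
    fun x y hy => ((hf x y hy).differentiableAt two_ne_zero).hasFDerivAt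
  have cd : ∀ (x : V) (y : ℝ), 0 < y → ContDiffAt ℝ 1 (fderiv ℝ f) (j x + y • t) :=
    fun x y hy => (hf x y hy).fderiv_right (by norm_num)
  have d2 : ∀ (x : V) (y : ℝ), 0 < y →
      HasFDerivAt (fderiv ℝ f) (fderiv ℝ (fderiv ℝ f) (j x + y • t)) (j x + y • t) :=
    fun x y hy => ((cd x y hy).differentiableAt one_ne_zero).hasFDerivAt
  have hPc : Continuous fun q : V × ℝ => j q.1 + q.2 • t := by fun_prop
  have c0 : ContinuousOn (fun q : V × ℝ => f (j q.1 + q.2 • t)) (univ ×ˢ Ioi 0) :=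
    fun q hq => (((hf q.1 q.2 hq.2).continuousAt).comp (f := fun q : V × ℝ => j q.1 + q.2 • t)
      hPc.continuousAt).continuousWithinAt
  have c1 : ContinuousOn (fun q : V × ℝ => fderiv ℝ f (j q.1 + q.2 • t)) (univ ×ˢ Ioi 0) :=
    fun q hq => (((cd q.1 q.2 hq.2).continuousAt).comp (f := fun q : V × ℝ => j q.1 + q.2 • t)
      hPc.continuousAt).continuousWithinAt
  have c2 : ContinuousOn (fun q : V × ℝ => fderiv ℝ (fderiv ℝ f) (j q.1 + q.2 • t))
      (univ ×ˢ Ioi 0) :=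
    fun q hq => ((((cd q.1 q.2 hq.2).fderiv_right (m := 0) (by norm_num)).continuousAt).comp
      (f := fun q : V × ℝ => j q.1 + q.2 • t) hPc.continuousAt).continuousWithinAt
  -- the energy density and its first two vertical derivatives
  set G : V → ℝ → ℝ := fun x y => ‖f (j x + y • t)‖ ^ 2 with hG
  set G' : V → ℝ → ℝ := fun x y =>
    2 * ⟪f (j x + y • t), fderiv ℝ f (j x + y • t) t⟫ with hG'
  set G'' : V → ℝ → ℝ := fun x y =>
    2 * (⟪f (j x + y • t), fderiv ℝ (fderiv ℝ f) (j x + y • t) t t⟫ +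
    ⟪fderiv ℝ f (j x + y • t) t, fderiv ℝ f (j x + y • t) t⟫) with hG''
  have hline : ∀ (x : V) (y : ℝ), HasDerivAt (fun y : ℝ => j x + y • t) t y := by
    intro x y
    simpa using ((hasDerivAt_id y).smul_const t).const_add (j x)
  have dG : ∀ (x : V) (y : ℝ), 0 < y → HasDerivAt (G x) (G' x y) y := fun x y hy =>
    ((d1 x y hy).comp_hasDerivAt y (hline x y)).norm_sq
  have dG' : ∀ (x : V) (y : ℝ), 0 < y → HasDerivAt (G' x) (G'' x y) y := by
    intro x y hy
    obtain ⟨D, hD, hDw⟩ := hasFDerivAt_two_mul_inner (hline x y).hasFDerivAt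
      (d1 x y hy) (d2 x y hy) t
    have h3 := hD.hasDerivAt
    rw [hDw 1] at h3
    simpa only [ContinuousLinearMap.toSpanSingleton_apply, one_smul] using h3
  have cG : ContinuousOn (Function.uncurry G) (univ ×ˢ Ioi 0) := by
    exact c0.norm.pow 2
  have c1t : ContinuousOn (fun q : V × ℝ => fderiv ℝ f (j q.1 + q.2 • t) t) (univ ×ˢ Ioi 0) :=
    c1.clm_apply continuousOn_const
  have c2t : ContinuousOn (fun q : V × ℝ => fderiv ℝ (fderiv ℝ f) (j q.1 + q.2 • t) t t)
      (univ ×ˢ Ioi 0) := (c2.clm_apply continuousOn_const).clm_apply continuousOn_const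
  have cG' : ContinuousOn (Function.uncurry G') (univ ×ˢ Ioi 0) :=
    continuousOn_const.mul (c0.inner c1t)
  have cG'' : ContinuousOn (Function.uncurry G'') (univ ×ˢ Ioi 0) :=
    continuousOn_const.mul ((c0.inner c2t).add (c1t.inner c1t))
  have hχ2 : ∀ i, Continuous fun z => fderiv ℝ (fun z => fderiv ℝ χ z (e i)) z (e i) := fun i =>
    ((((hχ.fderiv_right (m := 1) (by norm_num)).clm_apply contDiff_const).continuous_fderiv
      (by norm_num)).clm_apply continuous_const)
  have hχc : ∀ i, HasCompactSupport fun z => fderiv ℝ (fun z => fderiv ℝ χ z (e i)) z (e i) :=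
    fun i => (hc.fderiv_apply (𝕜 := ℝ) (e i)).fderiv_apply (𝕜 := ℝ) (e i)
  have ctr : Continuous (trace2 e χ) := continuous_finsetSum _ fun i _ => hχ2 i
  have htr : HasCompactSupport (trace2 e χ) := by
    refine HasCompactSupport.intro' hc (isClosed_tsupport χ) fun x hx => ?_
    refine Finset.sum_eq_zero fun i _ => image_eq_zero_of_notMem_tsupport
      (f := fun x => fderiv ℝ (fun z => fderiv ℝ χ z (e i)) x (e i)) fun h => hx ?_
    exact tsupport_fderiv_apply_subset ℝ (e i) (tsupport_fderiv_apply_subset ℝ (e i) h)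
  refine le_chord_add_of_deriv2_ge (φ := fun y => ∫ x, G x y * χ x)
    (φ' := fun y => ∫ x, G' x y * χ x) (φ'' := fun y => ∫ x, G'' x y * χ x)
    (fun y hy => hasDerivAt_integral_mul_of_hasCompactSupport hχ.continuous hc cG cG' dG hy)
    (fun y hy => hasDerivAt_integral_mul_of_hasCompactSupport hχ.continuous hc cG' cG'' dG' hy)
    (continuousOn_integral_mul_of_hasCompactSupport ctr.abs htr.abs cG)
    (fun y hy => integral_nonneg fun x => by positivity) ?_ h0 h01 hs0 hs1
  intro y hy
  -- horizontal second derivatives of the energy density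
  have hUC : ContDiff ℝ 2 fun x => G x y := by
    refine contDiff_iff_contDiffAt.2 fun x => ContDiffAt.norm_sq ℝ ?_
    exact (hf x y hy).comp (f := fun x => j x + y • t) x (by fun_prop)
  have hj : ∀ x, HasFDerivAt (fun x => j x + y • t) j x := fun x =>
    j.hasFDerivAt.add_const _
  have hU1 : ∀ v, (fun z => fderiv ℝ (fun x => G x y) z v) =
      fun z => 2 * ⟪f (j z + y • t), fderiv ℝ f (j z + y • t) (j v)⟫ := by
    intro v
    ext z
    have := ((d1 z y hy).comp z (hj z)).norm_sq
    rw [show (fun x => G x y) = fun x => ‖(f ∘ fun x => j x + y • t) x‖ ^ 2 from rfl, this.fderiv]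
    simp
    ring
  have hU2 : ∀ v z, fderiv ℝ (fun z => fderiv ℝ (fun x => G x y) z v) z v =
      2 * (⟪f (j z + y • t), fderiv ℝ (fderiv ℝ f) (j z + y • t) (j v) (j v)⟫ +
        ⟪fderiv ℝ f (j z + y • t) (j v), fderiv ℝ f (j z + y • t) (j v)⟫) := by
    intro v z
    rw [hU1 v]
    obtain ⟨D, hD, hDw⟩ := hasFDerivAt_two_mul_inner (hj z) (d1 z y hy) (d2 z y hy) (j v)
    rw [hD.fderiv, hDw v]
  have hUc2 : ∀ i, Continuous fun z =>
      fderiv ℝ (fun z => fderiv ℝ (fun x => G x y) z (e i)) z (e i) := fun i =>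
    ((((hUC.fderiv_right (m := 1) (by norm_num)).clm_apply contDiff_const).continuous_fderiv
      (by norm_num)).clm_apply continuous_const)
  -- pointwise, `Δ|f|² ≥ 0`: the vertical second derivative dominates minus the horizontal ones
  have hpt : ∀ x,
      -∑ i, fderiv ℝ (fun z => fderiv ℝ (fun x => G x y) z (e i)) x (e i) ≤ G'' x y := by
    intro x
    simp only [hU2, hG'']
    have h := congrArg (fun w => ⟪f (j x + y • t), w⟫) (hΔ x y hy)
    simp only [inner_add_right, inner_sum, inner_zero_right] at h
    rw [← Finset.mul_sum, Finset.sum_add_distrib]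
    have h5 : 0 ≤ ∑ i, ⟪fderiv ℝ f (j x + y • t) (j (e i)), fderiv ℝ f (j x + y • t) (j (e i))⟫ :=
      Finset.sum_nonneg fun i _ => real_inner_self_nonneg
    have h6 : 0 ≤ ⟪fderiv ℝ f (j x + y • t) t, fderiv ℝ f (j x + y • t) t⟫ := real_inner_self_nonneg
    linarith
  have cGy : Continuous fun x => G x y := hUC.continuous
  have cG''y : Continuous fun x => G'' x y :=
    cG''.comp_continuous (f := fun x => (x, y)) (by fun_prop) fun x => ⟨mem_univ _, hy⟩
  calc -∫ x, G x y * |trace2 e χ x| ≤ -∫ x, G x y * trace2 e χ x := by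
        refine neg_le_neg (integral_mono ?_ ?_ fun x => ?_)
        · exact (cGy.mul ctr).integrable_of_hasCompactSupport htr.mul_left
        · exact (cGy.mul ctr.abs).integrable_of_hasCompactSupport htr.abs.mul_left
        · exact mul_le_mul_of_nonneg_left (le_abs_self _) (by positivity)
    _ = ∫ x, (-∑ i, fderiv ℝ (fun z => fderiv ℝ (fun x => G x y) z (e i)) x (e i)) * χ x := by
        simp only [trace2, Finset.mul_sum, neg_mul, Finset.sum_mul, integral_neg]
        rw [integral_finsetSum, integral_finsetSum]
        · simp only [integral_fderiv_fderiv_mul hUC hχ hc]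
        · exact fun i _ => ((hUc2 i).mul hχ.continuous).integrable_of_hasCompactSupport hc.mul_left
        · exact fun i _ => (cGy.mul (hχ2 i)).integrable_of_hasCompactSupport (hχc i).mul_left
    _ ≤ ∫ x, G'' x y * χ x := by
        refine integral_mono ?_ ?_ fun x => mul_le_mul_of_nonneg_right (hpt x) (hχ0 x)
        · exact ((continuous_finsetSum _ fun i _ => hUc2 i).neg.mul
            hχ.continuous).integrable_of_hasCompactSupport hc.mul_left
        · exact (cG''y.mul hχ.continuous).integrable_of_hasCompactSupport hc.mul_left

end Convexity

section SliceEnergy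

variable {V : Type*} [NormedAddCommGroup V] [InnerProductSpace ℝ V] [FiniteDimensional ℝ V]

theorem trace2_comp_smul {V ι : Type*} [NormedAddCommGroup V] [InnerProductSpace ℝ V]
     [Fintype ι] (e : OrthonormalBasis ι ℝ V) {χ : V → ℝ}
    (r : ℝ) (x : V) : trace2 e (fun x => χ (r • x)) x = r ^ 2 * trace2 e χ (r • x) := by
  have aux : ∀ (F : V → ℝ) (v : V),
      fderiv ℝ (fun z => r • F (r • z)) x v = r ^ 2 * fderiv ℝ F (r • x) v := by
    intro F v
    rw [show (fun z => r • F (r • z)) = r • (fun z => F (r • z)) from rfl,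
      fderiv_const_smul_field, Pi.smul_apply, fderiv_comp_smul]
    simp
    ring
  simp only [trace2, Finset.mul_sum]
  refine Finset.sum_congr rfl fun i _ => ?_
  have h1 : (fun z => fderiv ℝ (fun x => χ (r • x)) z (e i)) =
      fun z => r • (fun z => fderiv ℝ χ z (e i)) (r • z) := by
    ext z
    rw [fderiv_comp_smul]
    simp
  rw [h1]
  exact aux (fun z => fderiv ℝ χ z (e i)) (e i)

/-- Smooth cutoffs tending to `1` whose Laplacians tend to `0` uniformly. -/
theorem exists_cutoff {ι : Type*} [Fintype ι] (e : OrthonormalBasis ι ℝ V) :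
    ∃ (χ : ℕ → V → ℝ) (C : ℝ), (∀ k, ContDiff ℝ 2 (χ k)) ∧ (∀ k, HasCompactSupport (χ k)) ∧
      (∀ k x, 0 ≤ χ k x) ∧ (∀ k x, χ k x ≤ 1) ∧ (∀ x, ∀ᶠ k in atTop, χ k x = 1) ∧
      (∀ k x, |trace2 e (χ k) x| ≤ C * (1 / ((k : ℝ) + 1)) ^ 2) := by
  let b : ContDiffBump (0 : V) := ⟨1, 2, one_pos, one_lt_two⟩
  have hb : ContDiff ℝ 2 b := b.contDiff
  have ctr : Continuous (trace2 e b) := continuous_finsetSum _ fun i _ =>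
    ((((hb.fderiv_right (m := 1) (by norm_num)).clm_apply contDiff_const).continuous_fderiv
      (by norm_num)).clm_apply continuous_const)
  have htr : HasCompactSupport (trace2 e b) := by
    refine HasCompactSupport.intro' b.hasCompactSupport (isClosed_tsupport b) fun x hx => ?_
    refine Finset.sum_eq_zero fun i _ => image_eq_zero_of_notMem_tsupport
      (f := fun x => fderiv ℝ (fun z => fderiv ℝ b z (e i)) x (e i)) fun h => hx ?_
    exact tsupport_fderiv_apply_subset ℝ (e i) (tsupport_fderiv_apply_subset ℝ (e i) h)
  obtain ⟨C, hC⟩ := htr.exists_bound_of_continuous ctr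
  have hr : ∀ k : ℕ, (1 / ((k : ℝ) + 1)) ≠ 0 := fun k => by positivity
  refine ⟨fun k x => b ((1 / ((k : ℝ) + 1)) • x), C, fun k => ?_, fun k => ?_, fun k x => b.nonneg,
    fun k x => b.le_one, fun x => ?_, fun k x => ?_⟩
  · exact hb.comp (contDiff_const_smul _)
  · exact b.hasCompactSupport.comp_homeomorph (Homeomorph.smulOfNeZero _ (hr k))
  · have ht : Tendsto (fun k : ℕ => (1 / ((k : ℝ) + 1)) • x) atTop (𝓝 0) := by
      simpa using (tendsto_one_div_add_atTop_nhds_zero_nat (𝕜 := ℝ)).smul_const x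
    filter_upwards [ht (Metric.closedBall_mem_nhds (0 : V) one_pos)] with k hk
    exact b.one_of_mem_closedBall hk
  · rw [trace2_comp_smul, abs_mul, abs_of_nonneg (by positivity), mul_comm C]
    exact mul_le_mul_of_nonneg_left (hC _) (by positivity)

variable [MeasurableSpace V] [BorelSpace V]

/-- The squared `L²`-norm of the slice of `f` at height `y`. -/
noncomputable def sliceEnergy (f : WithLp 2 (V × ℝ) → ℂ) (y : ℝ) : ENNReal :=
  ∫⁻ x, ‖f (toLp 2 (x, y))‖ₑ ^ 2

theorem ofReal_integral_le_lintegral {X : Type*} [MeasurableSpace X] {μ : Measure X} (f : X → ℝ) :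
    ENNReal.ofReal (∫ x, f x ∂μ) ≤ ∫⁻ x, ENNReal.ofReal (f x) ∂μ := by
  by_cases hf : Integrable f μ
  · rw [integral_eq_lintegral_pos_part_sub_lintegral_neg_part hf]
    refine (ENNReal.ofReal_le_ofReal (sub_le_self _ ENNReal.toReal_nonneg)).trans ?_
    exact ENNReal.ofReal_toReal_le
  · simp [integral_undef hf]

theorem continuous_slice {V : Type*} [NormedAddCommGroup V] {f : WithLp 2 (V × ℝ) → ℂ} 
    (hf : ContinuousOn f (upperHalf V)) {y : ℝ} (hy : 0 < y) : Continuous fun x => f (toLp 2 (x, y)) :=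
  hf.comp_continuous (by fun_prop) fun _ => hy

theorem enorm_sq_eq_ofReal (z : ℂ) : ‖z‖ₑ ^ 2 = ENNReal.ofReal (‖z‖ ^ 2) := by
  rw [← ofReal_norm, ENNReal.ofReal_pow (norm_nonneg _)]

/-- The energy of the slices of a harmonic function lies below its chords. -/
theorem sliceEnergy_le_chord {f : WithLp 2 (V × ℝ) → ℂ}
    (hf : InnerProductSpace.HarmonicOnNhd f (upperHalf V)) {y0 y1 : ℝ} (h0 : 0 < y0)
    (h01 : y0 ≤ y1) (hfin : ∫⁻ y in Ioc y0 y1, sliceEnergy f y < ⊤) {s : ℝ} (hs0 : 0 ≤ s)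
    (hs1 : s ≤ 1) :
    sliceEnergy f ((1 - s) * y0 + s * y1) ≤
      ENNReal.ofReal (1 - s) * sliceEnergy f y0 + ENNReal.ofReal s * sliceEnergy f y1 := by
  set e := stdOrthonormalBasis ℝ V
  obtain ⟨χ, C, hχ, hχc, hχ0, hχ1, hχlim, hχC⟩ := exists_cutoff e
  have hC0 : 0 ≤ C := by
    have := (abs_nonneg _).trans (hχC 0 0)
    simpa using this
  let j : V →L[ℝ] WithLp 2 (V × ℝ) :=
    ((WithLp.prodContinuousLinearEquiv 2 ℝ V ℝ).symm : (V × ℝ) →L[ℝ] WithLp 2 (V × ℝ)) ∘L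
      ContinuousLinearMap.inl ℝ V ℝ
  have hj : ∀ x, j x = toLp 2 (x, (0 : ℝ)) := fun x => rfl
  set t : WithLp 2 (V × ℝ) := toLp 2 ((0 : V), (1 : ℝ)) with ht
  have hP : ∀ (x : V) (y : ℝ), j x + y • t = toLp 2 (x, y) := by
    intro x y
    rw [hj, ht, ← toLp_smul, ← toLp_add]
    simp
  have hcont : ContinuousOn f (upperHalf V) := hf.continuousOn
  have hypos : 0 < (1 - s) * y0 + s * y1 := by nlinarith
  have key := fun k => slice_energy_le_chord e (f := f) j t
    (fun x y hy => by rw [hP]; exact (hf _ hy).1)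
    (fun x y hy => by
      rw [hP]
      have h := (hf (toLp 2 (x, y)) hy).2.self_of_nhds
      rw [laplacian_eq_sum_add e] at h
      simp only [iteratedFDeriv_two_diag] at h
      exact h)
    (hχ k) (hχc k) (hχ0 k) h0 h01 hs0 hs1
  simp only [hP] at key
  have hint : ∀ k y, 0 < y → Integrable fun x => ‖f (toLp 2 (x, y))‖ ^ 2 * χ k x := fun k y hy =>
    (((continuous_slice hcont hy).norm.pow 2).mul (hχ k).continuous).integrable_of_hasCompactSupport
      (hχc k).mul_left
  have hle : ∀ k y, 0 < y →
      ENNReal.ofReal (∫ x, ‖f (toLp 2 (x, y))‖ ^ 2 * χ k x) ≤ sliceEnergy f y := by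
    intro k y hy
    rw [ofReal_integral_eq_lintegral_ofReal (hint k y hy)
      (Eventually.of_forall fun x => mul_nonneg (by positivity) (hχ0 k x))]
    refine lintegral_mono fun x => ?_
    rw [enorm_sq_eq_ofReal]
    exact ENNReal.ofReal_le_ofReal (mul_le_of_le_one_right (by positivity) (hχ1 k x))
  have herr : ∀ k,
      ENNReal.ofReal (∫ y in y0..y1, ∫ x, ‖f (toLp 2 (x, y))‖ ^ 2 * |trace2 e (χ k) x|) ≤
      ENNReal.ofReal (C * (1 / ((k : ℝ) + 1)) ^ 2) * ∫⁻ y in Ioc y0 y1, sliceEnergy f y := by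
    intro k
    rw [intervalIntegral.integral_of_le h01, ← lintegral_const_mul' _ _ ENNReal.ofReal_ne_top]
    refine (ofReal_integral_le_lintegral _).trans ?_
    refine setLIntegral_mono' measurableSet_Ioc fun y hy => ?_
    refine (ofReal_integral_le_lintegral _).trans ?_
    rw [sliceEnergy, ← lintegral_const_mul' _ _ ENNReal.ofReal_ne_top]
    refine lintegral_mono fun x => ?_
    rw [enorm_sq_eq_ofReal, ← ENNReal.ofReal_mul (by positivity), mul_comm]
    exact ENNReal.ofReal_le_ofReal (mul_le_mul_of_nonneg_right (hχC k x) (by positivity))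
  set M := ∫⁻ y in Ioc y0 y1, sliceEnergy f y
  set A := ENNReal.ofReal (1 - s) * sliceEnergy f y0 + ENNReal.ofReal s * sliceEnergy f y1 with hA
  set δ : ℕ → ENNReal := fun k => ENNReal.ofReal (y1 - y0) *
    (ENNReal.ofReal (C * (1 / ((k : ℝ) + 1)) ^ 2) * M) with hδ
  set yy := (1 - s) * y0 + s * y1 with hyy
  have hk : ∀ k, ENNReal.ofReal (∫ x, ‖f (toLp 2 (x, yy))‖ ^ 2 * χ k x) ≤ A + δ k := by
    intro k
    refine (ENNReal.ofReal_le_ofReal (key k)).trans ?_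
    refine ENNReal.ofReal_add_le.trans
      (add_le_add (ENNReal.ofReal_add_le.trans (add_le_add ?_ ?_)) ?_)
    · rw [ENNReal.ofReal_mul (by linarith)]
      gcongr
      exact hle k y0 h0
    · rw [ENNReal.ofReal_mul hs0]
      gcongr
      exact hle k y1 (h0.trans_le h01)
    · rw [ENNReal.ofReal_mul (by linarith)]
      exact mul_le_mul_right (herr k) _
  have hδ0 : Tendsto (fun k => A + δ k) atTop (𝓝 (A + 0)) := by
    refine tendsto_const_nhds.add ?_
    have h1 : Tendsto (fun k : ℕ => ENNReal.ofReal (C * (1 / ((k : ℝ) + 1)) ^ 2)) atTop (𝓝 0) := by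
      have := ((tendsto_one_div_add_atTop_nhds_zero_nat (𝕜 := ℝ)).pow 2).const_mul C
      simpa [Function.comp_def] using (ENNReal.continuous_ofReal.tendsto _).comp this
    have h2 := ENNReal.Tendsto.mul_const (b := M) h1 (Or.inr hfin.ne)
    have h3 := ENNReal.Tendsto.const_mul (a := ENNReal.ofReal (y1 - y0)) h2
      (Or.inr ENNReal.ofReal_ne_top)
    simpa [hδ] using h3
  rw [add_zero] at hδ0
  -- Fatou's lemma for the limit of the cutoffs
  calc sliceEnergy f yy =
      ∫⁻ x, liminf (fun k => ENNReal.ofReal (‖f (toLp 2 (x, yy))‖ ^ 2 * χ k x)) atTop := by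
        refine lintegral_congr fun x => ?_
        rw [enorm_sq_eq_ofReal]
        refine (Tendsto.liminf_eq ?_).symm
        refine tendsto_const_nhds.congr' ?_
        filter_upwards [hχlim x] with k hk
        rw [hk, mul_one]
    _ ≤ liminf (fun k => ∫⁻ x, ENNReal.ofReal (‖f (toLp 2 (x, yy))‖ ^ 2 * χ k x)) atTop := by
        refine lintegral_liminf_le' fun k => ?_
        exact (hint k yy hypos).aestronglyMeasurable.aemeasurable.ennreal_ofReal
    _ ≤ liminf (fun k => A + δ k) atTop := by
        refine liminf_le_liminf (Eventually.of_forall fun k => ?_)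
        change ∫⁻ x, ENNReal.ofReal (‖f (toLp 2 (x, yy))‖ ^ 2 * χ k x) ≤ A + δ k
        rw [← ofReal_integral_eq_lintegral_ofReal (hint k yy hypos)
          (Eventually.of_forall fun x => mul_nonneg (by positivity) (hχ0 k x))]
        exact hk k
    _ = A := hδ0.liminf_eq

end SliceEnergy

/-! ### Decay and continuity of the slices -/

section Decay

variable {V : Type*} [NormedAddCommGroup V] [InnerProductSpace ℝ V] [FiniteDimensional ℝ V]
  [MeasurableSpace V] [BorelSpace V]

/-- If the energy of the slices does not tend to infinity, then it decreases with the height. -/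
theorem sliceEnergy_anti {f : WithLp 2 (V × ℝ) → ℂ}
    (hf : InnerProductSpace.HarmonicOnNhd f (upperHalf V))
    (hloc : ∀ a b, 0 < a → ∫⁻ y in Ioc a b, sliceEnergy f y < ⊤) {C : ENNReal} (hC : C ≠ ⊤)
    (hfreq : ∃ᶠ c in atTop, sliceEnergy f c ≤ C) {a b : ℝ} (ha : 0 < a) (hab : a ≤ b) :
    sliceEnergy f b ≤ sliceEnergy f a := by
  rcases hab.eq_or_lt with rfl | hab
  · exact le_rfl
  -- `b` lies below the chord from `a` to `c`; the weight of `c` tends to `0` as `c → ∞`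
  have h1 : Tendsto (fun c : ℝ => ENNReal.ofReal ((b - a) / (c - a)) * C) atTop (𝓝 0) := by
    have h2 : Tendsto (fun c : ℝ => (b - a) / (c - a)) atTop (𝓝 0) :=
      tendsto_const_nhds.div_atTop (tendsto_atTop_add_const_right _ _ tendsto_id)
    have h3 := (ENNReal.continuous_ofReal.tendsto _).comp h2
    simpa [Function.comp_def] using ENNReal.Tendsto.mul_const (b := C) h3 (Or.inr hC)
  refine ENNReal.le_of_forall_pos_le_add fun ε hε _ => ?_
  have h4 : ∀ᶠ c in atTop, ENNReal.ofReal ((b - a) / (c - a)) * C ≤ ε :=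
    h1.eventually_le_const (by simpa using hε)
  obtain ⟨c, hc1, hc2, hc3⟩ := (hfreq.and_eventually (h4.and (eventually_gt_atTop b))).exists
  have hca : 0 < c - a := by linarith
  have hs0 : 0 ≤ (b - a) / (c - a) := div_nonneg (by linarith) hca.le
  have hs1 : (b - a) / (c - a) ≤ 1 := (div_le_one hca).2 (by linarith)
  have key := sliceEnergy_le_chord hf ha (by linarith : a ≤ c) (hloc a c ha) hs0 hs1
  have e : (1 - (b - a) / (c - a)) * a + (b - a) / (c - a) * c = b := by
    field_simp
    ring
  rw [e] at key
  refine key.trans (add_le_add ?_ ?_)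
  · exact mul_le_of_le_one_left' (ENNReal.ofReal_le_one.2 (by linarith))
  · exact (mul_le_mul_right hc1 _).trans hc2

theorem aestronglyMeasurable_comp_toLp {f : WithLp 2 (V × ℝ) → ℂ}
    (hf : ContinuousOn f (upperHalf V)) (ν : Measure ℝ) [SFinite ν] :
    AEStronglyMeasurable (fun q : V × ℝ => f (toLp 2 q)) (volume.prod (ν.restrict (Ioi 0))) := by
  have h : ContinuousOn (fun q : V × ℝ => f (toLp 2 q)) (univ ×ˢ Ioi 0) :=
    hf.comp (by fun_prop) fun q hq => hq.2
  have := h.aestronglyMeasurable (μ := volume.prod ν) (MeasurableSet.univ.prod measurableSet_Ioi)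
  rwa [← Measure.prod_restrict, Measure.restrict_univ] at this

theorem sliceEnergy_anti_of_lintegral {f : WithLp 2 (V × ℝ) → ℂ}
    (hf : InnerProductSpace.HarmonicOnNhd f (upperHalf V))
    (hint : ∀ δ, 0 < δ → ∫⁻ y in Ioi δ, sliceEnergy f y < ⊤) {a b : ℝ} (ha : 0 < a)
    (hab : a ≤ b) : sliceEnergy f b ≤ sliceEnergy f a := by
  refine sliceEnergy_anti hf (fun a b ha => (lintegral_mono_set Ioc_subset_Ioi_self).trans_lt
    (hint a ha)) (C := 1) ENNReal.one_ne_top ?_ ha hab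
  intro h
  -- otherwise the energy exceeds `1` near infinity and is not integrable there
  obtain ⟨c, hc⟩ := eventually_atTop.1 h
  have h1 := hint (max c 1) (lt_max_of_lt_right one_pos)
  have h2 : ∫⁻ y in Ioi (max c 1), 1 ≤ ∫⁻ y in Ioi (max c 1), sliceEnergy f y :=
    setLIntegral_mono' measurableSet_Ioi fun y hy =>
      (not_le.1 (hc y (le_of_lt (lt_of_le_of_lt (le_max_left _ _) hy)))).le
  simp at h2
  simp [h2] at h1

theorem sliceEnergy_lt_top {f : WithLp 2 (V × ℝ) → ℂ}
    (hf : InnerProductSpace.HarmonicOnNhd f (upperHalf V))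
    (hint : ∀ δ, 0 < δ → ∫⁻ y in Ioi δ, sliceEnergy f y < ⊤) {y : ℝ} (hy : 0 < y) :
    sliceEnergy f y < ⊤ := by
  have h1 : ∫⁻ y in Ioc (y / 2) y, sliceEnergy f y < ⊤ :=
    (lintegral_mono_set Ioc_subset_Ioi_self).trans_lt (hint _ (half_pos hy))
  have h2 : ∫⁻ z in Ioc (y / 2) y, sliceEnergy f y ≤ ∫⁻ z in Ioc (y / 2) y, sliceEnergy f z :=
    setLIntegral_mono' measurableSet_Ioc fun z hz =>
      sliceEnergy_anti_of_lintegral hf hint ((half_pos hy).trans hz.1) hz.2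
  rw [setLIntegral_const] at h2
  refine ENNReal.lt_top_of_mul_ne_top_left (h2.trans_lt h1).ne ?_
  simp [hy]

/-- A sequence that converges pointwise, with energies not exceeding that of the limit, converges
in `L²`, by the parallelogram law and Fatou's lemma. -/
theorem tendsto_lintegral_sub_sq {X : Type*} [MeasurableSpace X] {μ : Measure X}
    {f : ℕ → X → ℂ} {g : X → ℂ} (hf : ∀ k, AEStronglyMeasurable (f k) μ)
    (hg : AEStronglyMeasurable g μ) (hlim : ∀ x, Tendsto (fun k => f k x) atTop (𝓝 (g x)))
    (hle : ∀ k, ∫⁻ x, ‖f k x‖ₑ ^ 2 ∂μ ≤ ∫⁻ x, ‖g x‖ₑ ^ 2 ∂μ)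
    (hfin : ∫⁻ x, ‖g x‖ₑ ^ 2 ∂μ < ⊤) :
    Tendsto (fun k => ∫⁻ x, ‖f k x - g x‖ₑ ^ 2 ∂μ) atTop (𝓝 0) := by
  set L := ∫⁻ x, ‖g x‖ₑ ^ 2 ∂μ with hL
  have par : ∀ k, ∫⁻ x, ‖f k x - g x‖ₑ ^ 2 ∂μ + ∫⁻ x, ‖f k x + g x‖ₑ ^ 2 ∂μ ≤ 4 * L := by
    intro k
    have hm : AEMeasurable (fun x => ‖f k x - g x‖ₑ ^ 2) μ := ((hf k).sub hg).enorm.pow_const 2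
    rw [← lintegral_add_left' hm]
    calc ∫⁻ x, (‖f k x - g x‖ₑ ^ 2 + ‖f k x + g x‖ₑ ^ 2) ∂μ
        = ∫⁻ x, (2 * ‖f k x‖ₑ ^ 2 + 2 * ‖g x‖ₑ ^ 2) ∂μ := by
          refine lintegral_congr fun x => ?_
          simp only [enorm_sq_eq_ofReal]
          rw [← ENNReal.ofReal_add (by positivity) (by positivity), ← ENNReal.ofReal_ofNat 2,
            ← ENNReal.ofReal_mul (by positivity), ← ENNReal.ofReal_mul (by positivity),
            ← ENNReal.ofReal_add (by positivity) (by positivity)]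
          congr 1
          have := parallelogram_law_with_norm ℝ (f k x) (g x)
          linarith
      _ = 2 * ∫⁻ x, ‖f k x‖ₑ ^ 2 ∂μ + 2 * L := by
          rw [lintegral_add_left' (((hf k).enorm.pow_const 2).const_mul 2),
            lintegral_const_mul' _ _ (by simp), lintegral_const_mul' _ _ (by simp)]
      _ ≤ 2 * L + 2 * L := by gcongr; exact hle k
      _ = 4 * L := by rw [← add_mul]; norm_num
  have hfatou : 4 * L ≤ liminf (fun k => ∫⁻ x, ‖f k x + g x‖ₑ ^ 2 ∂μ) atTop := by
    calc 4 * L = ∫⁻ x, liminf (fun k => ‖f k x + g x‖ₑ ^ 2) atTop ∂μ := by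
          rw [hL, ← lintegral_const_mul' _ _ (by simp)]
          refine lintegral_congr fun x => ?_
          have h1 : Tendsto (fun k => ‖f k x + g x‖ₑ ^ 2) atTop (𝓝 (‖g x + g x‖ₑ ^ 2)) :=
            ((ENNReal.continuous_pow 2).tendsto _).comp
              ((continuous_enorm.tendsto _).comp ((hlim x).add_const (g x)))
          rw [h1.liminf_eq, enorm_sq_eq_ofReal, enorm_sq_eq_ofReal, ← ENNReal.ofReal_ofNat 4,
            ← ENNReal.ofReal_mul (by positivity), ← two_mul, norm_mul]
          congr 1
          norm_num
          ring
      _ ≤ _ := lintegral_liminf_le' fun k => (((hf k).add hg).enorm.pow_const 2)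
  have h4 : 4 * L ≠ ⊤ := ENNReal.mul_ne_top (by simp) hfin.ne
  have hq : Tendsto (fun k => ∫⁻ x, ‖f k x + g x‖ₑ ^ 2 ∂μ) atTop (𝓝 (4 * L)) := by
    refine tendsto_of_le_liminf_of_limsup_le hfatou ?_
    refine (limsup_le_limsup (Eventually.of_forall fun k => le_add_self.trans (par k))).trans ?_
    simp
  have hsub := ENNReal.Tendsto.sub (tendsto_const_nhds (x := 4 * L) (f := atTop (α := ℕ))) hq
    (Or.inl h4)
  rw [tsub_self] at hsub
  refine tendsto_of_tendsto_of_tendsto_of_le_of_le tendsto_const_nhds hsub (fun k => zero_le)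
    fun k => ?_
  exact ENNReal.le_sub_of_add_le_right (ne_top_of_le_ne_top h4 (le_add_self.trans (par k))) (par k)

/-- A harmonic function with bounded slice energy which tends to zero at the boundary
vanishes. -/
theorem eq_zero_of_sliceEnergy_tendsto_zero {f : WithLp 2 (V × ℝ) → ℂ}
    (hf : InnerProductSpace.HarmonicOnNhd f (upperHalf V)) {C : ENNReal} (hC : C ≠ ⊤)
    (hb : ∀ y, 0 < y → sliceEnergy f y ≤ C)
    (h0 : Tendsto (fun k : ℕ => sliceEnergy f (1 / ((k : ℝ) + 1))) atTop (𝓝 0)) :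
    ∀ p ∈ upperHalf V, f p = 0 := by
  have hloc : ∀ a b, 0 < a → ∫⁻ y in Ioc a b, sliceEnergy f y < ⊤ := by
    intro a b ha
    refine (setLIntegral_mono' measurableSet_Ioc
      fun y hy => hb y (ha.trans hy.1)).trans_lt ?_
    rw [setLIntegral_const]
    exact ENNReal.mul_lt_top hC.lt_top (by simp)
  have hz : ∀ y, 0 < y → sliceEnergy f y = 0 := by
    intro y hy
    refine le_antisymm (ge_of_tendsto h0 ?_) zero_le
    filter_upwards [(tendsto_one_div_add_atTop_nhds_zero_nat (𝕜 := ℝ)).eventually_lt_const hy]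
      with k hk
    refine sliceEnergy_anti hf hloc hC ?_ (by positivity) hk.le
    exact ((eventually_gt_atTop 0).mono hb).frequently
  intro p hp
  have h1 := hz p.snd hp
  have hc := continuous_slice hf.continuousOn hp
  rw [sliceEnergy, lintegral_eq_zero_iff (hc.measurable.enorm.pow_const 2)] at h1
  have h2 : (fun x => f (toLp 2 (x, p.snd))) =ᵐ[volume] fun _ => 0 := by
    filter_upwards [h1] with x hx
    simpa using hx
  have h3 := (Continuous.ae_eq_iff_eq volume hc continuous_const).1 h2
  exact congrFun h3 p.fst

end Decay

/-! ### Fourier representation of harmonic functions with square integrable slices -/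

section PaleyWiener

variable {V : Type*} [NormedAddCommGroup V] [InnerProductSpace ℝ V] [FiniteDimensional ℝ V]
  [MeasurableSpace V] [BorelSpace V]

theorem integrable_poissonMul {y : ℝ} (hy : 0 < y) : Integrable (poissonMul y : V → ℝ) := by
  set n := Module.finrank ℝ V + 1
  set a := 2 * Real.pi * y with ha
  have ha0 : 0 < a := by positivity
  have hI : Integrable fun x : V => (1 + ‖x‖) ^ (-(n : ℝ)) :=
    integrable_one_add_norm (by simp [n])
  refine (hI.const_mul (Real.exp a * n.factorial / a ^ n)).mono'
    (continuous_poissonMul y).aestronglyMeasurable (Eventually.of_forall fun ξ => ?_)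
  rw [Real.norm_of_nonneg (poissonMul_pos y ξ).le, Real.rpow_neg (by positivity),
    Real.rpow_natCast, poissonMul]
  have h := Real.pow_div_factorial_le_exp (a * (1 + ‖ξ‖)) (by positivity) n
  rw [mul_add, mul_one, Real.exp_add, mul_comm a ‖ξ‖] at h
  rw [Real.exp_neg, show 2 * Real.pi * y * ‖ξ‖ = ‖ξ‖ * a by rw [ha]; ring, inv_le_comm₀
    (Real.exp_pos _) (by positivity)]
  rw [div_le_iff₀ (by positivity), show a + ‖ξ‖ * a = a * (1 + ‖ξ‖) by ring, mul_pow] at h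
  rw [mul_inv, inv_inv, inv_div, div_mul_eq_mul_div, div_le_iff₀ (by positivity)]
  linarith

theorem memLp_poissonMul {y : ℝ} (hy : 0 < y) : MemLp (poissonMul y : V → ℝ) 2 := by
  rw [memLp_two_iff_integrable_sq (continuous_poissonMul y).aestronglyMeasurable]
  refine (integrable_poissonMul (V := V) (y := y + y) (by positivity)).congr
    (Eventually.of_forall fun ξ => ?_)
  simp only [poissonMul_add, pow_two]

theorem memLp_poissonMul_mul {g : V → ℂ} (hg : MemLp g 2) {y : ℝ} (hy : 0 ≤ y) :
    MemLp (fun ξ => (poissonMul y ξ : ℂ) * g ξ) 2 := by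
  refine hg.mono ((Complex.continuous_ofReal.comp
    (continuous_poissonMul y)).aestronglyMeasurable.mul hg.1) (Eventually.of_forall fun ξ => ?_)
  rw [norm_mul, Complex.norm_real, Real.norm_of_nonneg (poissonMul_pos y ξ).le]
  exact mul_le_of_le_one_left (norm_nonneg _) (poissonMul_le_one hy ξ)

theorem PoissonIntegrable.of_memLp {g : V → ℂ} (hg : MemLp g 2) : PoissonIntegrable g where
  aestronglyMeasurable := hg.1
  integrable _ hy := (memLp_poissonMul hy).integrable_mul hg.norm

theorem PoissonIntegrable.integrable_mul {g : V → ℂ} (hg : PoissonIntegrable g) {y : ℝ}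
    (hy : 0 < y) : Integrable fun ξ => (poissonMul y ξ : ℂ) * g ξ := by
  refine (hg.integrable y hy).mono' ((Complex.continuous_ofReal.comp
    (continuous_poissonMul y)).aestronglyMeasurable.mul hg.1) (Eventually.of_forall fun ξ => ?_)
  rw [norm_mul, Complex.norm_real, Real.norm_of_nonneg (poissonMul_pos y ξ).le]

/-- The slice energy of a harmonic extension, by Plancherel. -/
theorem sliceEnergy_harmonicExt {g : V → ℂ} (hg : PoissonIntegrable g) {y : ℝ} (hy : 0 < y)
    (hg2 : MemLp (fun ξ => (poissonMul y ξ : ℂ) * g ξ) 2) :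
    sliceEnergy (harmonicExt g) y = ∫⁻ ξ, ‖(poissonMul y ξ : ℂ) * g ξ‖ₑ ^ 2 := by
  rw [sliceEnergy]
  simp only [harmonicExt_eq_fourierInv]
  exact lintegral_fourierInv_sq (hg.integrable_mul hy) hg2

theorem enorm_sub_sq_le (a b c : ℂ) : ‖a - b‖ₑ ^ 2 ≤ 2 * ‖a - c‖ₑ ^ 2 + 2 * ‖b - c‖ₑ ^ 2 := by
  simp only [enorm_sq_eq_ofReal]
  rw [← ENNReal.ofReal_ofNat 2, ← ENNReal.ofReal_mul (by positivity),
    ← ENNReal.ofReal_mul (by positivity), ← ENNReal.ofReal_add (by positivity) (by positivity)]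
  refine ENNReal.ofReal_le_ofReal ?_
  have h1 : ‖a - b‖ ≤ ‖a - c‖ + ‖b - c‖ := by
    rw [norm_sub_rev b]
    exact norm_sub_le_norm_sub_add_norm_sub _ _ _
  nlinarith [sq_nonneg (‖a - c‖ - ‖b - c‖), norm_nonneg (a - b)]

theorem Lp.fourierInv_sub (f g : Lp ℂ 2 (volume : Measure V)) : 𝓕⁻ (f - g) = 𝓕⁻ f - 𝓕⁻ g :=
  map_sub (Lp.fourierTransformₗᵢ V ℂ).symm f g

/-- The energy of a difference is controlled by the distances of the two slices to a third
function. -/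
theorem sliceEnergy_sub_le {f g : WithLp 2 (V × ℝ) → ℂ} {h : V → ℂ} {y : ℝ}
    (hf : AEMeasurable fun x => f (toLp 2 (x, y))) (hh : AEMeasurable h) :
    sliceEnergy (fun p => f p - g p) y ≤ 2 * (∫⁻ x, ‖f (toLp 2 (x, y)) - h x‖ₑ ^ 2) +
      2 * ∫⁻ x, ‖g (toLp 2 (x, y)) - h x‖ₑ ^ 2 := by
  have hm : AEMeasurable (fun x => 2 * ‖f (toLp 2 (x, y)) - h x‖ₑ ^ 2) :=
    ((hf.sub hh).enorm.pow_const 2).const_mul 2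
  rw [← lintegral_const_mul' _ _ (by simp), ← lintegral_const_mul' _ _ (by simp),
    ← lintegral_add_left' hm]
  exact lintegral_mono fun x => enorm_sub_sq_le _ _ _

/-- The harmonic extension of the Fourier transform of a square integrable function attains this
function as its boundary value in `L²`. -/
theorem tendsto_harmonicExt_fourier {h : V → ℂ} (hh : MemLp h 2) {y : ℕ → ℝ} (hy : ∀ k, 0 < y k)
    (hy0 : Tendsto y atTop (𝓝 0)) :
    Tendsto (fun k => ∫⁻ x, ‖harmonicExt (𝓕 (hh.toLp h) : Lp ℂ 2 (volume : Measure V))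
      (toLp 2 (x, y k)) - h x‖ₑ ^ 2) atTop (𝓝 0) := by
  set F : Lp ℂ 2 (volume : Measure V) := 𝓕 (hh.toLp h) with hF
  have hF2 : MemLp F 2 := Lp.memLp F
  have hFP := PoissonIntegrable.of_memLp hF2
  have e1 : ∀ k, ∫⁻ x, ‖harmonicExt F (toLp 2 (x, y k)) - h x‖ₑ ^ 2 =
      ∫⁻ ξ, ‖(poissonMul (y k) ξ : ℂ) * F ξ - F ξ‖ₑ ^ 2 := by
    intro k
    simp only [harmonicExt_eq_fourierInv]
    have h1 := hFP.integrable_mul (hy k)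
    have h2 := memLp_poissonMul_mul hF2 (hy k).le
    have e2 : 𝓕⁻ (h2.toLp _ - F) = (memLp_fourierInv h1 h2).toLp _ - hh.toLp h := by
      rw [toLp_fourierInv h1 h2, Lp.fourierInv_sub]
      exact congrArg _ (FourierTransform.fourierInv_fourier_eq _)
    have e3 := congrArg (fun G : Lp ℂ 2 (volume : Measure V) => ‖G‖ₑ ^ 2) e2
    have e4 : ‖𝓕⁻ (h2.toLp _ - F)‖ₑ = ‖h2.toLp _ - F‖ₑ := by
      rw [← ofReal_norm, ← ofReal_norm, Lp.norm_fourierInv_eq]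
    simp only [e4] at e3
    rw [Lp.enorm_def, Lp.enorm_def, eLpNorm_two_sq, eLpNorm_two_sq] at e3
    rw [lintegral_congr_ae (g := fun x => ‖((memLp_fourierInv h1 h2).toLp _ - hh.toLp h :
      Lp ℂ 2 (volume : Measure V)) x‖ₑ ^ 2), ← e3]
    · refine lintegral_congr_ae ?_
      filter_upwards [Lp.coeFn_sub (h2.toLp _) F, h2.coeFn_toLp] with x hx hx'
      rw [hx, Pi.sub_apply, hx']
    · filter_upwards [Lp.coeFn_sub ((memLp_fourierInv h1 h2).toLp _) (hh.toLp h),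
        (memLp_fourierInv h1 h2).coeFn_toLp, hh.coeFn_toLp] with x hx hx' hx''
      rw [hx, Pi.sub_apply, hx', hx'']
  simp only [e1]
  have hz : ∫⁻ ξ : V, (0 : ENNReal) = 0 := by simp
  rw [← hz]
  refine tendsto_lintegral_of_dominated_convergence' (fun ξ => ‖F ξ‖ₑ ^ 2) (fun k => ?_)
    (fun k => Eventually.of_forall fun ξ => ?_) ?_ (Eventually.of_forall fun ξ => ?_)
  · exact ((memLp_poissonMul_mul hF2 (hy k).le).1.sub hF2.1).enorm.pow_const 2
  · have h1 := poissonMul_pos (y k) ξ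
    have h2 := poissonMul_le_one (hy k).le ξ
    simp only [enorm_sq_eq_ofReal]
    refine ENNReal.ofReal_le_ofReal (pow_le_pow_left₀ (norm_nonneg _) ?_ 2)
    rw [← sub_one_mul, norm_mul]
    refine mul_le_of_le_one_left (norm_nonneg _) ?_
    rw [← Complex.ofReal_one, ← Complex.ofReal_sub, Complex.norm_real, Real.norm_eq_abs, abs_le]
    constructor <;> linarith
  · exact ((memLp_two_iff hF2.1).1 hF2).ne
  · have h1 : Tendsto (fun k => (poissonMul (y k) ξ : ℂ) * F ξ - F ξ) atTop (𝓝 0) := by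
      have h2 : Tendsto (fun k => poissonMul (y k) ξ) atTop (𝓝 1) := by
        have : Continuous fun y : ℝ => poissonMul y ξ := by unfold poissonMul; fun_prop
        simpa [poissonMul, Function.comp_def] using (this.tendsto 0).comp hy0
      have h3 := ((((Complex.continuous_ofReal.tendsto 1).comp h2).mul_const (F ξ)).sub_const (F ξ))
      simpa [Function.comp_def] using h3
    have h4 := ((ENNReal.continuous_pow 2).tendsto _).comp ((continuous_enorm.tendsto _).comp h1)
    simpa [Function.comp_def] using h4

/-- Above each height, a harmonic function with square integrable slices is the harmonic extension
of the Fourier transform of the slice at this height. -/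
theorem eq_harmonicExt_slice {f : WithLp 2 (V × ℝ) → ℂ}
    (hf : InnerProductSpace.HarmonicOnNhd f (upperHalf V))
    (hint : ∀ δ : ℝ, 0 < δ → ∫⁻ y in Ioi δ, sliceEnergy f y < ⊤) {δ : ℝ} (hδ : 0 < δ)
    (hh : MemLp (fun x => f (toLp 2 (x, δ))) 2) (x : V) {y : ℝ} (hy : 0 < y) :
    f (toLp 2 (x, δ + y)) =
      harmonicExt (𝓕 (hh.toLp _) : Lp ℂ 2 (volume : Measure V)) (toLp 2 (x, y)) := by
  set F : Lp ℂ 2 (volume : Measure V) := 𝓕 (hh.toLp _) with hF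
  have hF2 : MemLp F 2 := Lp.memLp F
  have hFP := PoissonIntegrable.of_memLp hF2
  have eadd : ∀ (x : V) (y : ℝ), toLp 2 (x, y) + toLp 2 ((0 : V), δ) = toLp 2 (x, δ + y) := by
    intro x y
    rw [← toLp_add, Prod.mk_add_mk, add_zero, add_comm]
  -- the difference of the translate of `f` and the harmonic extension vanishes, as both have the
  -- boundary value `f (·, δ)` in `L²`
  set f1 : WithLp 2 (V × ℝ) → ℂ := fun p => f (p + toLp 2 ((0 : V), δ)) with hf1
  have hf1h : InnerProductSpace.HarmonicOnNhd f1 (upperHalf V) := by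
    intro p hp
    refine harmonicAt_comp_add_right _ (hf _ ?_)
    have hp : 0 < p.snd := hp
    change 0 < p.snd + δ
    linarith
  have hgh := hFP.harmonicOnNhd
  have hD := hf1h.sub hgh
  set N := sliceEnergy f δ with hN
  have hNfin : N < ⊤ := sliceEnergy_lt_top hf hint hδ
  have hf1N : ∀ y, 0 < y → sliceEnergy f1 y ≤ N := by
    intro y hy
    have : sliceEnergy f1 y = sliceEnergy f (δ + y) := by
      simp only [sliceEnergy, hf1, eadd]
    rw [this]
    exact sliceEnergy_anti_of_lintegral hf hint hδ (by linarith)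
  have hgN : ∀ y, 0 < y → sliceEnergy (harmonicExt F) y ≤ ∫⁻ ξ, ‖F ξ‖ₑ ^ 2 := by
    intro y hy
    rw [sliceEnergy_harmonicExt hFP hy (memLp_poissonMul_mul hF2 hy.le)]
    refine lintegral_mono fun ξ => ?_
    simp only [enorm_sq_eq_ofReal]
    refine ENNReal.ofReal_le_ofReal (pow_le_pow_left₀ (norm_nonneg _) ?_ 2)
    rw [norm_mul, Complex.norm_real, Real.norm_of_nonneg (poissonMul_pos y ξ).le]
    exact mul_le_of_le_one_left (norm_nonneg _) (poissonMul_le_one hy.le ξ)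
  have hsl : ∀ y, 0 < y → AEMeasurable fun x => f1 (toLp 2 (x, y)) := fun y hy =>
    (continuous_slice hf1h.continuousOn hy).measurable.aemeasurable
  have key := eq_zero_of_sliceEnergy_tendsto_zero hD
    (C := 2 * N + 2 * ∫⁻ ξ, ‖F ξ‖ₑ ^ 2)
    (ENNReal.add_ne_top.2 ⟨ENNReal.mul_ne_top (by simp) hNfin.ne,
      ENNReal.mul_ne_top (by simp) ((memLp_two_iff hF2.1).1 hF2).ne⟩) ?_ ?_
  · have := key (toLp 2 (x, y)) hy
    rw [Pi.sub_apply, sub_eq_zero] at this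
    rw [← this, hf1]
    simp only [eadd]
  · intro y hy
    refine (sliceEnergy_sub_le (h := fun _ => 0) (hsl y hy) aemeasurable_const).trans ?_
    simp only [sub_zero]
    exact add_le_add (mul_le_mul_right (hf1N y hy) _) (mul_le_mul_right (hgN y hy) _)
  · have hy0 := tendsto_one_div_add_atTop_nhds_zero_nat (𝕜 := ℝ)
    have hyp : ∀ k : ℕ, 0 < 1 / ((k : ℝ) + 1) := fun k => by positivity
    have t1 : Tendsto (fun k : ℕ =>
        ∫⁻ x, ‖f1 (toLp 2 (x, 1 / ((k : ℝ) + 1))) - f (toLp 2 (x, δ))‖ₑ ^ 2) atTop (𝓝 0) := by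
      refine tendsto_lintegral_sub_sq (f := fun k x => f1 (toLp 2 (x, 1 / ((k : ℝ) + 1))))
        (fun k => (hsl _ (hyp k)).aestronglyMeasurable) hh.1 (fun x => ?_)
        (fun k => hf1N _ (hyp k)) hNfin
      simp only [hf1, eadd]
      have hc : ContinuousAt f (toLp 2 (x, δ)) :=
        hf.continuousOn.continuousAt (isOpen_upperHalf.mem_nhds hδ)
      have hq : Continuous fun y : ℝ => toLp 2 (x, δ + y) := by fun_prop
      have := (hq.tendsto 0).comp hy0
      rw [add_zero] at this
      exact hc.tendsto.comp this
    have t2 := tendsto_harmonicExt_fourier hh hyp hy0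
    have t3 := (ENNReal.Tendsto.const_mul (a := 2) t1 (by simp)).add
      (ENNReal.Tendsto.const_mul (a := 2) t2 (by simp))
    simp only [mul_zero, add_zero] at t3
    refine tendsto_of_tendsto_of_tendsto_of_le_of_le tendsto_const_nhds t3 (fun k => zero_le)
      fun k => ?_
    exact sliceEnergy_sub_le (hsl _ (hyp k)) hh.1.aemeasurable

theorem poissonMul_neg_mul {V : Type*} [NormedAddCommGroup V] (y : ℝ) (ξ : V) :
    poissonMul (-y) ξ * poissonMul y ξ = 1 := by
  rw [← poissonMul_add]
  simp [poissonMul]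

/-- **Fourier representation.** A harmonic function on the half-space whose slice energy is
integrable away from the boundary is a superposition of the decaying exponential harmonics. -/
theorem exists_eq_harmonicExt {f : WithLp 2 (V × ℝ) → ℂ}
    (hf : InnerProductSpace.HarmonicOnNhd f (upperHalf V))
    (hint : ∀ δ : ℝ, 0 < δ → ∫⁻ y in Ioi δ, sliceEnergy f y < ⊤) :
    ∃ A : V → ℂ, PoissonIntegrable A ∧
      (∀ y : ℝ, 0 < y → MemLp (fun ξ => (poissonMul y ξ : ℂ) * A ξ) 2) ∧
      ∀ p ∈ upperHalf V, f p = harmonicExt A p := by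
  have hh : ∀ δ : ℝ, 0 < δ → MemLp (fun x => f (toLp 2 (x, δ))) 2 := fun δ hδ =>
    (memLp_two_iff (continuous_slice hf.continuousOn hδ).aestronglyMeasurable).2
      (sliceEnergy_lt_top hf hint hδ)
  -- the Fourier transform of the slice at height `δ`
  let F : ∀ δ : ℝ, 0 < δ → Lp ℂ 2 (volume : Measure V) := fun δ hδ => 𝓕 ((hh δ hδ).toLp _)
  have hF2 : ∀ (δ : ℝ) hδ, MemLp (F δ hδ) 2 := fun δ hδ => Lp.memLp _
  have hFP := fun (δ : ℝ) hδ => PoissonIntegrable.of_memLp (hF2 δ hδ)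
  have hslice : ∀ (δ : ℝ) hδ x (y : ℝ), 0 < y →
      f (toLp 2 (x, δ + y)) = harmonicExt (F δ hδ) (toLp 2 (x, y)) :=
    fun (δ : ℝ) hδ x y hy => eq_harmonicExt_slice hf hint hδ (hh δ hδ) x hy
  -- the transforms at different heights are related by the Poisson multiplier
  have hFF : ∀ (δ : ℝ) hδ (δ' : ℝ) hδ', δ < δ' →
      (F δ' hδ' : V → ℂ) =ᵐ[volume] fun ξ => (poissonMul (δ' - δ) ξ : ℂ) * F δ hδ ξ := by
    intro δ hδ δ' hδ' hlt
    have h1 := (hFP δ hδ).integrable_mul (sub_pos.2 hlt)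
    have h2 := memLp_poissonMul_mul (hF2 δ hδ) (sub_pos.2 hlt).le
    have e1 : (hh δ' hδ').toLp _ = (memLp_fourierInv h1 h2).toLp _ := by
      congr 1
      ext x
      rw [← harmonicExt_eq_fourierInv, ← hslice δ hδ x _ (sub_pos.2 hlt)]
      congr 3
      ring
    have e2 : F δ' hδ' = h2.toLp _ := by
      change 𝓕 ((hh δ' hδ').toLp _) = _
      rw [e1, toLp_fourierInv h1 h2, FourierTransform.fourier_fourierInv_eq]
    rw [e2]
    exact h2.coeFn_toLp
  -- the symbol of `f`, from the slice at height `1`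
  set A : V → ℂ := fun ξ => (poissonMul (-1) ξ : ℂ) * F 1 one_pos ξ with hA
  have hAF : ∀ y (hy : 0 < y), (fun ξ => (poissonMul y ξ : ℂ) * A ξ) =ᵐ[volume] F y hy := by
    intro y hy
    rcases lt_trichotomy y 1 with h | rfl | h
    · filter_upwards [hFF y hy 1 one_pos h] with ξ hξ
      rw [hA]
      simp only
      rw [hξ, ← mul_assoc, ← mul_assoc, ← Complex.ofReal_mul, ← Complex.ofReal_mul,
        ← poissonMul_add, ← poissonMul_add, show y + -1 + (1 - y) = 0 by ring]
      simp [poissonMul]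
    · refine Eventually.of_forall fun ξ => ?_
      simp only [hA]
      rw [← mul_assoc, ← Complex.ofReal_mul, mul_comm (poissonMul 1 ξ), poissonMul_neg_mul]
      simp
    · filter_upwards [hFF 1 one_pos y hy h] with ξ hξ
      rw [hξ, hA]
      simp only
      rw [← mul_assoc, ← Complex.ofReal_mul, ← poissonMul_add, ← sub_eq_add_neg]
  have hAm : AEStronglyMeasurable A :=
    (Complex.continuous_ofReal.comp (continuous_poissonMul (-1))).aestronglyMeasurable.mul
      (hF2 1 one_pos).1
  have hAP : PoissonIntegrable A := by
    refine ⟨hAm, fun y hy => ?_⟩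
    refine ((hFP (y / 2) (half_pos hy)).integrable (y / 2) (half_pos hy)).congr ?_
    filter_upwards [hAF (y / 2) (half_pos hy)] with ξ hξ
    rw [← hξ, norm_mul, Complex.norm_real, Real.norm_of_nonneg (poissonMul_pos _ ξ).le,
      ← mul_assoc, ← poissonMul_add, add_halves]
  refine ⟨A, hAP, fun y hy => (memLp_congr_ae (hAF y hy)).2 (hF2 y hy), fun p hp => ?_⟩
  have hp : 0 < p.snd := hp
  have h2 : 0 < p.snd / 2 := half_pos hp
  have e := hslice (p.snd / 2) h2 p.fst (p.snd / 2) h2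
  rw [add_halves] at e
  have e3 : p = toLp 2 (p.fst, p.snd) := rfl
  rw [e3]
  refine e.trans ?_
  rw [harmonicExt_eq_fourierInv, harmonicExt_eq_fourierInv, Real.fourierInv_eq, Real.fourierInv_eq]
  refine integral_congr_ae ?_
  filter_upwards [hAF (p.snd / 2) h2] with ξ hξ
  rw [← hξ, ← mul_assoc, ← Complex.ofReal_mul, ← poissonMul_add, add_halves]

end PaleyWiener

/-! ### The reproducing kernel of a space of harmonic functions on the half-space -/

section HarmonicKernel

/-- Measures on `(0, ∞)` that dominate a multiple of the Lebesgue measure away from `0`. -/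
structure DominatesLebesgue (ν : Measure ℝ) : Prop where
  measure_Iic : ν (Iic 0) = 0
  le : ∀ δ : ℝ, 0 < δ → ∃ c : ℝ, 0 < c ∧ ENNReal.ofReal c • volume.restrict (Ioi δ) ≤ ν

theorem DominatesLebesgue.restrict_eq {ν : Measure ℝ} (hν : DominatesLebesgue ν) :
    ν.restrict (Ioi 0) = ν := by
  refine Measure.restrict_eq_self_of_ae_mem ?_
  rw [ae_iff]
  convert hν.measure_Iic using 2
  ext; simp

theorem DominatesLebesgue.ae_pos {ν : Measure ℝ} (hν : DominatesLebesgue ν) :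
    ∀ᵐ y ∂ν, 0 < y := by
  rw [ae_iff]
  convert hν.measure_Iic using 2
  ext; simp

theorem DominatesLebesgue.lintegral_lt_top {ν : Measure ℝ} (hν : DominatesLebesgue ν)
    {N : ℝ → ENNReal} (hN : ∫⁻ y, N y ∂ν < ⊤) {δ : ℝ} (hδ : 0 < δ) :
    ∫⁻ y in Ioi δ, N y < ⊤ := by
  obtain ⟨c, hc, h⟩ := hν.le δ hδ
  have h1 := (lintegral_mono' h (le_refl N)).trans_lt hN
  rw [lintegral_smul_measure, smul_eq_mul] at h1
  exact ENNReal.lt_top_of_mul_ne_top_right h1.ne (by simpa using hc)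

variable {V : Type*} [NormedAddCommGroup V]

/-- The Laplace transform of `ν` at `4π ‖ξ‖`, possibly infinite: the energy of the elementary
harmonic function of frequency `ξ`. -/
noncomputable def poissonLaplace (ν : Measure ℝ) (ξ : V) : ENNReal :=
  ∫⁻ y, ENNReal.ofReal (poissonMul (2 * y) ξ) ∂ν

theorem continuous_uncurry_poissonMul :
    Continuous fun q : V × ℝ => poissonMul (2 * q.2) q.1 := by
  unfold poissonMul; fun_prop

theorem measurable_poissonLaplace [MeasurableSpace V] [OpensMeasurableSpace V]
    [SecondCountableTopology V] (ν : Measure ℝ) [SFinite ν] :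
    Measurable (poissonLaplace ν : V → ENNReal) :=
  (ENNReal.measurable_ofReal.comp
    (continuous_uncurry_poissonMul (V := V)).measurable).lintegral_prod_right'

theorem DominatesLebesgue.exists_le_poissonLaplace {ν : Measure ℝ} (hν : DominatesLebesgue ν)
    {δ : ℝ} (hδ : 0 < δ) :
    ∃ C : ℝ, 0 < C ∧ ∀ ξ : V, ENNReal.ofReal (C * poissonMul (4 * δ) ξ) ≤ poissonLaplace ν ξ := by
  obtain ⟨c, hc, h⟩ := hν.le δ hδ
  refine ⟨c * δ, by positivity, fun ξ => ?_⟩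
  refine le_trans ?_ (lintegral_mono' h (le_refl _))
  rw [lintegral_smul_measure, smul_eq_mul, mul_assoc, ENNReal.ofReal_mul hc.le]
  gcongr
  calc ENNReal.ofReal (δ * poissonMul (4 * δ) ξ)
      = ∫⁻ y in Ioc δ (2 * δ), ENNReal.ofReal (poissonMul (4 * δ) ξ) := by
        rw [setLIntegral_const, Real.volume_Ioc, mul_comm δ, ENNReal.ofReal_mul
          (poissonMul_pos _ _).le]
        ring_nf
    _ ≤ ∫⁻ y in Ioc δ (2 * δ), ENNReal.ofReal (poissonMul (2 * y) ξ) := by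
        refine setLIntegral_mono' measurableSet_Ioc fun y hy => ENNReal.ofReal_le_ofReal ?_
        exact poissonMul_anti ξ (by linarith [hy.2])
    _ ≤ _ := lintegral_mono_set Ioc_subset_Ioi_self

theorem DominatesLebesgue.poissonLaplace_ne_zero {ν : Measure ℝ} (hν : DominatesLebesgue ν)
    (ξ : V) : poissonLaplace ν ξ ≠ 0 := by
  obtain ⟨C, hC, h⟩ := hν.exists_le_poissonLaplace (V := V) one_pos
  refine ((ENNReal.ofReal_pos.2 ?_).trans_le (h ξ)).ne'
  exact mul_pos hC (poissonMul_pos _ _)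

/-- The inverse of the Laplace transform grows slower than every `exp (2π b ‖ξ‖)`. With the
convention `⊤.toReal⁻¹ = 0`, frequencies of infinite energy do not contribute. -/
theorem DominatesLebesgue.exists_poissonMul_mul_inv_le {ν : Measure ℝ} (hν : DominatesLebesgue ν)
    {b : ℝ} (hb : 0 < b) :
    ∃ C : ℝ, 0 < C ∧ ∀ ξ : V, poissonMul b ξ * (poissonLaplace ν ξ).toReal⁻¹ ≤ C := by
  obtain ⟨C, hC, h⟩ := hν.exists_le_poissonLaplace (V := V) (show 0 < b / 4 by positivity)
  refine ⟨C⁻¹, inv_pos.2 hC, fun ξ => ?_⟩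
  have hp := poissonMul_pos b ξ
  have h1 := h ξ
  rw [show 4 * (b / 4) = b by ring] at h1
  by_cases ht : poissonLaplace ν ξ = ⊤
  · simp [ht, hC.le]
  · have h2 := (ENNReal.ofReal_le_iff_le_toReal ht).1 h1
    have h3 : 0 < (poissonLaplace ν ξ).toReal := lt_of_lt_of_le (by positivity) h2
    rw [← div_eq_mul_inv, div_le_iff₀ h3, inv_mul_eq_div, le_div_iff₀ hC, mul_comm]
    exact h2

variable [InnerProductSpace ℝ V]

/-- The Fourier symbol of the reproducing kernel, at the point `p`, of the harmonic functions with
spectrum in `S`. -/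
noncomputable def kernelSymbol (ν : Measure ℝ) (S : Set V) (p : WithLp 2 (V × ℝ)) : V → ℂ :=
  S.indicator fun ξ => conj (Complex.exp (phaseCLM (fstL 2 ℝ V ℝ) (sndL 2 ℝ V ℝ) ξ p)) *
    ((poissonLaplace ν ξ).toReal⁻¹ : ℝ)

theorem norm_kernelSymbol_le (ν : Measure ℝ) (S : Set V) (p : WithLp 2 (V × ℝ)) (ξ : V) :
    ‖kernelSymbol ν S p ξ‖ ≤ poissonMul p.snd ξ * (poissonLaplace ν ξ).toReal⁻¹ := by
  refine (norm_indicator_le_norm_self _ _).trans_eq ?_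
  rw [norm_mul, RCLike.norm_conj, norm_cexp_phaseCLM, Complex.norm_real,
    Real.norm_of_nonneg (inv_nonneg.2 ENNReal.toReal_nonneg)]
  rfl

theorem DominatesLebesgue.exists_norm_kernelSymbol_le {ν : Measure ℝ} (hν : DominatesLebesgue ν)
    (S : Set V) {p : WithLp 2 (V × ℝ)} (hp : p ∈ upperHalf V) :
    ∃ C : ℝ, 0 < C ∧ ∀ ξ : V, ‖kernelSymbol ν S p ξ‖ ≤ C * poissonMul (p.snd / 2) ξ := by
  obtain ⟨C, hC, h⟩ := hν.exists_poissonMul_mul_inv_le (V := V) (half_pos hp)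
  refine ⟨C, hC, fun ξ => ?_⟩
  refine (norm_kernelSymbol_le ν S p ξ).trans ?_
  conv_lhs => rw [← add_halves p.snd, poissonMul_add, mul_comm (poissonMul _ _), mul_assoc]
  rw [mul_comm C]
  gcongr
  · exact (poissonMul_pos _ _).le
  · exact h ξ

theorem phaseCLM_neg {E : Type*} [NormedAddCommGroup E] [NormedSpace ℝ E] (a : E →L[ℝ] V)
    (b : E →L[ℝ] ℝ) (ξ : V) (p : E) : phaseCLM a b (-ξ) p = conj (phaseCLM a b ξ p) := by
  simp [phaseCLM_apply, Complex.conj_ofNat]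

variable [FiniteDimensional ℝ V] [MeasurableSpace V] [BorelSpace V]

theorem aestronglyMeasurable_kernelSymbol (ν : Measure ℝ) [SFinite ν] {S : Set V}
    (hS : MeasurableSet S) (p : WithLp 2 (V × ℝ)) :
    AEStronglyMeasurable (kernelSymbol ν S p) := by
  have h : AEStronglyMeasurable (fun ξ : V =>
      conj (Complex.exp (phaseCLM (fstL 2 ℝ V ℝ) (sndL 2 ℝ V ℝ) ξ p))) :=
    (Complex.continuous_conj.comp (continuous_cexp_phaseCLM _ _ p)).aestronglyMeasurable
  exact (h.mul (Complex.measurable_ofReal.comp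
    (measurable_poissonLaplace ν).ennreal_toReal.inv).aestronglyMeasurable).indicator hS

theorem memLp_kernelSymbol {ν : Measure ℝ} [SFinite ν] (hν : DominatesLebesgue ν)
    {S : Set V} (hS : MeasurableSet S) {p : WithLp 2 (V × ℝ)} (hp : p ∈ upperHalf V) :
    MemLp (kernelSymbol ν S p) 2 := by
  obtain ⟨C, hC, h⟩ := hν.exists_norm_kernelSymbol_le S hp
  refine ((memLp_poissonMul (half_pos hp)).const_mul C).mono
    (aestronglyMeasurable_kernelSymbol ν hS p) (Eventually.of_forall fun ξ => (h ξ).trans ?_)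
  exact le_abs_self _

/-- The reproducing kernel, at the point `p`, of the harmonic functions on the half-space that are
square integrable with respect to `dx dν(y)` and whose Fourier representation is supported in `S`.
For `S = univ` these are all the square integrable harmonic functions; on `ℝ × ℝ` and for
`S = Ioi 0` they are the holomorphic ones. -/
noncomputable def harmonicKernel (ν : Measure ℝ) (S : Set V) (p : WithLp 2 (V × ℝ)) :
    WithLp 2 (V × ℝ) → ℂ :=
  harmonicExt (kernelSymbol ν S p)

theorem harmonicOnNhd_harmonicKernel {ν : Measure ℝ} [SFinite ν] (hν : DominatesLebesgue ν)
    {S : Set V} (hS : MeasurableSet S) {p : WithLp 2 (V × ℝ)} (hp : p ∈ upperHalf V) :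
    InnerProductSpace.HarmonicOnNhd (harmonicKernel ν S p) (upperHalf V) :=
  (PoissonIntegrable.of_memLp (memLp_kernelSymbol hν hS hp)).harmonicOnNhd

/-- The kernel of all the harmonic functions is real-valued, since the Laplace transform
depends on `‖ξ‖` only. -/
theorem conj_harmonicKernel (ν : Measure ℝ) (p q : WithLp 2 (V × ℝ)) :
    conj (harmonicKernel ν univ p q) = harmonicKernel ν univ p q := by
  rw [harmonicKernel, harmonicExt, ← integral_conj, ← integral_neg_eq_self]
  refine integral_congr_ae (Eventually.of_forall fun ξ => ?_)
  have : poissonLaplace ν (-ξ) = poissonLaplace ν ξ := by simp [poissonLaplace, poissonMul]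
  simp [kernelSymbol, phaseCLM_neg, ← Complex.exp_conj, this]

theorem harmonicKernel_self (ν : Measure ℝ) {S : Set V} (hS : MeasurableSet S)
    (p : WithLp 2 (V × ℝ)) :
    harmonicKernel ν S p p =
      (∫ ξ in S, poissonMul (2 * p.snd) ξ * (poissonLaplace ν ξ).toReal⁻¹ : ℝ) := by
  rw [harmonicKernel, harmonicExt, ← integral_complex_ofReal, ← integral_indicator hS]
  refine integral_congr_ae (Eventually.of_forall fun ξ => ?_)
  simp only [kernelSymbol]
  rw [← indicator_mul_right S fun ξ =>
    Complex.exp (phaseCLM (fstL 2 ℝ V ℝ) (sndL 2 ℝ V ℝ) ξ p)]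
  refine congrFun (congrArg _ (funext fun ξ => ?_)) ξ
  rw [← mul_assoc, Complex.mul_conj, Complex.normSq_eq_norm_sq, norm_cexp_phaseCLM,
    ← Complex.ofReal_mul, two_mul, poissonMul_add, pow_two]
  rfl

/-- The energy of a harmonic extension is the weighted energy of its symbol. -/
theorem lintegral_sliceEnergy_harmonicExt {ν : Measure ℝ} [SFinite ν] (hν : DominatesLebesgue ν)
    {g : V → ℂ} (hg : PoissonIntegrable g)
    (hg2 : ∀ y : ℝ, 0 < y → MemLp (fun ξ => (poissonMul y ξ : ℂ) * g ξ) 2) :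
    ∫⁻ y, sliceEnergy (harmonicExt g) y ∂ν = ∫⁻ ξ, ‖g ξ‖ₑ ^ 2 * poissonLaplace ν ξ := by
  have h1 : ∫⁻ y, sliceEnergy (harmonicExt g) y ∂ν =
      ∫⁻ y, (∫⁻ ξ, ‖g ξ‖ₑ ^ 2 * ENNReal.ofReal (poissonMul (2 * y) ξ)) ∂ν := by
    refine lintegral_congr_ae ?_
    filter_upwards [hν.ae_pos] with y hy
    rw [sliceEnergy_harmonicExt hg hy (hg2 y hy)]
    refine lintegral_congr fun ξ => ?_
    have e : ‖(poissonMul y ξ : ℂ)‖ₑ = ENNReal.ofReal (poissonMul y ξ) := by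
      rw [← ofReal_norm, Complex.norm_real, Real.norm_of_nonneg (poissonMul_pos y ξ).le]
    rw [enorm_mul, mul_pow, mul_comm, two_mul, poissonMul_add,
      ENNReal.ofReal_mul (poissonMul_pos y ξ).le, ← pow_two, e]
  have hm : AEMeasurable (fun q : V × ℝ => ‖g q.1‖ₑ ^ 2 *
      ENNReal.ofReal (poissonMul (2 * q.2) q.1)) (volume.prod ν) :=
    (hg.1.enorm.pow_const 2).comp_fst.mul (ENNReal.measurable_ofReal.comp
      (continuous_uncurry_poissonMul (V := V)).measurable).aemeasurable
  rw [h1, ← lintegral_prod_symm _ hm, lintegral_prod _ hm]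
  refine lintegral_congr_ae (Eventually.of_forall fun ξ => ?_)
  simp only
  rw [lintegral_const_mul, poissonLaplace]
  exact ENNReal.measurable_ofReal.comp
    (continuous_uncurry_poissonMul.comp (Continuous.prodMk_right ξ)).measurable

theorem lintegral_prod_eq_sliceEnergy {ν : Measure ℝ} [SFinite ν] (hν : DominatesLebesgue ν)
    {f : WithLp 2 (V × ℝ) → ℂ} (hf : ContinuousOn f (upperHalf V)) :
    ∫⁻ q : V × ℝ, ‖f (toLp 2 q)‖ₑ ^ 2 ∂(volume.prod ν) = ∫⁻ y, sliceEnergy f y ∂ν := by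
  have h := (aestronglyMeasurable_comp_toLp hf ν).enorm.pow_const 2
  rw [hν.restrict_eq] at h
  rw [lintegral_prod_symm _ h]
  rfl

theorem memLp_prod_iff {ν : Measure ℝ} [SFinite ν] (hν : DominatesLebesgue ν)
    {f : WithLp 2 (V × ℝ) → ℂ} (hf : ContinuousOn f (upperHalf V)) :
    MemLp (fun q : V × ℝ => f (toLp 2 q)) 2 (volume.prod ν) ↔ ∫⁻ y, sliceEnergy f y ∂ν < ⊤ := by
  have h := aestronglyMeasurable_comp_toLp hf ν
  rw [hν.restrict_eq] at h
  rw [memLp_two_iff h, lintegral_prod_eq_sliceEnergy hν hf]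

theorem lintegral_kernelSymbol_lt_top {ν : Measure ℝ} (hν : DominatesLebesgue ν)
    (S : Set V) {p : WithLp 2 (V × ℝ)} (hp : p ∈ upperHalf V) :
    ∫⁻ ξ, ‖kernelSymbol ν S p ξ‖ₑ ^ 2 * poissonLaplace ν ξ < ⊤ := by
  obtain ⟨C, hC, h⟩ := hν.exists_norm_kernelSymbol_le S hp
  have hI : Integrable fun ξ : V => C * poissonMul (p.snd + p.snd / 2) ξ :=
    (integrable_poissonMul (by have : 0 < p.snd := hp; positivity)).const_mul C
  refine lt_of_le_of_lt (lintegral_mono fun ξ => ?_) hI.lintegral_lt_top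
  by_cases ht : poissonLaplace ν ξ = ⊤
  · have : kernelSymbol ν S p ξ = 0 := by simp [kernelSymbol, ht]
    simp [this]
  · have h0 : 0 < (poissonLaplace ν ξ).toReal :=
      ENNReal.toReal_pos (hν.poissonLaplace_ne_zero ξ) ht
    rw [pow_two, mul_assoc]
    have e : ‖kernelSymbol ν S p ξ‖ₑ * poissonLaplace ν ξ ≤
        ENNReal.ofReal (poissonMul p.snd ξ) := by
      rw [← ofReal_norm (kernelSymbol ν S p ξ)]
      refine (mul_le_mul_left (ENNReal.ofReal_le_ofReal (norm_kernelSymbol_le ν S p ξ)) _).trans_eq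
        ?_
      nth_rewrite 2 [← ENNReal.ofReal_toReal ht]
      rw [← ENNReal.ofReal_mul (mul_nonneg (poissonMul_pos _ _).le (inv_nonneg.2 h0.le)),
        mul_assoc, inv_mul_cancel₀ h0.ne', mul_one]
    refine (mul_le_mul_right e _).trans ?_
    rw [← ofReal_norm (kernelSymbol ν S p ξ), ← ENNReal.ofReal_mul (norm_nonneg _)]
    refine ENNReal.ofReal_le_ofReal ?_
    rw [poissonMul_add, mul_comm (poissonMul p.snd ξ), ← mul_assoc]
    gcongr
    · exact (poissonMul_pos _ _).le
    · exact h ξ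

theorem memLp_harmonicKernel {ν : Measure ℝ} [SFinite ν] (hν : DominatesLebesgue ν)
    {S : Set V} (hS : MeasurableSet S) {p : WithLp 2 (V × ℝ)} (hp : p ∈ upperHalf V) :
    MemLp (fun q : V × ℝ => harmonicKernel ν S p (toLp 2 q)) 2 (volume.prod ν) := by
  have hm := memLp_kernelSymbol hν hS hp
  rw [memLp_prod_iff hν (harmonicOnNhd_harmonicKernel hν hS hp).continuousOn, harmonicKernel,
    lintegral_sliceEnergy_harmonicExt hν (.of_memLp hm)
      fun y hy => memLp_poissonMul_mul hm hy.le]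
  exact lintegral_kernelSymbol_lt_top hν S hp

/-- The reproducing property for functions with spectrum in `S`, by the Fourier representation of
`f` and Parseval on each slice. -/
theorem eq_integral_mul_conj_harmonicKernel {ν : Measure ℝ} [SFinite ν] (hν : DominatesLebesgue ν)
    {S : Set V} (hS : MeasurableSet S) {p : WithLp 2 (V × ℝ)} (hp : p ∈ upperHalf V)
    {f : WithLp 2 (V × ℝ) → ℂ} {A : V → ℂ} (hA : PoissonIntegrable A)
    (hA2 : ∀ y : ℝ, 0 < y → MemLp (fun ξ => (poissonMul y ξ : ℂ) * A ξ) 2)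
    (hAS : ∀ᵐ ξ, ξ ∉ S → A ξ = 0) (hfA : ∀ p ∈ upperHalf V, f p = harmonicExt A p)
    (hf2 : MemLp (fun q : V × ℝ => f (toLp 2 q)) 2 (volume.prod ν)) :
    f p = ∫ q : V × ℝ, f (toLp 2 q) * conj (harmonicKernel ν S p (toLp 2 q)) ∂(volume.prod ν) := by
  have hfc : ContinuousOn f (upperHalf V) := hA.harmonicOnNhd.continuousOn.congr hfA
  have hE := (memLp_prod_iff hν hfc).1 hf2
  set g := kernelSymbol ν S p with hg
  have hgm := memLp_kernelSymbol hν hS hp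
  have hgP : PoissonIntegrable g := .of_memLp hgm
  have hg2 := fun (y : ℝ) (hy : 0 < y) => memLp_poissonMul_mul hgm hy.le
  -- the weighted energy of the symbol is finite, so the symbol vanishes where the weight is
  -- infinite
  have hAE : ∫⁻ ξ, ‖A ξ‖ₑ ^ 2 * poissonLaplace ν ξ < ⊤ := by
    rw [← lintegral_sliceEnergy_harmonicExt hν hA hA2]
    refine lt_of_le_of_lt (le_of_eq (lintegral_congr_ae ?_)) hE
    filter_upwards [hν.ae_pos] with y hy
    rw [sliceEnergy, sliceEnergy]
    exact lintegral_congr fun x => by rw [hfA _ (show toLp 2 (x, y) ∈ upperHalf V from hy)]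
  have hgE := lintegral_kernelSymbol_lt_top hν S hp
  have hA0 : ∀ᵐ ξ, poissonLaplace ν ξ = ⊤ → A ξ = 0 := by
    filter_upwards [ae_lt_top' ((hA.1.enorm.pow_const 2).mul
      (measurable_poissonLaplace ν).aemeasurable) hAE.ne] with ξ hξ ht
    by_contra h0
    simp [ht, h0] at hξ
  have hint : Integrable (fun q : V × ℝ =>
      (poissonMul (2 * q.2) q.1 : ℂ) * (A q.1 * conj (g q.1))) (volume.prod ν) := by
    have hm : AEStronglyMeasurable (fun q : V × ℝ =>
        (poissonMul (2 * q.2) q.1 : ℂ) * (A q.1 * conj (g q.1))) (volume.prod ν) :=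
      (Complex.continuous_ofReal.comp
        (continuous_uncurry_poissonMul (V := V))).aestronglyMeasurable.mul
        ((hA.1.mul (Complex.continuous_conj.comp_aestronglyMeasurable hgP.1)).comp_fst)
    refine ⟨hm, ?_⟩
    rw [hasFiniteIntegral_iff_enorm, lintegral_prod _ hm.enorm]
    have hsum : ∫⁻ ξ, (‖A ξ‖ₑ ^ 2 * poissonLaplace ν ξ + ‖g ξ‖ₑ ^ 2 * poissonLaplace ν ξ) < ⊤ := by
      have hm1 : AEMeasurable fun ξ => ‖A ξ‖ₑ ^ 2 * poissonLaplace ν ξ :=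
        (hA.1.enorm.pow_const 2).mul (measurable_poissonLaplace ν).aemeasurable
      rw [lintegral_add_left' hm1]
      exact ENNReal.add_lt_top.2 ⟨hAE, hgE⟩
    refine lt_of_le_of_lt (lintegral_mono fun ξ => ?_) hsum
    have hmξ : Measurable fun y : ℝ => ENNReal.ofReal (poissonMul (2 * y) ξ) :=
      ENNReal.measurable_ofReal.comp
        (continuous_uncurry_poissonMul.comp (Continuous.prodMk_right ξ)).measurable
    calc ∫⁻ y, ‖(poissonMul (2 * y) ξ : ℂ) * (A ξ * conj (g ξ))‖ₑ ∂ν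
        = poissonLaplace ν ξ * (‖A ξ‖ₑ * ‖g ξ‖ₑ) := by
          rw [poissonLaplace, ← lintegral_mul_const _ hmξ]
          refine lintegral_congr fun y => ?_
          rw [enorm_mul, enorm_mul, RCLike.enorm_conj, ← ofReal_norm,
            Complex.norm_real, Real.norm_of_nonneg (poissonMul_pos _ ξ).le]
      _ ≤ poissonLaplace ν ξ * (‖A ξ‖ₑ ^ 2 + ‖g ξ‖ₑ ^ 2) := by
          gcongr
          rcases le_total ‖A ξ‖ₑ ‖g ξ‖ₑ with h | h
          · exact (mul_le_mul_left h _).trans (by rw [← pow_two]; exact le_add_self)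
          · exact (mul_le_mul_right h _).trans (by rw [← pow_two]; exact le_self_add)
      _ = _ := by ring
  have hprod : Integrable (fun q : V × ℝ => f (toLp 2 q) * conj (harmonicKernel ν S p (toLp 2 q)))
      (volume.prod ν) :=
    hf2.integrable_mul (memLp_harmonicKernel hν hS hp).star
  rw [integral_prod_symm _ hprod]
  calc f p = ∫ ξ, Complex.exp (phaseCLM (fstL 2 ℝ V ℝ) (sndL 2 ℝ V ℝ) ξ p) * A ξ := hfA p hp
    _ = ∫ ξ, ∫ y, (poissonMul (2 * y) ξ : ℂ) * (A ξ * conj (g ξ)) ∂ν := by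
        refine integral_congr_ae ?_
        filter_upwards [hA0, hAS] with ξ hξ hξS
        rw [integral_mul_const, integral_complex_ofReal, integral_eq_lintegral_of_nonneg_ae
          (Eventually.of_forall fun y => (poissonMul_pos _ ξ).le)
          (continuous_uncurry_poissonMul.comp (Continuous.prodMk_right ξ)).aestronglyMeasurable]
        change _ = ((poissonLaplace ν ξ).toReal : ℂ) * _
        by_cases ht : poissonLaplace ν ξ = ⊤
        · simp [hξ ht]
        by_cases hS : ξ ∉ S
        · simp [hξS hS]
        · have h0 : ((poissonLaplace ν ξ).toReal : ℂ) ≠ 0 := by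
            exact_mod_cast (ENNReal.toReal_pos (hν.poissonLaplace_ne_zero ξ) ht).ne'
          rw [hg, kernelSymbol, indicator_of_mem (not_not.1 hS)]
          simp only [map_mul, Complex.conj_conj, Complex.conj_ofReal]
          rw [Complex.ofReal_inv]
          field_simp
    _ = ∫ y, (∫ ξ, (poissonMul (2 * y) ξ : ℂ) * (A ξ * conj (g ξ))) ∂ν :=
        integral_integral_swap hint
    _ = _ := by
        refine integral_congr_ae ?_
        filter_upwards [hν.ae_pos] with y hy
        have := integral_fourierInv_mul_conj (hA.integrable_mul hy) (hA2 y hy)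
          (hgP.integrable_mul hy) (hg2 y hy)
        simp only [harmonicKernel, ← hg]
        have e : ∀ x : V, f (toLp 2 (x, y)) = harmonicExt A (toLp 2 (x, y)) :=
          fun x => hfA _ hy
        simp only [e, harmonicExt_eq_fourierInv]
        rw [this]
        refine integral_congr_ae (Eventually.of_forall fun ξ => ?_)
        simp only [map_mul, Complex.conj_ofReal]
        rw [two_mul, poissonMul_add, Complex.ofReal_mul]
        ring

theorem eq_integral_mul_conj_harmonicKernel_univ {ν : Measure ℝ} [SFinite ν]
    (hν : DominatesLebesgue ν) {p : WithLp 2 (V × ℝ)} (hp : p ∈ upperHalf V)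
    {f : WithLp 2 (V × ℝ) → ℂ} (hf : InnerProductSpace.HarmonicOnNhd f (upperHalf V))
    (hf2 : MemLp (fun q : V × ℝ => f (toLp 2 q)) 2 (volume.prod ν)) :
    f p = ∫ q : V × ℝ, f (toLp 2 q) * conj (harmonicKernel ν univ p (toLp 2 q))
      ∂(volume.prod ν) := by
  obtain ⟨A, hA, hA2, hfA⟩ := exists_eq_harmonicExt hf fun δ hδ =>
    hν.lintegral_lt_top ((memLp_prod_iff hν hf.continuousOn).1 hf2) hδ
  exact eq_integral_mul_conj_harmonicKernel hν .univ hp hA hA2 (by simp) hfA hf2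

end HarmonicKernel

/-! ### Bergman kernels for weights depending on the height -/

section Weight

/-- The measure `ρ(y)^α dy` on `(0, ∞)`. -/
noncomputable def heightMeasure (ρ : ℝ → ℝ) (α : ℝ) : Measure ℝ :=
  (volume.restrict (Ioi 0)).withDensity fun y => ENNReal.ofReal (ρ y ^ α)

instance (ρ : ℝ → ℝ) (α : ℝ) : SFinite (heightMeasure ρ α) := by
  unfold heightMeasure; infer_instance

theorem Suitable.continuousOn {ρ : ℝ → ℝ} (hρ : Suitable ρ) : ContinuousOn ρ (Ioi 0) :=
  hρ.smooth.continuousOn.mono Ioi_subset_Ici_self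

theorem Suitable.aemeasurable {ρ : ℝ → ℝ} (hρ : Suitable ρ) (α : ℝ) :
    AEMeasurable (fun y => ENNReal.ofReal (ρ y ^ α)) (volume.restrict (Ioi 0)) := by
  refine ENNReal.measurable_ofReal.comp_aemeasurable (AEMeasurable.pow_const ?_ α)
  exact hρ.continuousOn.aemeasurable measurableSet_Ioi

theorem Suitable.strictMonoOn {ρ : ℝ → ℝ} (hρ : Suitable ρ) : StrictMonoOn ρ (Ioi 0) := by
  refine strictMonoOn_of_deriv_pos (convex_Ioi 0) hρ.continuousOn fun y hy => ?_
  rw [interior_Ioi] at hy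
  exact hρ.deriv_pos y hy

/-- The weight is increasing, hence bounded below away from `0`. -/
theorem Suitable.dominatesLebesgue {ρ : ℝ → ℝ} (hρ : Suitable ρ) {α : ℝ} (hα : 0 ≤ α) :
    DominatesLebesgue (heightMeasure ρ α) where
  measure_Iic := by
    refine withDensity_absolutelyContinuous _ _ ?_
    rw [Measure.restrict_apply measurableSet_Iic]
    convert measure_empty (μ := volume)
    ext; simp
  le δ hδ := by
    refine ⟨ρ δ ^ α, Real.rpow_pos_of_pos (hρ.pos δ hδ) α, ?_⟩
    rw [Measure.le_iff]
    intro s hs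
    rw [heightMeasure, withDensity_apply _ hs, Measure.restrict_restrict hs, Measure.smul_apply,
      Measure.restrict_apply hs, smul_eq_mul, ← setLIntegral_const]
    calc ∫⁻ _ in s ∩ Ioi δ, ENNReal.ofReal (ρ δ ^ α)
        ≤ ∫⁻ y in s ∩ Ioi δ, ENNReal.ofReal (ρ y ^ α) := by
          refine setLIntegral_mono' (hs.inter measurableSet_Ioi) fun y hy => ?_
          refine ENNReal.ofReal_le_ofReal (Real.rpow_le_rpow (hρ.pos δ hδ).le ?_ hα)
          exact hρ.strictMonoOn.monotoneOn hδ (hδ.trans hy.2) (le_of_lt hy.2)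
      _ ≤ _ := lintegral_mono_set (inter_subset_inter_right _ (Ioi_subset_Ioi hδ.le))

/-- In volume-preserving coordinates whose last entry is the height, the weighted measure is a
product. -/
theorem Suitable.weightedMeasure_eq_map {X E : Type*} [MeasureSpace X]
    [SFinite (volume : Measure X)] [MeasureSpace E] {ρ : ℝ → ℝ} (hρ : Suitable ρ) (α : ℝ)
    (e : X × ℝ ≃ᵐ E) (he : MeasurePreserving e) {Ω : Set E} {wt : E → ℝ}
    (hΩ : e ⁻¹' Ω = univ ×ˢ Ioi 0) (hwt : ∀ q, wt (e q) = ρ q.2) :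
    weightedMeasure Ω wt α = (volume.prod (heightMeasure ρ α)).map e := by
  rw [heightMeasure, prod_withDensity_right₀ (hρ.aemeasurable α)]
  have h0 : (volume : Measure X).prod (volume.restrict (Ioi (0 : ℝ))) =
      (volume : Measure (X × ℝ)).restrict (univ ×ˢ Ioi 0) := by
    rw [Measure.volume_eq_prod, ← Measure.prod_restrict, Measure.restrict_univ]
  ext s hs
  rw [e.map_apply, withDensity_apply _ (e.measurable hs), h0, weightedMeasure,
    withDensity_apply _ hs, Measure.restrict_restrict hs,
    Measure.restrict_restrict (e.measurable hs), ← hΩ, ← preimage_inter,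
    ← he.setLIntegral_comp_preimage_emb e.measurableEmbedding]
  simp only [hwt]

theorem isHarmonicBergmanKernel_harmonicKernel (n : ℕ) {ρ : ℝ → ℝ} (hρ : Suitable ρ) {α : ℝ}
    (hα : 0 ≤ α) :
    IsHarmonicBergmanKernel (halfSpace n) (halfSpaceWeight n ρ) α
      fun p q => (harmonicKernel (heightMeasure ρ α) univ p q).re := by
  intro p hp
  have hν := hρ.dominatesLebesgue hα
  have hre : ∀ q, ((harmonicKernel (heightMeasure ρ α) univ p q).re : ℂ) =
      harmonicKernel (heightMeasure ρ α) univ p q := fun q =>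
    Complex.conj_eq_iff_re.1 (conj_harmonicKernel _ p q)
  have hμ := hρ.weightedMeasure_eq_map α
    (MeasurableEquiv.toLp 2 (EuclideanSpace ℝ (Fin (n - 1)) × ℝ))
    (WithLp.volume_preserving_toLp _ _) (Ω := halfSpace n) (wt := halfSpaceWeight n ρ)
    (by ext; simp [halfSpace]) fun q => rfl
  simp only [hre, harmonicBergmanSpace, mem_ofPred_eq, hμ, MeasurableEquiv.memLp_map_measure_iff,
    integral_map_equiv]
  refine ⟨⟨harmonicOnNhd_harmonicKernel hν .univ hp, memLp_harmonicKernel hν .univ hp⟩, ?_⟩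
  rintro f ⟨hf, hf2⟩
  rw [eq_integral_mul_conj_harmonicKernel_univ hν hp hf hf2]
  simp only [conj_harmonicKernel]
  rfl

/-- A harmonic Bergman kernel is determined on the diagonal. -/
theorem IsHarmonicBergmanKernel.self_eq {E : Type*} [NormedAddCommGroup E] [InnerProductSpace ℝ E]
    [FiniteDimensional ℝ E] [MeasureSpace E] {Ω : Set E} {wt : E → ℝ} {α : ℝ} {R R' : E → E → ℝ}
    (hR : IsHarmonicBergmanKernel Ω wt α R) (hR' : IsHarmonicBergmanKernel Ω wt α R') {p : E}
    (hp : p ∈ Ω) : R p p = R' p p := by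
  have h1 := (hR p hp).2 _ (hR' p hp).1
  have h2 := (hR' p hp).2 _ (hR p hp).1
  have h3 : (R' p p : ℂ) = R p p := by
    rw [h1, h2]
    exact integral_congr_ae (Eventually.of_forall fun q => mul_comm _ _)
  exact_mod_cast h3.symm

/-- A holomorphic Bergman kernel is determined on the diagonal. -/
theorem IsHolomorphicBergmanKernel.self_eq {E : Type*} [NormedAddCommGroup E] [NormedSpace ℂ E]
    [MeasureSpace E] {Ω : Set E} {wt : E → ℝ} {α : ℝ} {K K' : E → E → ℂ}
    (hK : IsHolomorphicBergmanKernel Ω wt α K) (hK' : IsHolomorphicBergmanKernel Ω wt α K')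
    {p : E} (hp : p ∈ Ω) : K p p = K' p p := by
  have h0 := (hK' p hp).2 _ (hK' p hp).1
  have h1 := (hK p hp).2 _ (hK' p hp).1
  have h2 := (hK' p hp).2 _ (hK p hp).1
  have h3 : conj (K' p p) = K' p p := by
    conv_lhs => rw [h0]
    conv_rhs => rw [h0]
    rw [← integral_conj]
    refine integral_congr_ae (Eventually.of_forall fun q => ?_)
    simp [mul_comm]
  rw [← h3, h1, ← integral_conj, h2]
  refine integral_congr_ae (Eventually.of_forall fun q => ?_)
  simp [mul_comm]

theorem nsmul_volume_ball_eq_sphereArea {d : ℕ} (hd : 0 < d) :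
    d * (volume : Measure (EuclideanSpace ℝ (Fin d))).real (Metric.ball 0 1) = sphereArea d := by
  have : Nonempty (Fin d) := ⟨⟨0, hd⟩⟩
  have hd' : (0 : ℝ) < d / 2 := by positivity
  have hG := Real.Gamma_pos_of_pos hd'
  rw [measureReal_def, EuclideanSpace.volume_ball, Fintype.card_fin, ENNReal.ofReal_one, one_pow,
    one_mul, Real.Gamma_add_one hd'.ne', ENNReal.toReal_ofReal (by positivity), sphereArea,
    Real.sqrt_eq_rpow, ← Real.rpow_natCast (Real.pi ^ _), ← Real.rpow_mul Real.pi_pos.le]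
  rw [show 1 / 2 * (d : ℝ) = d / 2 by ring]
  field_simp

/-- The diagonal of the half-space kernel, in polar coordinates on the frequency side. -/
theorem harmonicKernel_univ_self {d : ℕ} (hd : 0 < d) (ν : Measure ℝ)
    (p : WithLp 2 (EuclideanSpace ℝ (Fin d) × ℝ)) :
    harmonicKernel ν univ p p = (sphereArea d * ∫ t in Ioi (0 : ℝ),
      t ^ (d - 1) * (poissonMul (2 * p.snd) t * (poissonLaplace ν t).toReal⁻¹) : ℝ) := by
  have : Nontrivial (EuclideanSpace ℝ (Fin d)) := by
    have : Nonempty (Fin d) := ⟨⟨0, hd⟩⟩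
    infer_instance
  rw [harmonicKernel_self ν .univ, setIntegral_univ]
  congr 1
  have h := integral_fun_norm_addHaar (volume : Measure (EuclideanSpace ℝ (Fin d)))
    fun t : ℝ => poissonMul (2 * p.snd) t * (poissonLaplace ν t).toReal⁻¹
  rw [finrank_euclideanSpace_fin] at h
  rw [← nsmul_volume_ball_eq_sphereArea hd, mul_assoc, ← nsmul_eq_mul]
  simp only [smul_eq_mul] at h
  rw [← h]
  simp [poissonLaplace, poissonMul]

end Weight

/-! ### Holomorphic functions on the upper half-plane -/

section UpperHalfPlane

/-- The linear map `p ↦ a p + i b p`. -/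
noncomputable def complexOfPair {E : Type*} [NormedAddCommGroup E] [NormedSpace ℝ E]
    (a b : E →L[ℝ] ℝ) : E →L[ℝ] ℂ :=
  (Complex.equivRealProdCLM.symm : ℝ × ℝ →L[ℝ] ℂ) ∘L (a.prod b)

theorem iteratedFDeriv_two_comp_clm {E : Type*} [NormedAddCommGroup E] [NormedSpace ℝ E]
    {f : ℂ → ℂ} {s : Set ℂ} (hs : IsOpen s) (hf : ContDiffOn ℝ 2 f s) (ℓ : E →L[ℝ] ℂ) {p : E}
    (hp : ℓ p ∈ s) (v : E) :
    iteratedFDeriv ℝ 2 (f ∘ ℓ) p ![v, v] = iteratedFDeriv ℝ 2 f (ℓ p) ![ℓ v, ℓ v] := by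
  have hs' : IsOpen (ℓ ⁻¹' s) := hs.preimage ℓ.continuous
  rw [← iteratedFDerivWithin_of_isOpen 2 hs' hp, ← iteratedFDerivWithin_of_isOpen 2 hs hp,
    ℓ.iteratedFDerivWithin_comp_right hf hs.uniqueDiffOn hs'.uniqueDiffOn hp le_rfl]
  simp only [ContinuousMultilinearMap.compContinuousLinearMap_apply]
  congr 1
  ext i
  fin_cases i <;> rfl

theorem isOpen_im_pos : IsOpen {w : ℂ | 0 < w.im} :=
  isOpen_lt continuous_const Complex.continuous_im

theorem DifferentiableOn.harmonicOnNhd_upperHalf {f : ℂ → ℂ}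
    (hf : DifferentiableOn ℂ f {w | 0 < w.im}) :
    InnerProductSpace.HarmonicOnNhd
      (fun p : WithLp 2 (ℝ × ℝ) => f (complexOfPair (fstL 2 ℝ ℝ ℝ) (sndL 2 ℝ ℝ ℝ) p))
      (upperHalf ℝ) := by
  have hc : ContDiffOn ℝ 2 f {w | 0 < w.im} := (hf.contDiffOn isOpen_im_pos).restrict_scalars ℝ
  intro p hp
  have hm : ∀ q ∈ upperHalf ℝ,
      complexOfPair (fstL 2 ℝ ℝ ℝ) (sndL 2 ℝ ℝ ℝ) q ∈ {w : ℂ | 0 < w.im} := fun q hq => hq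
  refine ⟨(hc.contDiffAt (isOpen_im_pos.mem_nhds (hm p hp))).comp p
    (complexOfPair (fstL 2 ℝ ℝ ℝ) (sndL 2 ℝ ℝ ℝ)).contDiff.contDiffAt, ?_⟩
  filter_upwards [isOpen_upperHalf.mem_nhds hp] with q hq
  rw [laplacian_eq_sum_add (OrthonormalBasis.singleton Unit ℝ)]
  have key := fun v => iteratedFDeriv_two_comp_clm isOpen_im_pos hc
    (complexOfPair (fstL 2 ℝ ℝ ℝ) (sndL 2 ℝ ℝ ℝ)) (hm q hq) v
  have e1 : complexOfPair (fstL 2 ℝ ℝ ℝ) (sndL 2 ℝ ℝ ℝ) (toLp 2 ((1 : ℝ), (0 : ℝ))) = 1 := by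
    simp [complexOfPair, Complex.ext_iff]
  have e2 : complexOfPair (fstL 2 ℝ ℝ ℝ) (sndL 2 ℝ ℝ ℝ) (toLp 2 ((0 : ℝ), (1 : ℝ))) =
      Complex.I := by
    simp [complexOfPair, Complex.ext_iff]
  have hA := ((hf.analyticOnNhd isOpen_im_pos) _ (hm q hq)).harmonicAt.2.self_of_nhds
  rw [InnerProductSpace.laplacian_eq_iteratedFDeriv_complexPlane] at hA
  have k1 := key (toLp 2 ((1 : ℝ), (0 : ℝ)))
  have k2 := key (toLp 2 ((0 : ℝ), (1 : ℝ)))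
  rw [e1] at k1
  rw [e2] at k2
  simp only [Finset.univ_unique, OrthonormalBasis.singleton_apply, Finset.sum_const,
    Finset.card_singleton, one_smul]
  exact (congrArg₂ (· + ·) k1 k2).trans hA

theorem harmonicExt_eq_integral_complex (g : ℝ → ℂ) (w : ℂ) :
    harmonicExt g (toLp 2 (w.re, w.im)) =
      ∫ ξ, Complex.exp (phaseCLM Complex.reCLM Complex.imCLM ξ w) • g ξ := by
  simp [harmonicExt, phaseCLM_apply]

/-- The symbol of the Cauchy-Riemann operator applied to a harmonic extension. -/
noncomputable def cauchyRiemannSymbol (g : ℝ → ℂ) (ξ : ℝ) : ℂ :=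
  (phaseCLM Complex.reCLM Complex.imCLM ξ Complex.I -
    Complex.I * phaseCLM Complex.reCLM Complex.imCLM ξ 1) * g ξ

theorem cauchyRiemannSymbol_eq (g : ℝ → ℂ) (ξ : ℝ) :
    cauchyRiemannSymbol g ξ = (2 * Real.pi * (ξ - |ξ|) : ℝ) * g ξ := by
  have h := Complex.I_mul_I
  have h1 : ⟪ξ, (1 : ℝ)⟫ = ξ := by simp
  rw [cauchyRiemannSymbol, phaseCLM_apply, phaseCLM_apply]
  congr 1
  simp only [Complex.reCLM_apply, Complex.imCLM_apply, Complex.I_re, Complex.I_im, Complex.one_re,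
    Complex.one_im, inner_zero_right, Real.norm_eq_abs, h1]
  push_cast
  linear_combination (-2 * Real.pi * ξ) * h

/-- A harmonic extension is holomorphic where the Cauchy-Riemann operator annihilates it. -/
theorem PoissonIntegrable.differentiableAt_iff {g : ℝ → ℂ} (hg : PoissonIntegrable g) {w : ℂ}
    (hw : 0 < w.im) :
    DifferentiableAt ℂ (fun w : ℂ => harmonicExt g (toLp 2 (w.re, w.im))) w ↔
      harmonicExt (cauchyRiemannSymbol g) (toLp 2 (w.re, w.im)) = 0 := by
  simp only [harmonicExt_eq_integral_complex]
  have hd := hg.hasFDerivAt Complex.reCLM Complex.imCLM (p := w) hw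
  have hI := (hg.phaseCLM_smulRight Complex.reCLM Complex.imCLM).integrable_cexp
    Complex.reCLM Complex.imCLM (p := w) hw
  rw [differentiableAt_complex_iff_differentiableAt_real, and_iff_right hd.differentiableAt,
    hd.fderiv, ContinuousLinearMap.integral_apply hI, ContinuousLinearMap.integral_apply hI,
    ← sub_eq_zero, ← integral_smul]
  have hI1 := (hI.apply_continuousLinearMap 1).smul Complex.I
  simp only [Pi.smul_def] at hI1
  rw [← integral_sub (hI.apply_continuousLinearMap _) hI1]
  refine Eq.congr (integral_congr_ae (Eventually.of_forall fun ξ => ?_)) rfl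
  simp only [cauchyRiemannSymbol, smul_apply,
    ContinuousLinearMap.smulRight_apply, smul_eq_mul]
  ring

theorem differentiableOn_harmonicExt {g : ℝ → ℂ} (hg : PoissonIntegrable g)
    (hg0 : ∀ ξ, ξ ∉ Ioi 0 → g ξ = 0) :
    DifferentiableOn ℂ (fun w : ℂ => harmonicExt g (toLp 2 (w.re, w.im))) {w | 0 < w.im} := by
  intro w hw
  refine ((hg.differentiableAt_iff hw).2 ?_).differentiableWithinAt
  rw [harmonicExt]
  refine integral_eq_zero_of_ae (Eventually.of_forall fun ξ => ?_)
  by_cases h : ξ ∈ Ioi 0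
  · simp [cauchyRiemannSymbol_eq, abs_of_pos (mem_Ioi.1 h)]
  · simp [cauchyRiemannSymbol_eq, hg0 ξ h]

/-- The spectrum of a holomorphic function is contained in the positive half-line. -/
theorem ae_eq_zero_of_differentiableOn {g : ℝ → ℂ} (hg : PoissonIntegrable g)
    (hg2 : ∀ y : ℝ, 0 < y → MemLp (fun ξ => (poissonMul y ξ : ℂ) * g ξ) 2)
    (hd : DifferentiableOn ℂ (fun w : ℂ => harmonicExt g (toLp 2 (w.re, w.im))) {w | 0 < w.im}) :
    ∀ᵐ ξ, ξ ∉ Ioi 0 → g ξ = 0 := by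
  set B := cauchyRiemannSymbol g with hB
  have hBm : AEStronglyMeasurable B := by
    have : AEStronglyMeasurable fun ξ : ℝ => ((2 * Real.pi * (ξ - |ξ|) : ℝ) : ℂ) * g ξ :=
      (by fun_prop : Continuous fun ξ : ℝ => ((2 * Real.pi * (ξ - |ξ|) : ℝ) : ℂ)
        ).aestronglyMeasurable.mul hg.1
    exact this.congr (Eventually.of_forall fun ξ => (cauchyRiemannSymbol_eq g ξ).symm)
  have hbd : ∀ y : ℝ, 0 < y → ∀ ξ, poissonMul y ξ * ‖B ξ‖ ≤
      4 / y * (poissonMul (y / 2) ξ * ‖g ξ‖) := by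
    intro y hy ξ
    have h1 := norm_mul_poissonMul_le (half_pos hy) ξ
    have h3 := poissonMul_pos (y / 2) ξ
    have h4 : ‖B ξ‖ ≤ 4 * Real.pi * (‖ξ‖ * ‖g ξ‖) := by
      rw [hB, cauchyRiemannSymbol_eq, norm_mul, Complex.norm_real, norm_mul,
        Real.norm_of_nonneg (by positivity : 0 ≤ 2 * Real.pi)]
      have : ‖ξ - |ξ|‖ ≤ 2 * ‖ξ‖ := (norm_sub_le _ _).trans (by simp [two_mul])
      calc _ ≤ 2 * Real.pi * (2 * ‖ξ‖) * ‖g ξ‖ := by gcongr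
        _ = _ := by ring
    have e : poissonMul y ξ = poissonMul (y / 2) ξ * poissonMul (y / 2) ξ := by
      rw [← poissonMul_add]; ring_nf
    rw [e]
    calc _ ≤ poissonMul (y / 2) ξ * poissonMul (y / 2) ξ * (4 * Real.pi * (‖ξ‖ * ‖g ξ‖)) := by
          gcongr
      _ = 4 * Real.pi * (‖ξ‖ * poissonMul (y / 2) ξ) * (poissonMul (y / 2) ξ * ‖g ξ‖) := by ring
      _ ≤ 4 * Real.pi * (1 / (2 * Real.pi * (y / 2))) * (poissonMul (y / 2) ξ * ‖g ξ‖) := by gcongr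
      _ = _ := by have := Real.pi_ne_zero; field_simp
  have hBP : PoissonIntegrable B := by
    refine ⟨hBm, fun y hy => ?_⟩
    refine ((hg.integrable (y / 2) (half_pos hy)).const_mul (4 / y)).mono'
      ((continuous_poissonMul y).aestronglyMeasurable.mul hBm.norm)
      (Eventually.of_forall fun ξ => ?_)
    rw [Real.norm_of_nonneg (mul_nonneg (poissonMul_pos y ξ).le (norm_nonneg _))]
    exact hbd y hy ξ
  have hB2 : MemLp (fun ξ => (poissonMul 1 ξ : ℂ) * B ξ) 2 := by
    refine ((hg2 (1 / 2) one_half_pos).const_mul ((4 / 1 : ℝ) : ℂ)).mono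
      ((Complex.continuous_ofReal.comp (continuous_poissonMul 1)).aestronglyMeasurable.mul hBm)
      (Eventually.of_forall fun ξ => ?_)
    rw [norm_mul, norm_mul, norm_mul, Complex.norm_real, Complex.norm_real, Complex.norm_real,
      Real.norm_of_nonneg (poissonMul_pos _ ξ).le, Real.norm_of_nonneg (poissonMul_pos _ ξ).le,
      Real.norm_of_nonneg (by norm_num : (0 : ℝ) ≤ 4 / 1)]
    exact hbd 1 one_pos ξ
  have h0 : ∀ x : ℝ, harmonicExt B (toLp 2 (x, (1 : ℝ))) = 0 := by
    intro x
    have hw : 0 < (⟨x, 1⟩ : ℂ).im := one_pos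
    exact (hg.differentiableAt_iff hw).1 (hd.differentiableAt (isOpen_im_pos.mem_nhds hw))
  have h1 := sliceEnergy_harmonicExt hBP one_pos hB2
  simp only [sliceEnergy, h0] at h1
  simp only [enorm_zero, ne_eq, OfNat.ofNat_ne_zero, not_false_eq_true, zero_pow,
    lintegral_zero] at h1
  have h2 := (lintegral_eq_zero_iff' (hB2.1.enorm.pow_const 2)).1 h1.symm
  filter_upwards [h2, Measure.ae_ne volume (0 : ℝ)] with ξ hξ hξ0 hneg
  have hlt : ξ < 0 := lt_of_le_of_ne (not_lt.1 hneg) hξ0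
  have h5 : B ξ = 0 := by
    have : (poissonMul 1 ξ : ℂ) ≠ 0 := by exact_mod_cast (poissonMul_pos 1 ξ).ne'
    simpa [this] using hξ
  rw [hB, cauchyRiemannSymbol_eq, abs_of_neg hlt] at h5
  have h6 : 2 * Real.pi * (ξ - -ξ) ≠ 0 := by
    have := Real.pi_ne_zero
    simp only [sub_neg_eq_add, ne_eq, mul_eq_zero, not_or]
    refine ⟨⟨two_ne_zero, this⟩, by linarith⟩
  exact (mul_eq_zero.1 h5).resolve_left (by exact_mod_cast h6)

/-- The reproducing kernel, at the point `w₀`, of the holomorphic functions on the upper half-plane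
that are square integrable with respect to `dx dν(y)`. -/
noncomputable def planeKernel (ν : Measure ℝ) (w₀ w : ℂ) : ℂ :=
  harmonicKernel ν (Ioi 0) (toLp 2 (w₀.re, w₀.im)) (toLp 2 (w.re, w.im))

theorem differentiableOn_planeKernel {ν : Measure ℝ} [SFinite ν] (hν : DominatesLebesgue ν)
    {w₀ : ℂ} (hw₀ : 0 < w₀.im) : DifferentiableOn ℂ (planeKernel ν w₀) {w | 0 < w.im} :=
  differentiableOn_harmonicExt (.of_memLp (memLp_kernelSymbol hν measurableSet_Ioi hw₀))
    fun ξ hξ => by simp [kernelSymbol, indicator_of_notMem hξ]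

theorem memLp_planeKernel {ν : Measure ℝ} [SFinite ν] (hν : DominatesLebesgue ν)
    {w₀ : ℂ} (hw₀ : 0 < w₀.im) :
    MemLp (fun q : ℝ × ℝ => planeKernel ν w₀ ⟨q.1, q.2⟩) 2 (volume.prod ν) :=
  memLp_harmonicKernel hν measurableSet_Ioi hw₀

theorem eq_integral_mul_conj_planeKernel {ν : Measure ℝ} [SFinite ν] (hν : DominatesLebesgue ν)
    {w₀ : ℂ} (hw₀ : 0 < w₀.im) {f : ℂ → ℂ} (hf : DifferentiableOn ℂ f {w | 0 < w.im})
    (hf2 : MemLp (fun q : ℝ × ℝ => f ⟨q.1, q.2⟩) 2 (volume.prod ν)) :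
    f w₀ = ∫ q : ℝ × ℝ, f ⟨q.1, q.2⟩ * conj (planeKernel ν w₀ ⟨q.1, q.2⟩) ∂(volume.prod ν) := by
  have hh := hf.harmonicOnNhd_upperHalf
  obtain ⟨A, hA, hA2, hfA⟩ := exists_eq_harmonicExt hh fun δ hδ =>
    hν.lintegral_lt_top ((memLp_prod_iff hν hh.continuousOn).1 hf2) hδ
  have hd : DifferentiableOn ℂ (fun w : ℂ => harmonicExt A (toLp 2 (w.re, w.im)))
      {w | 0 < w.im} := hf.congr fun w hw => (hfA (toLp 2 (w.re, w.im)) hw).symm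
  exact eq_integral_mul_conj_harmonicKernel hν measurableSet_Ioi
    (p := toLp 2 (w₀.re, w₀.im)) hw₀ hA hA2 (ae_eq_zero_of_differentiableOn hA hA2 hd) hfA hf2

end UpperHalfPlane

/-! ### Coordinates on the Siegel domain -/

section SiegelCoordinates

variable {m : ℕ}

/-- The square `|z|²` of the Euclidean norm on `ℂ^m`. -/
noncomputable def sqNorm (z : Fin m → ℂ) : ℝ := ∑ j, ‖z j‖ ^ 2

@[fun_prop]
theorem continuous_sqNorm : Continuous (sqNorm : (Fin m → ℂ) → ℝ) := by
  unfold sqNorm; fun_prop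

theorem sqNorm_nonneg (z : Fin m → ℂ) : 0 ≤ sqNorm z :=
  Finset.sum_nonneg fun j _ => by positivity

theorem sqNorm_smul (c : ℂ) (z : Fin m → ℂ) : sqNorm (c • z) = ‖c‖ ^ 2 * sqNorm z := by
  simp [sqNorm, mul_pow, Finset.mul_sum]

/-- The coordinates `((z, x), h) ↦ (z, x + i (h + |z|²))`, whose last entry `h` is the height above
the boundary of the Siegel domain. -/
noncomputable def siegelChart (m : ℕ) : ((Fin m → ℂ) × ℝ) × ℝ ≃ᵐ (Fin m → ℂ) × ℂ where
  toFun q := (q.1.1, ⟨q.1.2, q.2 + sqNorm q.1.1⟩)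
  invFun p := ((p.1, p.2.re), p.2.im - sqNorm p.1)
  left_inv q := by simp
  right_inv p := by simp
  measurable_toFun := by
    refine (measurable_fst.comp measurable_fst).prodMk ?_
    refine Complex.measurableEquivRealProd.symm.measurable.comp
      ((measurable_snd.comp measurable_fst).prodMk ?_)
    exact (by fun_prop : Continuous fun q : ((Fin m → ℂ) × ℝ) × ℝ =>
      q.2 + sqNorm q.1.1).measurable
  measurable_invFun := by
    have : Continuous fun p : (Fin m → ℂ) × ℂ => ((p.1, p.2.re), p.2.im - sqNorm p.1) := by
      fun_prop
    exact this.measurable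

theorem siegelChart_apply (q : ((Fin m → ℂ) × ℝ) × ℝ) :
    siegelChart m q = (q.1.1, ⟨q.1.2, q.2 + sqNorm q.1.1⟩) := rfl

theorem measurePreserving_siegelChart : MeasurePreserving (siegelChart m) := by
  have h1 : MeasurePreserving (fun q : (Fin m → ℂ) × (ℝ × ℝ) =>
      (q.1, Complex.measurableEquivRealProd.symm q.2 + (sqNorm q.1 : ℂ) * Complex.I)) := by
    refine (MeasurePreserving.id volume).skew_product (g := fun z (q : ℝ × ℝ) =>
      Complex.measurableEquivRealProd.symm q + (sqNorm z : ℂ) * Complex.I) ?_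
      (Eventually.of_forall fun z => ?_)
    · refine (Complex.measurableEquivRealProd.symm.measurable.comp measurable_snd).add ?_
      exact (by fun_prop : Continuous fun q : (Fin m → ℂ) × (ℝ × ℝ) =>
        (sqNorm q.1 : ℂ) * Complex.I).measurable
    · exact ((measurePreserving_add_right volume ((sqNorm z : ℂ) * Complex.I)).comp
        Complex.volume_preserving_equiv_real_prod.symm).map_eq
  have h2 := h1.comp (measurePreserving_prodAssoc (volume : Measure (Fin m → ℂ))
    (volume : Measure ℝ) (volume : Measure ℝ))
  have e : ⇑(siegelChart m) = (fun q : (Fin m → ℂ) × (ℝ × ℝ) =>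
      (q.1, Complex.measurableEquivRealProd.symm q.2 + (sqNorm q.1 : ℂ) * Complex.I)) ∘
      MeasurableEquiv.prodAssoc := by
    funext q
    refine Prod.ext rfl (Complex.ext ?_ ?_) <;>
      simp [siegelChart_apply, MeasurableEquiv.prodAssoc,
        Complex.measurableEquivRealProd_symm_apply]
  rw [e]
  exact h2

/-- The distribution of the imaginary part `h + |z|²` under `dz dν(h)`. -/
noncomputable def siegelHeightMeasure (m : ℕ) (ν : Measure ℝ) : Measure ℝ :=
  ((volume : Measure (Fin m → ℂ)).prod ν).map fun q => q.2 + sqNorm q.1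

instance (ν : Measure ℝ) [SFinite ν] : SFinite (siegelHeightMeasure m ν) := by
  unfold siegelHeightMeasure; infer_instance

theorem measurable_add_sqNorm : Measurable fun q : (Fin m → ℂ) × ℝ => q.2 + sqNorm q.1 :=
  (by fun_prop : Continuous fun q : (Fin m → ℂ) × ℝ => q.2 + sqNorm q.1).measurable

/-- Forgetting `z` maps `dz dx dν(h)` to `dx` times the height distribution. -/
theorem measurePreserving_siegelProj (ν : Measure ℝ) [SFinite ν] :
    MeasurePreserving (fun q : ((Fin m → ℂ) × ℝ) × ℝ => (q.1.2, q.2 + sqNorm q.1.1))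
      (volume.prod ν) (volume.prod (siegelHeightMeasure m ν)) := by
  have h1 : MeasurePreserving (fun q : (Fin m → ℂ) × ℝ => q.2 + sqNorm q.1) (volume.prod ν)
      (siegelHeightMeasure m ν) := ⟨measurable_add_sqNorm, rfl⟩
  have h2 := (MeasurePreserving.id (volume : Measure ℝ)).prod h1
  have h3 := measurePreserving_prodAssoc (volume : Measure ℝ) (volume : Measure (Fin m → ℂ)) ν
  have h4 := (Measure.measurePreserving_swap (μ := (volume : Measure (Fin m → ℂ)))
    (ν := (volume : Measure ℝ))).prod (MeasurePreserving.id ν)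
  exact (h2.comp h3).comp h4

theorem DominatesLebesgue.siegelHeightMeasure {ν : Measure ℝ} [SFinite ν]
    (hν : DominatesLebesgue ν) (m : ℕ) : DominatesLebesgue (siegelHeightMeasure m ν) where
  measure_Iic := by
    rw [_root_.siegelHeightMeasure, Measure.map_apply measurable_add_sqNorm measurableSet_Iic]
    refine measure_mono_null (t := univ ×ˢ Iic 0) (fun q hq => ⟨trivial, ?_⟩) ?_
    · have := sqNorm_nonneg q.1
      simp only [mem_preimage, mem_Iic] at hq ⊢
      linarith
    · rw [Measure.prod_prod, hν.measure_Iic, mul_zero]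
  le δ hδ := by
    obtain ⟨c, hc, h⟩ := hν.le (δ / 2) (half_pos hδ)
    -- restrict to a small ball in `z`, on which the shift of the height is at most `δ / 2`
    obtain ⟨ε, hε, hball⟩ : ∃ ε : ℝ, 0 < ε ∧ Metric.ball (0 : Fin m → ℂ) ε ⊆
        {z | sqNorm z < δ / 2} := by
      refine Metric.isOpen_iff.1 (isOpen_lt continuous_sqNorm continuous_const) 0 ?_
      simpa [sqNorm] using hδ
    set B := Metric.ball (0 : Fin m → ℂ) ε
    have hB0 : volume B ≠ 0 := (Metric.measure_ball_pos volume 0 hε).ne'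
    have hB1 : volume B ≠ ⊤ := measure_ball_lt_top.ne
    refine ⟨c * (volume B).toReal, mul_pos hc (ENNReal.toReal_pos hB0 hB1), ?_⟩
    rw [Measure.le_iff]
    intro s hs
    have hs' := measurable_add_sqNorm (m := m) hs
    rw [_root_.siegelHeightMeasure, Measure.map_apply measurable_add_sqNorm hs,
      Measure.prod_apply hs', Measure.smul_apply, Measure.restrict_apply hs, smul_eq_mul,
      ENNReal.ofReal_mul hc.le, ENNReal.ofReal_toReal hB1]
    calc ENNReal.ofReal c * volume B * volume (s ∩ Ioi δ)
        = ∫⁻ _ in B, ENNReal.ofReal c * volume (s ∩ Ioi δ) := by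
          rw [setLIntegral_const]; ring
      _ ≤ ∫⁻ z in B, ν (Prod.mk z ⁻¹' ((fun q : (Fin m → ℂ) × ℝ => q.2 + sqNorm q.1) ⁻¹' s)) := by
          refine setLIntegral_mono' measurableSet_ball fun z hz => ?_
          have hz' : sqNorm z < δ / 2 := hball hz
          have hms : MeasurableSet ((fun y : ℝ => y + sqNorm z) ⁻¹' s) :=
            (measurable_add_const (sqNorm z)) hs
          refine le_trans ?_ (h _)
          rw [Measure.smul_apply, smul_eq_mul]
          refine mul_le_mul_right ?_ _
          change _ ≤ (volume.restrict (Ioi (δ / 2))) ((fun y : ℝ => y + sqNorm z) ⁻¹' s)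
          rw [Measure.restrict_apply hms, ← measure_preimage_add_right volume (sqNorm z)]
          refine measure_mono fun y hy => ⟨hy.1, ?_⟩
          have : δ < y + sqNorm z := hy.2
          rw [mem_Ioi]
          linarith
      _ ≤ _ := setLIntegral_le_lintegral _ _

theorem lintegral_exp_neg_sqNorm {b : ℝ} (hb : 0 < b) :
    ∫⁻ z : Fin m → ℂ, ENNReal.ofReal (Real.exp (-b * sqNorm z)) =
      ENNReal.ofReal ((Real.pi / b) ^ m) := by
  have h1 : ∫ z : Fin m → ℂ, Real.exp (-b * sqNorm z) = (Real.pi / b) ^ m := by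
    have e : ∀ z : Fin m → ℂ, Real.exp (-b * sqNorm z) = ∏ j, Real.exp (-b * ‖z j‖ ^ 2) := by
      intro z
      rw [sqNorm, Finset.mul_sum, Real.exp_sum]
    simp only [e]
    rw [integral_fintype_prod_volume_eq_pow (fun w : ℂ => Real.exp (-b * ‖w‖ ^ 2)),
      GaussianFourier.integral_rexp_neg_mul_sq_norm hb]
    simp
  -- a non-integrable function would have integral `0`
  have h2 : Integrable fun z : Fin m → ℂ => Real.exp (-b * sqNorm z) := by
    by_contra h
    rw [integral_undef h] at h1
    have : 0 < (Real.pi / b) ^ m := by positivity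
    exact this.ne h1
  rw [← h1, ofReal_integral_eq_lintegral_ofReal h2
    (Eventually.of_forall fun z => (Real.exp_pos _).le)]

/-- The Gaussian integral over `z` gives a power in the Laplace transform. -/
theorem poissonLaplace_siegelHeightMeasure (ν : Measure ℝ) [SFinite ν] {t : ℝ} (ht : 0 < t) :
    poissonLaplace (siegelHeightMeasure m ν) t =
      ENNReal.ofReal ((4 * t)⁻¹ ^ m) * poissonLaplace ν t := by
  have hm : Measurable fun y : ℝ => ENNReal.ofReal (poissonMul (2 * y) t) :=
    ENNReal.measurable_ofReal.comp
      (continuous_uncurry_poissonMul.comp (Continuous.prodMk_right t)).measurable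
  have hm2 : Measurable fun z : Fin m → ℂ =>
      ENNReal.ofReal (Real.exp (-(4 * Real.pi * t) * sqNorm z)) :=
    ENNReal.measurable_ofReal.comp (by fun_prop : Continuous fun z : Fin m → ℂ =>
      Real.exp (-(4 * Real.pi * t) * sqNorm z)).measurable
  have hπ := Real.pi_pos
  rw [poissonLaplace, siegelHeightMeasure, lintegral_map hm measurable_add_sqNorm]
  have e : ∀ q : (Fin m → ℂ) × ℝ, ENNReal.ofReal (poissonMul (2 * (q.2 + sqNorm q.1)) t) =
      ENNReal.ofReal (Real.exp (-(4 * Real.pi * t) * sqNorm q.1)) *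
        ENNReal.ofReal (poissonMul (2 * q.2) t) := by
    intro q
    rw [← ENNReal.ofReal_mul (Real.exp_pos _).le, poissonMul, poissonMul, ← Real.exp_add,
      Real.norm_of_nonneg ht.le]
    ring_nf
  simp only [e]
  rw [lintegral_prod_mul hm2.aemeasurable hm.aemeasurable,
    lintegral_exp_neg_sqNorm (by positivity), poissonLaplace]
  congr 3
  field_simp

end SiegelCoordinates

/-! ### Averaging over the rotations of the first variable -/

section Rotation

variable {m : ℕ}

/-- The rotation `z ↦ exp (iθ) z` in the coordinates of `siegelChart`. -/
noncomputable def siegelRotation (θ : ℝ) (q : ((Fin m → ℂ) × ℝ) × ℝ) : ((Fin m → ℂ) × ℝ) × ℝ :=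
  ((circleMap 0 1 θ • q.1.1, q.1.2), q.2)

theorem measurePreserving_siegelRotation (ν : Measure ℝ) [SFinite ν] (θ : ℝ) :
    MeasurePreserving (siegelRotation (m := m) θ) (volume.prod ν) (volume.prod ν) := by
  have h1 : MeasurePreserving fun w : ℂ => circleMap 0 1 θ * w := by
    have := (rotation (Circle.exp θ)).measurePreserving
    convert this using 1
    ext w
    simp [circleMap, rotation_apply]
  have h2 := volume_preserving_pi fun _ : Fin m => h1
  exact (h2.prod (MeasurePreserving.id (volume : Measure ℝ))).prod (MeasurePreserving.id ν)

theorem measurePreserving_prod_siegelRotation (σ ν : Measure ℝ) [SFinite σ] [SFinite ν] :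
    MeasurePreserving (fun q : ℝ × (((Fin m → ℂ) × ℝ) × ℝ) => (q.1, siegelRotation q.1 q.2))
      (σ.prod (volume.prod ν)) (σ.prod (volume.prod ν)) := by
  refine (MeasurePreserving.id σ).skew_product ?_
    (Eventually.of_forall fun θ => (measurePreserving_siegelRotation ν θ).map_eq)
  have : Continuous fun q : ℝ × (((Fin m → ℂ) × ℝ) × ℝ) => siegelRotation q.1 q.2 := by
    unfold siegelRotation circleMap; fun_prop
  exact this.measurable

theorem lintegral_siegelRotation (ν : Measure ℝ) [SFinite ν]
    {F : ((Fin m → ℂ) × ℝ) × ℝ → ENNReal} (hF : AEMeasurable F (volume.prod ν)) :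
    ∫⁻ q, (∫⁻ θ in Ioc 0 (2 * Real.pi), F (siegelRotation θ q)) ∂(volume.prod ν) =
      ENNReal.ofReal (2 * Real.pi) * ∫⁻ q, F q ∂(volume.prod ν) := by
  have hS := measurePreserving_prod_siegelRotation (m := m)
    (volume.restrict (Ioc 0 (2 * Real.pi))) ν
  have hF' : AEMeasurable (fun q : ℝ × (((Fin m → ℂ) × ℝ) × ℝ) => F q.2)
      ((volume.restrict (Ioc 0 (2 * Real.pi))).prod (volume.prod ν)) := hF.comp_snd
  have hc : AEMeasurable (fun q : ℝ × (((Fin m → ℂ) × ℝ) × ℝ) => F (siegelRotation q.1 q.2))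
      ((volume.restrict (Ioc 0 (2 * Real.pi))).prod (volume.prod ν)) :=
    hF'.comp_quasiMeasurePreserving hS.quasiMeasurePreserving
  rw [← lintegral_prod_symm _ hc]
  have e := lintegral_map' (hS.map_eq.symm ▸ hF') hS.aemeasurable
  rw [hS.map_eq] at e
  refine e.symm.trans ?_
  rw [lintegral_prod _ hF']
  simp [mul_comm]

theorem integral_siegelRotation (ν : Measure ℝ) [SFinite ν]
    {F : ((Fin m → ℂ) × ℝ) × ℝ → ℂ} (hF : Integrable F (volume.prod ν)) :
    ∫ q, (∫ θ in Ioc 0 (2 * Real.pi), F (siegelRotation θ q)) ∂(volume.prod ν) =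
      (2 * Real.pi) * ∫ q, F q ∂(volume.prod ν) := by
  have hS := measurePreserving_prod_siegelRotation (m := m)
    (volume.restrict (Ioc 0 (2 * Real.pi))) ν
  have hF' : Integrable (fun q : ℝ × (((Fin m → ℂ) × ℝ) × ℝ) => F q.2)
      ((volume.restrict (Ioc 0 (2 * Real.pi))).prod (volume.prod ν)) := hF.comp_snd _
  have hc : Integrable (fun q : ℝ × (((Fin m → ℂ) × ℝ) × ℝ) => F (siegelRotation q.1 q.2))
      ((volume.restrict (Ioc 0 (2 * Real.pi))).prod (volume.prod ν)) :=
    hS.integrable_comp_of_integrable hF'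
  rw [← integral_prod_symm _ hc]
  have e := integral_map hS.aemeasurable (hS.map_eq.symm ▸ hF'.1)
  rw [hS.map_eq] at e
  refine e.symm.trans ?_
  rw [integral_prod _ hF']
  simp [Real.two_pi_pos.le]

theorem siegelHeight_siegelChart (n : ℕ) (q : ((Fin (n - 2) → ℂ) × ℝ) × ℝ) :
    siegelHeight n (siegelChart (n - 2) q) = q.2 := by
  rw [siegelChart_apply]
  exact add_sub_cancel_right q.2 (sqNorm q.1.1)

/-- The mean value property over the rotations of the first variable. -/
theorem integral_circleMap_smul_eq {n : ℕ} {f : SiegelAmbient n → ℂ}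
    (hf : DifferentiableOn ℂ f (siegelDomain n)) {p : SiegelAmbient n} (hp : p ∈ siegelDomain n) :
    ∫ θ in Ioc 0 (2 * Real.pi), f (circleMap 0 1 θ • p.1, p.2) = 2 * Real.pi * f (0, p.2) := by
  have hU : MapsTo (fun c : ℂ => (c • p.1, p.2)) (Metric.closedBall 0 1) (siegelDomain n) := by
    intro c hc
    have hc1 : ‖c‖ ≤ 1 := by simpa using hc
    have h1 : 0 < p.2.im - sqNorm p.1 := hp
    change 0 < p.2.im - sqNorm (c • p.1)
    rw [sqNorm_smul]
    have h2 := mul_le_of_le_one_left (sqNorm_nonneg p.1)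
      (pow_le_one₀ (n := 2) (norm_nonneg c) hc1)
    linarith
  have hd : DifferentiableOn ℂ (fun c : ℂ => f (c • p.1, p.2)) (Metric.closedBall 0 1) :=
    hf.comp (by fun_prop) hU
  have h := DiffContOnCl.circleAverage (R := 1) (c := (0 : ℂ))
    (f := fun c : ℂ => f (c • p.1, p.2)) (by
      rw [abs_one]
      refine DifferentiableOn.diffContOnCl ?_
      rwa [closure_ball _ one_ne_zero])
  rw [Real.circleAverage_def, intervalIntegral.integral_of_le Real.two_pi_pos.le, zero_smul,
    inv_smul_eq_iff₀ Real.two_pi_pos.ne'] at h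
  rw [h]
  simp

end Rotation

/-! ### The Siegel kernel at a point with vanishing first variable -/

section SiegelKernel

theorem Suitable.weightedMeasure_siegelDomain (n : ℕ) {ρ : ℝ → ℝ} (hρ : Suitable ρ) (α : ℝ) :
    weightedMeasure (siegelDomain n) (siegelWeight n ρ) α =
      (volume.prod (heightMeasure ρ α)).map (siegelChart (n - 2)) := by
  refine hρ.weightedMeasure_eq_map α _ measurePreserving_siegelChart ?_ fun q => ?_
  · ext q
    change 0 < siegelHeight n (siegelChart (n - 2) q) ↔ _
    rw [siegelHeight_siegelChart]
    simp
  · rw [siegelWeight, siegelHeight_siegelChart]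

variable {n : ℕ}

theorem DominatesLebesgue.ae_siegelChart_mem {ν : Measure ℝ} (hν : DominatesLebesgue ν) :
    ∀ᵐ q ∂((volume : Measure ((Fin (n - 2) → ℂ) × ℝ)).prod ν),
      siegelChart (n - 2) q ∈ siegelDomain n := by
  have h : ∀ᵐ q ∂((volume : Measure ((Fin (n - 2) → ℂ) × ℝ)).prod ν), 0 < q.2 :=
    Measure.quasiMeasurePreserving_snd.ae hν.ae_pos
  filter_upwards [h] with q hq
  change 0 < siegelHeight n (siegelChart (n - 2) q)
  rwa [siegelHeight_siegelChart]

theorem zero_prod_mem_siegelDomain {w : ℂ} (hw : 0 < w.im) :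
    ((0, w) : SiegelAmbient n) ∈ siegelDomain n := by
  simpa [siegelDomain, siegelHeight] using hw

theorem im_pos_of_mem_siegelDomain {p : SiegelAmbient n} (hp : p ∈ siegelDomain n) :
    0 < p.2.im := by
  have h1 : 0 < p.2.im - sqNorm p.1 := hp
  linarith [sqNorm_nonneg p.1]

theorem differentiableOn_zero_prod {f : SiegelAmbient n → ℂ}
    (hf : DifferentiableOn ℂ f (siegelDomain n)) :
    DifferentiableOn ℂ (fun w : ℂ => f (0, w)) {w | 0 < w.im} :=
  hf.comp (by fun_prop) fun _ hw => zero_prod_mem_siegelDomain hw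

variable {ν : Measure ℝ} [SFinite ν]

/-- The restriction of a square integrable holomorphic function to `{z = 0}` is square integrable:
its square is the rotation average of the square of the function. -/
theorem memLp_zero_prod (hν : DominatesLebesgue ν) {f : SiegelAmbient n → ℂ}
    (hf : DifferentiableOn ℂ f (siegelDomain n))
    (hf2 : MemLp (f ∘ siegelChart (n - 2)) 2 (volume.prod ν)) :
    MemLp (fun q : ℝ × ℝ => f (0, ⟨q.1, q.2⟩)) 2
      (volume.prod (siegelHeightMeasure (n - 2) ν)) := by
  have hν' := hν.siegelHeightMeasure (n - 2)
  have hm := aestronglyMeasurable_comp_toLp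
    (differentiableOn_zero_prod hf).harmonicOnNhd_upperHalf.continuousOn
    (siegelHeightMeasure (n - 2) ν)
  rw [hν'.restrict_eq] at hm
  have hm : AEStronglyMeasurable (fun q : ℝ × ℝ => f (0, ⟨q.1, q.2⟩))
    (volume.prod (siegelHeightMeasure (n - 2) ν)) := hm
  have hπ := measurePreserving_siegelProj (m := n - 2) ν
  rw [memLp_two_iff hm]
  have hme := hm.enorm.pow_const 2
  have e := lintegral_map' (hπ.map_eq.symm ▸ hme) hπ.aemeasurable
  rw [hπ.map_eq] at e
  rw [e]
  have hfin := (memLp_two_iff hf2.1).1 hf2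
  have hrot := lintegral_siegelRotation ν (hf2.1.enorm.pow_const 2)
  have hle : ENNReal.ofReal (2 * Real.pi) *
      ∫⁻ q : ((Fin (n - 2) → ℂ) × ℝ) × ℝ, ‖f (0, ⟨q.1.2, q.2 + sqNorm q.1.1⟩)‖ₑ ^ 2
        ∂(volume.prod ν) ≤ ENNReal.ofReal (2 * Real.pi) *
      ∫⁻ q, ‖(f ∘ siegelChart (n - 2)) q‖ₑ ^ 2 ∂(volume.prod ν) := by
    rw [← hrot, ← lintegral_const_mul' _ _ ENNReal.ofReal_ne_top]
    refine lintegral_mono_ae ?_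
    filter_upwards [hν.ae_siegelChart_mem] with q hq
    -- the mean value property of `f²`
    have h := integral_circleMap_smul_eq (hf.pow 2) hq
    simp only [Pi.pow_apply] at h
    calc ENNReal.ofReal (2 * Real.pi) * ‖f (0, ⟨q.1.2, q.2 + sqNorm q.1.1⟩)‖ₑ ^ 2
        = ‖(2 * Real.pi : ℂ) * f (0, (siegelChart (n - 2) q).2) ^ 2‖ₑ := by
          rw [enorm_mul, enorm_pow]
          congr 1
          rw [← Complex.ofReal_ofNat, ← Complex.ofReal_mul, ← ofReal_norm, Complex.norm_real,
            Real.norm_of_nonneg Real.two_pi_pos.le]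
      _ ≤ ∫⁻ θ in Ioc 0 (2 * Real.pi),
          ‖f (circleMap 0 1 θ • (siegelChart (n - 2) q).1, (siegelChart (n - 2) q).2) ^ 2‖ₑ := by
          rw [← h]
          exact enorm_integral_le_lintegral_enorm _
      _ = _ := by
          refine lintegral_congr fun θ => ?_
          rw [enorm_pow, Function.comp_apply, siegelChart_apply, siegelChart_apply, siegelRotation,
            sqNorm_smul]
          simp
  have h2π : ENNReal.ofReal (2 * Real.pi) ≠ 0 := by simp [Real.pi_pos]
  exact ((ENNReal.mul_le_mul_iff_right h2π ENNReal.ofReal_ne_top).1 hle).trans_lt hfin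

theorem memLp_planeKernel_siegelChart (hν : DominatesLebesgue ν) (n : ℕ) {w₀ : ℂ}
    (hw₀ : 0 < w₀.im) :
    MemLp (fun q => planeKernel (siegelHeightMeasure (n - 2) ν) w₀ (siegelChart (n - 2) q).2) 2
      (volume.prod ν) := by
  have h := (memLp_planeKernel (hν.siegelHeightMeasure (n - 2)) hw₀).comp_measurePreserving
    (measurePreserving_siegelProj (m := n - 2) ν)
  simp only [siegelChart_apply]
  exact h

/-- The reproducing property at `(0, w₀)`: as the kernel does not depend on `z`, averaging over
rotations reduces it to the restriction of `f` to `{z = 0}`. -/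
theorem eq_integral_mul_conj_siegel (hν : DominatesLebesgue ν) {w₀ : ℂ} (hw₀ : 0 < w₀.im)
    {f : SiegelAmbient n → ℂ} (hf : DifferentiableOn ℂ f (siegelDomain n))
    (hf2 : MemLp (f ∘ siegelChart (n - 2)) 2 (volume.prod ν)) :
    f (0, w₀) = ∫ q, f (siegelChart (n - 2) q) *
      conj (planeKernel (siegelHeightMeasure (n - 2) ν) w₀ (siegelChart (n - 2) q).2)
        ∂(volume.prod ν) := by
  have hν' := hν.siegelHeightMeasure (n - 2)
  set k := planeKernel (siegelHeightMeasure (n - 2) ν) w₀ with hk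
  have h2 := memLp_zero_prod hν hf hf2
  have hπ := measurePreserving_siegelProj (m := n - 2) ν
  have hI1 : Integrable (fun q : ℝ × ℝ => f (0, ⟨q.1, q.2⟩) * conj (k ⟨q.1, q.2⟩))
      (volume.prod (siegelHeightMeasure (n - 2) ν)) :=
    h2.integrable_mul (memLp_planeKernel hν' hw₀).star
  have hI2 : Integrable (fun q => f (siegelChart (n - 2) q) * conj (k (siegelChart (n - 2) q).2))
      (volume.prod ν) := hf2.integrable_mul (memLp_planeKernel_siegelChart hν n hw₀).star
  have h2π : (2 * Real.pi : ℂ) ≠ 0 := by exact_mod_cast Real.two_pi_pos.ne'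
  have e1 := integral_map hπ.aemeasurable (hπ.map_eq.symm ▸ hI1.1)
  rw [hπ.map_eq] at e1
  refine (eq_integral_mul_conj_planeKernel hν' hw₀ (differentiableOn_zero_prod hf) h2).trans
    (e1.trans (mul_left_cancel₀ h2π ?_))
  rw [← integral_siegelRotation ν hI2, ← integral_const_mul]
  refine integral_congr_ae ?_
  filter_upwards [hν.ae_siegelChart_mem] with q hq
  have h := integral_circleMap_smul_eq hf hq
  have e : ∀ θ, siegelChart (n - 2) (siegelRotation θ q) =
      (circleMap 0 1 θ • (siegelChart (n - 2) q).1, (siegelChart (n - 2) q).2) := by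
    intro θ
    rw [siegelChart_apply, siegelChart_apply, siegelRotation, sqNorm_smul]
    simp
  simp only [e]
  rw [integral_mul_const, h]
  simp only [siegelChart_apply]
  ring

end SiegelKernel

/-! ### Heisenberg translations and the Siegel kernel -/

section Heisenberg

variable {m : ℕ}

/-- The sesquilinear form `∑ z_j conj(z₀_j)` on `ℂ^m`. -/
noncomputable def sesq (z z₀ : Fin m → ℂ) : ℂ := ∑ j, z j * conj (z₀ j)

/-- The Heisenberg translation that takes `0` to `(z₀, i |z₀|²)`. -/
noncomputable def heisenberg (z₀ : Fin m → ℂ) (p : (Fin m → ℂ) × ℂ) : (Fin m → ℂ) × ℂ :=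
  (p.1 + z₀, p.2 + Complex.I * sqNorm z₀ + 2 * Complex.I * sesq p.1 z₀)

theorem sqNorm_add (z z₀ : Fin m → ℂ) :
    sqNorm (z + z₀) = sqNorm z + sqNorm z₀ + 2 * (sesq z z₀).re := by
  simp only [sqNorm, sesq, Complex.re_sum, Finset.mul_sum, ← Finset.sum_add_distrib]
  refine Finset.sum_congr rfl fun j _ => ?_
  rw [Pi.add_apply, ← Complex.normSq_eq_norm_sq, ← Complex.normSq_eq_norm_sq,
    ← Complex.normSq_eq_norm_sq, Complex.normSq_add]

theorem sesq_self (z : Fin m → ℂ) : sesq z z = sqNorm z := by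
  rw [sesq, sqNorm, Complex.ofReal_sum]
  refine Finset.sum_congr rfl fun j _ => ?_
  rw [Complex.mul_conj, Complex.normSq_eq_norm_sq]

theorem heisenberg_neg_heisenberg (z₀ : Fin m → ℂ) (p : (Fin m → ℂ) × ℂ) :
    heisenberg (-z₀) (heisenberg z₀ p) = p := by
  have h1 : sesq (p.1 + z₀) (-z₀) = -sesq p.1 z₀ - sqNorm z₀ := by
    rw [← sesq_self]
    simp [sesq, add_mul, Finset.sum_add_distrib]
    ring
  have h2 : sqNorm (-z₀) = sqNorm z₀ := by simp [sqNorm]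
  refine Prod.ext (by simp [heisenberg]) ?_
  simp only [heisenberg, h1, h2]
  ring

theorem differentiable_heisenberg (z₀ : Fin m → ℂ) : Differentiable ℂ (heisenberg z₀) := by
  unfold heisenberg sesq; fun_prop

/-- The Heisenberg translation in the coordinates of `siegelChart`, where it does not change the
height. -/
noncomputable def heisenbergChart (z₀ : Fin m → ℂ) (q : ((Fin m → ℂ) × ℝ) × ℝ) :
    ((Fin m → ℂ) × ℝ) × ℝ :=
  ((q.1.1 + z₀, q.1.2 + -(2 * (sesq q.1.1 z₀).im)), q.2)

theorem heisenberg_siegelChart (z₀ : Fin m → ℂ) (q : ((Fin m → ℂ) × ℝ) × ℝ) :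
    heisenberg z₀ (siegelChart m q) = siegelChart m (heisenbergChart z₀ q) := by
  rw [siegelChart_apply, siegelChart_apply]
  refine Prod.ext rfl (Complex.ext ?_ ?_)
  · simp [heisenberg, heisenbergChart]
  · simp [heisenberg, heisenbergChart, sqNorm_add]
    ring

theorem measurePreserving_heisenbergChart (z₀ : Fin m → ℂ) (ν : Measure ℝ) [SFinite ν] :
    MeasurePreserving (heisenbergChart z₀) (volume.prod ν) (volume.prod ν) := by
  have hc : Continuous fun q : (Fin m → ℂ) × ℝ => q.2 + -(2 * (sesq q.1 z₀).im) := by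
    unfold sesq; fun_prop
  have h1 : MeasurePreserving
      (fun q : (Fin m → ℂ) × ℝ => (q.1 + z₀, q.2 + -(2 * (sesq q.1 z₀).im))) volume volume :=
    (measurePreserving_add_right volume z₀).skew_product
      (g := fun z (x : ℝ) => x + -(2 * (sesq z z₀).im)) hc.measurable
      (Eventually.of_forall fun z => (measurePreserving_add_right volume _).map_eq)
  exact h1.prod (MeasurePreserving.id ν)

theorem siegelHeight_heisenberg {n : ℕ} (z₀ : Fin (n - 2) → ℂ) (p : SiegelAmbient n) :
    siegelHeight n (heisenberg z₀ p) = siegelHeight n p := by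
  obtain ⟨q, rfl⟩ := (siegelChart (n - 2)).surjective p
  rw [heisenberg_siegelChart, siegelHeight_siegelChart, siegelHeight_siegelChart]
  rfl

theorem mapsTo_heisenberg {n : ℕ} (z₀ : Fin (n - 2) → ℂ) :
    MapsTo (heisenberg z₀) (siegelDomain n) (siegelDomain n) := by
  intro p hp
  change 0 < siegelHeight n (heisenberg z₀ p)
  rwa [siegelHeight_heisenberg]

/-- The reproducing kernel of the Siegel domain: at a point `p = heisenberg p.1 (0, w₀)` it is the
translate of the kernel at `(0, w₀)`. -/
noncomputable def siegelKernel (n : ℕ) (ν : Measure ℝ) (q p : SiegelAmbient n) : ℂ :=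
  planeKernel (siegelHeightMeasure (n - 2) ν) (p.2 - Complex.I * sqNorm p.1)
    (heisenberg (-p.1) q).2

theorem isHolomorphicBergmanKernel_siegelKernel (n : ℕ) {ρ : ℝ → ℝ} (hρ : Suitable ρ) {α : ℝ}
    (hα : 0 ≤ α) :
    IsHolomorphicBergmanKernel (siegelDomain n) (siegelWeight n ρ) α
      (siegelKernel n (heightMeasure ρ α)) := by
  intro p hp
  have hν := hρ.dominatesLebesgue hα
  set ν := heightMeasure ρ α with hν_def
  set w₀ : ℂ := p.2 - Complex.I * sqNorm p.1 with hw_def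
  set k := planeKernel (siegelHeightMeasure (n - 2) ν) w₀ with hk
  have hw₀ : 0 < w₀.im := by
    have : 0 < p.2.im - sqNorm p.1 := hp
    simpa [hw_def] using this
  have hp0 : heisenberg p.1 (0, w₀) = p := by
    refine Prod.ext (by simp [heisenberg]) ?_
    simp [heisenberg, sesq, hw_def]
  have hd : DifferentiableOn ℂ (fun q : SiegelAmbient n => k (heisenberg (-p.1) q).2)
      (siegelDomain n) :=
    (differentiableOn_planeKernel (hν.siegelHeightMeasure (n - 2)) hw₀).comp
      ((differentiable_heisenberg (-p.1)).snd.differentiableOn)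
      fun q hq => im_pos_of_mem_siegelDomain (mapsTo_heisenberg (-p.1) hq)
  have hk2 := memLp_planeKernel_siegelChart hν n hw₀
  have hT := fun z₀ => measurePreserving_heisenbergChart (m := n - 2) z₀ ν
  simp only [holomorphicBergmanSpace, mem_ofPred_eq, hρ.weightedMeasure_siegelDomain,
    MeasurableEquiv.memLp_map_measure_iff, integral_map_equiv]
  refine ⟨⟨hd, ?_⟩, ?_⟩
  · have h := hk2.comp_measurePreserving (hT (-p.1))
    refine h.ae_eq (Eventually.of_forall fun q => ?_)
    simp only [Function.comp_apply, siegelKernel]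
    rw [heisenberg_siegelChart]
  · rintro f ⟨hf, hf2⟩
    have hfT : DifferentiableOn ℂ (fun q => f (heisenberg p.1 q)) (siegelDomain n) :=
      hf.comp (differentiable_heisenberg p.1).differentiableOn (mapsTo_heisenberg p.1)
    have hfT2 : MemLp ((fun q => f (heisenberg p.1 q)) ∘ siegelChart (n - 2)) 2
        (volume.prod ν) := by
      refine (hf2.comp_measurePreserving (hT p.1)).ae_eq (Eventually.of_forall fun q => ?_)
      simp only [Function.comp_apply]
      rw [heisenberg_siegelChart]
    have h := eq_integral_mul_conj_siegel hν hw₀ hfT hfT2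
    simp only [hp0] at h
    rw [h]
    -- substitute `q ↦ heisenbergChart p.1 q` in the integral
    set F : ((Fin (n - 2) → ℂ) × ℝ) × ℝ → ℂ := fun q => f (siegelChart (n - 2) q) *
      conj (siegelKernel n ν (siegelChart (n - 2) q) p) with hF
    have hI : AEStronglyMeasurable F (volume.prod ν) := by
      have h := hk2.comp_measurePreserving (hT (-p.1))
      refine hf2.1.mul (Complex.continuous_conj.comp_aestronglyMeasurable (h.1.congr
        (Eventually.of_forall fun q => ?_)))
      simp only [Function.comp_apply, siegelKernel]
      rw [heisenberg_siegelChart]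
    have e := integral_map (hT p.1).aemeasurable ((hT p.1).map_eq.symm ▸ hI)
    rw [(hT p.1).map_eq] at e
    rw [e]
    refine integral_congr_ae (Eventually.of_forall fun q => ?_)
    simp only [hF, siegelKernel, ← heisenberg_siegelChart, heisenberg_neg_heisenberg]
    rfl

/-- The diagonal of the Siegel kernel at `(0, w)`. -/
theorem kernelZero_siegelKernel_self (n : ℕ) (ν : Measure ℝ) [SFinite ν] (w : ℂ) :
    kernelZero (siegelKernel n ν) w w = ((4 : ℝ) ^ (n - 2) * ∫ t in Ioi (0 : ℝ),
      t ^ (n - 2) * (poissonMul (2 * w.im) t * (poissonLaplace ν t).toReal⁻¹) : ℝ) := by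
  have h0 : kernelZero (siegelKernel n ν) w w =
      planeKernel (siegelHeightMeasure (n - 2) ν) w w := by
    simp [kernelZero, siegelKernel, heisenberg, sqNorm, sesq]
  rw [h0, planeKernel, harmonicKernel_self _ measurableSet_Ioi, ← integral_const_mul]
  congr 1
  refine setIntegral_congr_fun measurableSet_Ioi fun t ht => ?_
  have ht : 0 < t := ht
  simp only [toLp_snd]
  rw [poissonLaplace_siegelHeightMeasure ν ht, ENNReal.toReal_mul,
    ENNReal.toReal_ofReal (by positivity)]
  rw [mul_inv, ← inv_pow, inv_inv, mul_pow]
  ring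

end Heisenberg

theorem mainTheorem3 (n : ℕ) (hn : 2 ≤ n) (ρ : ℝ → ℝ) (hρ : Suitable ρ) (α : ℝ) (hα : 0 ≤ α) :
    (∃ R, IsHarmonicBergmanKernel (halfSpace n) (halfSpaceWeight n ρ) α R) ∧
    (∃ K, IsHolomorphicBergmanKernel (siegelDomain n) (siegelWeight n ρ) α K) ∧
    ∀ R K, IsHarmonicBergmanKernel (halfSpace n) (halfSpaceWeight n ρ) α R →
      IsHolomorphicBergmanKernel (siegelDomain n) (siegelWeight n ρ) α K →
      ∀ (a : EuclideanSpace ℝ (Fin (n - 1))) (b : ℝ), 0 < b →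
        (∀ s : ℝ, (R (WithLp.toLp 2 (a, b)) (WithLp.toLp 2 (a, b)) : ℂ) =
          (2 : ℂ) ^ (4 - 2 * (n : ℤ)) * (sphereArea (n - 1) : ℂ) *
            kernelZero K (s + b * Complex.I) (s + b * Complex.I)) ∧
        (R (WithLp.toLp 2 (a, b)) (WithLp.toLp 2 (a, b)) : ℂ) =
          (2 : ℂ) ^ (4 - 2 * (n : ℤ)) * (sphereArea (n - 1) : ℂ) *
            kernelZero K (b * Complex.I) (b * Complex.I) := by
  have hR₀ := isHarmonicBergmanKernel_harmonicKernel n hρ hα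
  have hK₀ := isHolomorphicBergmanKernel_siegelKernel n hρ hα
  refine ⟨⟨_, hR₀⟩, ⟨_, hK₀⟩, fun R K hR hK a b hb => ?_⟩
  have key : ∀ s : ℝ, (R (WithLp.toLp 2 (a, b)) (WithLp.toLp 2 (a, b)) : ℂ) =
      (2 : ℂ) ^ (4 - 2 * (n : ℤ)) * (sphereArea (n - 1) : ℂ) *
        kernelZero K (s + b * Complex.I) (s + b * Complex.I) := by
    intro s
    have him : (s + b * Complex.I : ℂ).im = b := by simp
    have h1 : kernelZero K (s + b * Complex.I) (s + b * Complex.I) =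
        kernelZero (siegelKernel n (heightMeasure ρ α)) (s + b * Complex.I)
          (s + b * Complex.I) :=
      hK.self_eq hK₀ (zero_prod_mem_siegelDomain (by rw [him]; exact hb))
    have h2 : (2 : ℂ) ^ (4 - 2 * (n : ℤ)) * 4 ^ (n - 2) = 1 := by
      obtain ⟨m, rfl⟩ := Nat.exists_eq_add_of_le hn
      rw [show (4 - 2 * ((2 + m : ℕ) : ℤ)) = -((2 * m : ℕ) : ℤ) by push_cast; ring, zpow_neg,
        zpow_natCast, Nat.add_sub_cancel_left, pow_mul]
      norm_num
    rw [hR.self_eq hR₀ (show toLp 2 (a, b) ∈ halfSpace n from hb),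
      harmonicKernel_univ_self (by omega), Complex.ofReal_re, h1, kernelZero_siegelKernel_self,
      him, Nat.sub_sub, toLp_snd]
    push_cast
    linear_combination (-(sphereArea (n - 1) : ℂ) * ((∫ t in Ioi (0 : ℝ), t ^ (n - 2) *
      (poissonMul (2 * b) t * (poissonLaplace (heightMeasure ρ α) t).toReal⁻¹) : ℝ) : ℂ)) * h2
  exact ⟨key, by simpa using key 0⟩
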